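/- Let $d\ge 0$, $T>0$, and let $a_\alpha:[0,T]\times\mathbb R^{d+1}\to\mathbb R$ be given for the multi-indices $\alpha\in\mathbb N_0^{d+1}$ with $|\alpha|\le 2$, such that $a_\alpha(t,\cdot)$ is $C^\infty$ for each $t$. Let $\bar z:[0,T]\to\mathbb R^{d+1}$ be continuous and suppose that $t\mapsto \partial_z^\eta a_\alpha(t,\bar z(t))$ is continuous on $[0,T]$ for all $|\alpha|\le2$ and all $\eta$. For $n\ge0$ put $$a_{\alpha,n}(t,z)=\sum_{|\eta|=n}\frac{1}{\eta!}(z-\bar z(t))^\eta\,\partial_z^\eta a_\alpha(t,\bar z(t)),\qquad \mathcal A_n(t)=\sum_{|\alpha|\le 2}a_{\alpha,n}(t,z)\,\partial_z^\alpha .$$ Let $m(s)$ be the vector with entries $m_j(s)=a_{e_j,0}(s)$, let $A(s)$ be the symmetric matrix with entries $A_{jj}(s)=2a_{2e_j,0}(s)$ and $A_{jl}(s)=a_{e_j+e_l,0}(s)$ for $j\ne l$, and put $\mathbf m(t,s)=\int_t^s m(r)\,dr$, $\mathbf C(t,s)=\int_t^s A(r)\,dr$. Assume that $\mathbf C(t,s)$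 is positive definite whenever $0\le t<s\le T$. A classical solution below is a real function on $[0,T]\times\mathbb R^{d+1}$ that is continuous, satisfies a bound $|w(t,z)|\le Ke^{c|z|}$ there, is $C^2$ in $z$ for each $0\le t<T$, is differentiable in $t$ for $0\le t<T$ (from the right at $t=0$), and satisfies the equation for $0\le t<T$ and the terminal condition at $T$. Let $v_0$ be a classical solution of $$(\partial_t+\mathcal A_0(t))v_0=0,\qquad v_0(T,\cdot)=\phi ,$$ and consider for $n\ge1$ the problems $$(\partial_t+\mathcal A_0(t))v_n+\sum_{k=1}^n\mathcal A_k(t)v_{n-k}=0,\qquad v_n(T,\cdot)=0. \qquad (*)$$ For $n\ge 1$ define $$\mathcal L_n(t,T)=\sum_{k=1}^n\ \sum_{i\in I_{n,k}}\int_t^T dt_1\int_{t_1}^T dt_2\cdots\int_{t_{k-1}}^T dt_k\ \mathcal G_{i_1}(t,t_1)\,\mathcal G_{i_2}(t,t_2)\cdots\mathcal G_{i_k}(t,t_k),$$ where $I_{n,k}$ is the set of $k$-tuples $(i_1,\dots,i_k)$ of positive integers with $i_1+\dots+i_k=n$, and $$\mathcal G_i(t,s)=\sum_{|\alpha|\le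 2}a_{\alpha,i}(s,\mathcal Z(t,s))\,\partial_z^\alpha,\qquad \mathcal Z(t,s)=z+\mathbf m(t,s)+\mathbf C(t,s)\nabla_z ;$$ here the components of $\mathcal Z(t,s)$, which commute on smooth functions, are substituted into the polynomial $a_{\alpha,i}(s,\cdot)$. Then: 1. $v_0(t,\cdot)$ is $C^\infty$ for $0\le t<T$. 2. For $n\ge1$ and $0\le t<T$, $\mathcal L_n(t,T)$ is, on $C^\infty(\mathbb R^{d+1})$, a linear differential operator of finite order with smooth coefficients. 3. With $\mathcal L_k(t,T)v_0(t,\cdot)$ in place of $v_k$ for every $k\ge 1$, the differential equations in $(*)$ hold for all $n\ge1$, $0\le t<T$ and $z\in\mathbb R^{d+1}$. 4. If $n\ge1$ and $v_1,\dots,v_n$ are classical solutions of $(*)$ for the orders $1,\dots,n$, then $$v_n(t,z)=\mathcal L_n(t,T)\,v_0(t,z)\qquad\text{for all } 0\le t<T,\ z\in\mathbb R^{d+1}.$$ -/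

import Mathlib

open Set
open scoped ContDiff

noncomputable section

namespace PolyExpansion

/-- The state space `ℝ^{d+1}` of `z = (x, y₁, …, y_d)`. -/
abbrev Space (d : ℕ) : Type := Fin (d + 1) → ℝ

/-- Multi-indices `α = (α₁, …, α_{d+1})`. -/
abbrev MultiIndex (d : ℕ) : Type := Fin (d + 1) → ℕ

/-- Operators acting on real functions of `z`. -/
abbrev Op (d : ℕ) : Type := (Space d → ℝ) → (Space d → ℝ)

variable {d : ℕ}

/-- The multi-indices `α` with `|α| = n`. -/
def indicesOfOrder (d n : ℕ) : Finset (MultiIndex d) :=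
  Finset.piAntidiag Finset.univ n

/-- The multi-indices `α` with `|α| ≤ 2`. -/
def indicesLeTwo (d : ℕ) : Finset (MultiIndex d) :=
  (Finset.range 3).biUnion (indicesOfOrder d)

/-- The factorial `α! = ∏ⱼ αⱼ!`. -/
def multiFactorial (α : MultiIndex d) : ℕ := ∏ j, (α j).factorial

/-- The ordered composition `B₁^{α₁} ∘ B₂^{α₂} ∘ ⋯ ∘ B_{d+1}^{α_{d+1}}` of powers of operators. -/
def opMonomial (B : Fin (d + 1) → Op d) (α : MultiIndex d) : Op d := fun f =>
  (List.finRange (d + 1)).foldr (fun j g => (B j)^[α j] g) f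

/-- The partial derivative `∂_{z_j}`. -/
def partialDeriv (j : Fin (d + 1)) : Op d := fun f z => fderiv ℝ f z (Pi.single j 1)

/-- The partial derivative `∂_z^α`. -/
def multiDeriv (α : MultiIndex d) : Op d := opMonomial partialDeriv α

/-- `a_{α,n}(t,z) = ∑_{|η| = n} (1/η!) (z - z̄(t))^η ∂_z^η a_α(t, z̄(t))`. -/
def taylorCoeff (a : MultiIndex d → ℝ → Space d → ℝ) (zbar : ℝ → Space d)
    (α : MultiIndex d) (n : ℕ) (t : ℝ) (z : Space d) : ℝ :=
  ∑ η ∈ indicesOfOrder d n,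
    (1 / (multiFactorial η : ℝ)) * (∏ j, (z j - zbar t j) ^ η j) *
      multiDeriv η (a α t) (zbar t)

/-- `𝒜_n(t) = ∑_{|α| ≤ 2} a_{α,n}(t,z) ∂_z^α`. -/
def generatorTerm (a : MultiIndex d → ℝ → Space d → ℝ) (zbar : ℝ → Space d)
    (n : ℕ) (t : ℝ) : Op d := fun f z =>
  ∑ α ∈ indicesLeTwo d, taylorCoeff a zbar α n t z * multiDeriv α f z

/-- The instantaneous drift vector `m(s)`, with entries `a_{e_j,0}(s) = a_{e_j}(s, z̄(s))`. -/
def driftVec (a : MultiIndex d → ℝ → Space d → ℝ) (zbar : ℝ → Space d) (s : ℝ) : Space d :=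
  fun j => a (Pi.single j 1) s (zbar s)

/-- The instantaneous covariance matrix `A(s)`: `2 a_{2e_j,0}(s)` on the diagonal and
`a_{e_j+e_l,0}(s)` off the diagonal. -/
def covMatrix (a : MultiIndex d → ℝ → Space d → ℝ) (zbar : ℝ → Space d) (s : ℝ) :
    Matrix (Fin (d + 1)) (Fin (d + 1)) ℝ :=
  Matrix.of fun j l =>
    (if j = l then 2 else 1) * a (Pi.single j 1 + Pi.single l 1) s (zbar s)

/-- `𝐦(t,s) = ∫_t^s m(r) dr`. -/
def meanInt (a : MultiIndex d → ℝ → Space d → ℝ) (zbar : ℝ → Space d) (t s : ℝ) : Space d :=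
  fun j => ∫ r in t..s, driftVec a zbar r j

/-- `𝐂(t,s) = ∫_t^s A(r) dr`. -/
def covInt (a : MultiIndex d → ℝ → Space d → ℝ) (zbar : ℝ → Space d) (t s : ℝ) :
    Matrix (Fin (d + 1)) (Fin (d + 1)) ℝ :=
  Matrix.of fun j l => ∫ r in t..s, covMatrix a zbar r j l

/-- The `j`-th component of `𝒵(t,s) - z̄(s)`, where `𝒵(t,s) = z + 𝐦(t,s) + 𝐂(t,s) ∇_z`. -/
def centeredZ (a : MultiIndex d → ℝ → Space d → ℝ) (zbar : ℝ → Space d) (t s : ℝ)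
    (j : Fin (d + 1)) : Op d := fun f z =>
  (z j + meanInt a zbar t s j) * f z + (∑ l, covInt a zbar t s j l * partialDeriv l f z)
    - zbar s j * f z

/-- The operator `a_{α,n}(s, 𝒵(t,s))`: the polynomial `a_{α,n}(s, ·)` with the components of
`𝒵(t,s)` substituted for those of `z`. On smooth functions these components commute with each
other, because `𝐂(t,s)` is symmetric, so the order of the factors is immaterial. -/
def taylorOp (a : MultiIndex d → ℝ → Space d → ℝ) (zbar : ℝ → Space d)
    (α : MultiIndex d) (n : ℕ) (t s : ℝ) : Op d := fun f z =>
  ∑ η ∈ indicesOfOrder d n,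
    (1 / (multiFactorial η : ℝ)) * multiDeriv η (a α s) (zbar s) *
      opMonomial (centeredZ a zbar t s) η f z

/-- `𝒢_n(t,s) = ∑_{|α| ≤ 2} a_{α,n}(s, 𝒵(t,s)) ∂_z^α`. -/
def gOp (a : MultiIndex d → ℝ → Space d → ℝ) (zbar : ℝ → Space d)
    (n : ℕ) (t s : ℝ) : Op d := fun f z =>
  ∑ α ∈ indicesLeTwo d, taylorOp a zbar α n t s (multiDeriv α f) z

/-- `I_{n,k}`: the `k`-tuples of positive integers with sum `n`. -/
def compositions (n k : ℕ) : Finset (Fin k → ℕ) :=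
  (Finset.piAntidiag Finset.univ n).filter fun i => ∀ j, 1 ≤ i j

/-- `𝒢_{i₁}(t,t₁) ∘ 𝒢_{i₂}(t,t₂) ∘ ⋯ ∘ 𝒢_{i_k}(t,t_k)`. -/
def gProd (a : MultiIndex d → ℝ → Space d → ℝ) (zbar : ℝ → Space d) {k : ℕ}
    (i : Fin k → ℕ) (t : ℝ) (τ : Fin k → ℝ) : Op d := fun f =>
  (List.finRange k).foldr (fun j g => gOp a zbar (i j) t (τ j) g) f

/-- `∫_t^T dt₁ ∫_{t₁}^T dt₂ ⋯ ∫_{t_{k-1}}^T dt_k F(t₁, …, t_k)`. -/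
def iteratedIntegral (T : ℝ) : (k : ℕ) → ℝ → ((Fin k → ℝ) → ℝ) → ℝ
  | 0, _, F => F Fin.elim0
  | k + 1, t, F => ∫ s in t..T, iteratedIntegral T k s fun τ => F (Fin.cons s τ)

/-- `𝓛_n(t,T)`. -/
def lOp (a : MultiIndex d → ℝ → Space d → ℝ) (zbar : ℝ → Space d)
    (n : ℕ) (t T : ℝ) : Op d := fun f z =>
  ∑ k ∈ Finset.Icc 1 n, ∑ i ∈ compositions n k,
    iteratedIntegral T k t fun τ => gProd a zbar i t τ f z

/-- `L` is, on smooth functions, a linear differential operator of finite order with smooth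
coefficients. -/
def IsLinearDiffOp (L : Op d) : Prop :=
  ∃ (B : Finset (MultiIndex d)) (c : MultiIndex d → Space d → ℝ),
    (∀ β ∈ B, ContDiff ℝ ∞ (c β)) ∧
    ∀ f : Space d → ℝ, ContDiff ℝ ∞ f → ∀ z, L f z = ∑ β ∈ B, c β z * multiDeriv β f z

/-- `w` satisfies `(∂_t + A(t)) w(t,·) + h(t,·) = 0` pointwise for `0 ≤ t < T`
(the time derivative at `t = 0` is the right derivative). -/
def SolvesPDE (T : ℝ) (A : ℝ → Op d) (h w : ℝ → Space d → ℝ) : Prop :=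
  ∀ t ∈ Ico 0 T, ∀ z,
    HasDerivWithinAt (fun s => w s z) (-(A t (w t) z + h t z)) (Icc 0 T) t

/-- `w` is a classical solution, of at most exponential growth in `z` uniformly in `t`, of the
terminal value problem `(∂_t + A(t)) w(t,·) + h(t,·) = 0` for `0 ≤ t < T`, `w(T,·) = g`. -/
structure IsClassicalSolution (T : ℝ) (A : ℝ → Op d) (h : ℝ → Space d → ℝ) (g : Space d → ℝ)
    (w : ℝ → Space d → ℝ) : Prop where
  continuousOn : ContinuousOn (fun p : ℝ × Space d => w p.1 p.2) (Icc 0 T ×ˢ univ)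
  contDiff : ∀ t ∈ Ico 0 T, ContDiff ℝ 2 (w t)
  growth : ∃ K c : ℝ, ∀ t ∈ Icc 0 T, ∀ z, |w t z| ≤ K * Real.exp (c * ‖z‖)
  pde : SolvesPDE T A h w
  terminal : w T = g

/-- The source term `∑_{k=1}^n 𝒜_k(t) v_{n-k}(t,·)` of the `n`-th order equation. -/
def sourceTerm (a : MultiIndex d → ℝ → Space d → ℝ) (zbar : ℝ → Space d)
    (v : ℕ → ℝ → Space d → ℝ) (n : ℕ) (t : ℝ) (z : Space d) : ℝ :=
  ∑ k ∈ Finset.Icc 1 n, generatorTerm a zbar k t (v (n - k) t) z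

/-- `v₀` for `n = 0`, and `𝓛_n(t,T) v₀(t,·)` for `n ≥ 1`. -/
def expansionTerm (a : MultiIndex d → ℝ → Space d → ℝ) (zbar : ℝ → Space d) (T : ℝ)
    (v₀ : ℝ → Space d → ℝ) (n : ℕ) (t : ℝ) : Space d → ℝ :=
  if n = 0 then v₀ t else lOp a zbar n t T (v₀ t)

end PolyExpansion

end

/-!
With the coefficients frozen along `z̄`, the operator `𝒜_0(t)` depends on time only. Multiplication
by `z_j` at time `s`, conjugated by the flow of `∂_t + 𝒜_0`, is the operator `𝒵_j(t,s)`, which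
therefore commutes with `∂_t + 𝒜_0(t)` for fixed `s`; so does `𝒢_n(t,s)`. In `∂_t 𝓛_n(t,T) v₀` only
the lower limit of the outermost integral contributes beyond `-𝒜_0`, and it gives
`-∑_k 𝒢_k(t,t) 𝓛_{n-k}(t,T) v₀ = -∑_k 𝒜_k(t) 𝓛_{n-k}(t,T) v₀` because `𝒵(t,t) = z`.

To apply operators of every order to `v₀` one needs `v₀` smooth. Terminal values are approximated in
a weighted uniform norm by trigonometric polynomials, for which the equation is solved explicitly,
and Bernstein's method together with the maximum principle bounds all derivatives before time `T`;
positive definiteness of `𝐂(t,s)` enters here. Uniqueness follows from the maximum principle with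
the barrier `∑ⱼ cosh (κ zⱼ)`.
-/

noncomputable section

open Filter Topology

namespace PolyExpansion

variable {d : ℕ}

/-! ### Smooth functions and their differential operators -/

theorem contDiff_partialDeriv {m n : WithTop ℕ∞} {f : Space d → ℝ} (hf : ContDiff ℝ n f)
    (hmn : m + 1 ≤ n) (j : Fin (d + 1)) : ContDiff ℝ m (partialDeriv j f) :=
  (hf.fderiv_right hmn).clm_apply contDiff_const

theorem partialDeriv_add {f g : Space d → ℝ} (hf : Differentiable ℝ f) (hg : Differentiable ℝ g)
    (j : Fin (d + 1)) : partialDeriv j (f + g) = partialDeriv j f + partialDeriv j g := by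
  ext z
  simp only [partialDeriv, Pi.add_apply, fderiv_add (hf z) (hg z), add_apply]

theorem partialDeriv_smul {f : Space d → ℝ} (hf : Differentiable ℝ f) (c : ℝ)
    (j : Fin (d + 1)) : partialDeriv j (c • f) = c • partialDeriv j f := by
  ext z
  simp only [partialDeriv, Pi.smul_apply, fderiv_const_smul (hf z), smul_apply]

theorem partialDeriv_partialDeriv {f : Space d → ℝ} (hf : ContDiff ℝ 2 f) (i j : Fin (d + 1))
    (z : Space d) : partialDeriv i (partialDeriv j f) z =
      fderiv ℝ (fderiv ℝ f) z (Pi.single i 1) (Pi.single j 1) := by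
  have hf' : DifferentiableAt ℝ (fderiv ℝ f) z :=
    (hf.fderiv_right (m := 1) (by norm_num)).differentiable one_ne_zero z
  change fderiv ℝ (fun y => fderiv ℝ f y (Pi.single j 1)) z (Pi.single i 1) = _
  rw [(hf'.hasFDerivAt.clm_apply (hasFDerivAt_const (Pi.single j (1 : ℝ) : Space d) z)).fderiv]
  simp

theorem partialDeriv_comm {f : Space d → ℝ} (hf : ContDiff ℝ 2 f) (i j : Fin (d + 1)) :
    partialDeriv i (partialDeriv j f) = partialDeriv j (partialDeriv i f) := by
  ext z
  rw [partialDeriv_partialDeriv hf, partialDeriv_partialDeriv hf]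
  exact hf.contDiffAt.isSymmSndFDerivAt (by simp) _ _

/-- The algebra of smooth real functions on `Space d`. Differential operators with smooth
coefficients act on it as linear endomorphisms, so that they can be composed without checking
differentiability at every step. -/
def smoothAlgebra (d : ℕ) : Subalgebra ℝ (Space d → ℝ) where
  carrier := {f | ContDiff ℝ ∞ f}
  mul_mem' {_ _} (hf : ContDiff ℝ ∞ _) (hg : ContDiff ℝ ∞ _) := hf.mul hg
  add_mem' {_ _} (hf : ContDiff ℝ ∞ _) (hg : ContDiff ℝ ∞ _) := hf.add hg
  algebraMap_mem' r := show ContDiff ℝ ∞ fun _ => r from contDiff_const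

/-- Smooth real functions on `Space d`. -/
abbrev SmoothFn (d : ℕ) : Type := smoothAlgebra d

/-- Linear operators on smooth functions. -/
abbrev SmoothOp (d : ℕ) : Type := Module.End ℝ (SmoothFn d)

theorem SmoothFn.contDiff (f : SmoothFn d) : ContDiff ℝ ∞ (f : Space d → ℝ) := f.2

theorem SmoothFn.contDiff_two (f : SmoothFn d) : ContDiff ℝ 2 (f : Space d → ℝ) :=
  f.contDiff.of_le (WithTop.coe_le_coe.2 le_top)

theorem SmoothFn.differentiable (f : SmoothFn d) : Differentiable ℝ (f : Space d → ℝ) :=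
  f.contDiff.differentiable (by simp)

@[simp] theorem SmoothFn.coe_sum {ι : Type*} (s : Finset ι) (f : ι → SmoothFn d) (z : Space d) :
    ((∑ i ∈ s, f i : SmoothFn d) : Space d → ℝ) z = ∑ i ∈ s, (f i : Space d → ℝ) z := by
  rw [AddSubmonoidClass.coe_finsetSum, Finset.sum_apply]

/-- The partial derivative `∂_{z_j}` as an operator on smooth functions. -/
def derivOp (j : Fin (d + 1)) : SmoothOp d where
  toFun f := ⟨partialDeriv j f, contDiff_partialDeriv (m := ∞) f.contDiff (by simp) j⟩
  map_add' f g := Subtype.ext (partialDeriv_add f.differentiable g.differentiable j)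
  map_smul' c f := Subtype.ext (partialDeriv_smul f.differentiable c j)

theorem coe_derivOp (j : Fin (d + 1)) (f : SmoothFn d) :
    (derivOp j f : Space d → ℝ) = partialDeriv j f := rfl

/-- The coordinate function `z ↦ z_j`. -/
def coordFn (j : Fin (d + 1)) : SmoothFn d :=
  ⟨fun z => z j, show ContDiff ℝ ∞ fun z : Space d => z j from contDiff_apply ℝ ℝ j⟩

@[simp] theorem coordFn_apply (j : Fin (d + 1)) (z : Space d) :
    (coordFn j : Space d → ℝ) z = z j := rfl

/-- Multiplication by a smooth function, as an operator. -/
abbrev mulOp (g : SmoothFn d) : SmoothOp d := LinearMap.mulLeft ℝ g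

/-- Multiplication by the coordinate `z_j`, as an operator. -/
abbrev coordOp (j : Fin (d + 1)) : SmoothOp d := mulOp (coordFn j)

theorem derivOp_mul (j : Fin (d + 1)) (f g : SmoothFn d) :
    derivOp j (f * g) = f * derivOp j g + g * derivOp j f := by
  ext z
  simp only [coe_derivOp, partialDeriv, Subalgebra.coe_mul, Subalgebra.coe_add, Pi.add_apply,
    Pi.mul_apply]
  rw [fderiv_mul (f.differentiable z) (g.differentiable z)]
  simp

theorem derivOp_coordFn (i j : Fin (d + 1)) :
    derivOp i (coordFn j : SmoothFn d) = if i = j then 1 else 0 := by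
  ext z
  have hj : HasFDerivAt (fun z : Space d => z j) (ContinuousLinearMap.proj (R := ℝ) j) z :=
    hasFDerivAt_apply j z
  simp only [coe_derivOp, partialDeriv, coordFn]
  rw [hj.fderiv]
  by_cases h : i = j
  · subst h; simp
  · simp [h]

theorem derivOp_mul_mulOp (j : Fin (d + 1)) (g : SmoothFn d) :
    derivOp j * mulOp g = mulOp g * derivOp j + mulOp (derivOp j g) := by
  ext1 f
  simp only [Module.End.mul_apply, LinearMap.add_apply, LinearMap.mulLeft_apply, derivOp_mul]
  rw [mul_comm f]

theorem derivOp_mul_coordOp (i j : Fin (d + 1)) :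
    (derivOp i * coordOp j : SmoothOp d) = coordOp j * derivOp i + if i = j then 1 else 0 := by
  rw [coordOp, derivOp_mul_mulOp, derivOp_coordFn]
  split_ifs
  · ext1 f; simp
  · ext1 f; simp

theorem commute_derivOp (i j : Fin (d + 1)) : Commute (derivOp i : SmoothOp d) (derivOp j) := by
  ext1 f
  exact Subtype.ext (partialDeriv_comm f.contDiff_two i j)

/-! ### Multi-indices and ordered monomials -/

theorem MultiIndex.exists_eq_add_single {β : MultiIndex d} (hβ : β ≠ 0) :
    ∃ (γ : MultiIndex d) (j : Fin (d + 1)), β = γ + Pi.single j 1 := by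
  obtain ⟨j, hj⟩ := Function.ne_iff.1 hβ
  refine ⟨β - Pi.single j 1, j, (tsub_add_cancel_of_le ?_).symm⟩
  exact update_le_iff.2 ⟨Nat.one_le_iff_ne_zero.2 hj, fun i _ => Nat.zero_le _⟩

@[elab_as_elim]
theorem MultiIndex.induction {p : MultiIndex d → Prop} (zero : p 0)
    (add_single : ∀ β j, p β → p (β + Pi.single j 1)) (β : MultiIndex d) : p β := by
  induction hn : ∑ j, β j generalizing β with
  | zero => rwa [show β = 0 from funext fun j => Finset.sum_eq_zero_iff.1 hn j (Finset.mem_univ j)]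
  | succ n ih =>
    obtain ⟨γ, j, rfl⟩ := MultiIndex.exists_eq_add_single (β := β) (by rintro rfl; simp at hn)
    refine add_single γ j (ih γ ?_)
    simpa [Finset.sum_add_distrib] using hn

/-- The ordered monomial `b₁^{β₁} ⋯ b_{d+1}^{β_{d+1}}` in possibly noncommuting elements. -/
def ordPow {R : Type*} [Monoid R] (b : Fin (d + 1) → R) (β : MultiIndex d) : R :=
  ((List.finRange (d + 1)).map fun j => b j ^ β j).prod

section ordPow

variable {R : Type*} [Monoid R] {b : Fin (d + 1) → R}

theorem ordPow_zero (b : Fin (d + 1) → R) : ordPow b 0 = 1 := by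
  simp [ordPow]

theorem prod_map_pow_add_single {ι : Type*} [DecidableEq ι] {b : ι → R}
    (β : ι → ℕ) {j : ι} (hb : ∀ i, Commute (b i) (b j)) {l : List ι} (hl : l.Nodup) :
    (l.map fun i => b i ^ (β + Pi.single j 1 : ι → ℕ) i).prod =
      (if j ∈ l then b j else 1) * (l.map fun i => b i ^ β i).prod := by
  induction l with
  | nil => simp
  | cons i l ih =>
    obtain ⟨hi, hl⟩ := List.nodup_cons.1 hl
    simp only [List.map_cons, List.prod_cons, ih hl, List.mem_cons]
    by_cases hij : j = i
    · subst hij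
      simp [hi, pow_succ', mul_assoc]
    · have hc : Commute (b i ^ β i) (b j) := (hb i).pow_left _
      by_cases hjl : j ∈ l
      · simp [hij, hjl, ← mul_assoc, hc.eq]
      · simp [hij, hjl]

theorem ordPow_add_single (β : MultiIndex d) {j : Fin (d + 1)} (hb : ∀ i, Commute (b i) (b j)) :
    ordPow b (β + Pi.single j 1) = b j * ordPow b β := by
  simpa [ordPow] using prod_map_pow_add_single β hb (List.nodup_finRange (d + 1))

theorem ordPow_mem {S : Type*} [SetLike S R] [SubmonoidClass S R] {s : S} (hb : ∀ j, b j ∈ s)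
    (β : MultiIndex d) : ordPow b β ∈ s := by
  refine list_prod_mem fun x hx => ?_
  obtain ⟨j, -, rfl⟩ := List.mem_map.1 hx
  exact pow_mem (hb j) _

end ordPow

/-- The derivative `∂_z^β` as an operator on smooth functions. -/
abbrev multiDerivOp (β : MultiIndex d) : SmoothOp d := ordPow derivOp β

theorem multiDerivOp_add_single (β : MultiIndex d) (j : Fin (d + 1)) :
    (multiDerivOp (β + Pi.single j 1) : SmoothOp d) = derivOp j * multiDerivOp β :=
  ordPow_add_single β fun i => commute_derivOp i j

theorem iterate_eq_coe_pow {B : Op d} {b : SmoothOp d}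
    (h : ∀ f : SmoothFn d, B f = (b f : Space d → ℝ)) (n : ℕ) (f : SmoothFn d) :
    B^[n] f = ((b ^ n) f : Space d → ℝ) := by
  induction n generalizing f with
  | zero => rfl
  | succ n ih => rw [Function.iterate_succ_apply, h, ih, pow_succ]; rfl

theorem opMonomial_eq_coe_ordPow {B : Fin (d + 1) → Op d} {b : Fin (d + 1) → SmoothOp d}
    (h : ∀ j, ∀ f : SmoothFn d, B j f = (b j f : Space d → ℝ)) (η : MultiIndex d)
    (f : SmoothFn d) : opMonomial B η f = (ordPow b η f : Space d → ℝ) := by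
  unfold opMonomial ordPow
  induction List.finRange (d + 1) with
  | nil => rfl
  | cons j l ih =>
    rw [List.foldr_cons, ih, iterate_eq_coe_pow (h j), List.map_cons, List.prod_cons]
    rfl

theorem multiDeriv_eq_coe (β : MultiIndex d) (f : SmoothFn d) :
    multiDeriv β f = (multiDerivOp β f : Space d → ℝ) :=
  opMonomial_eq_coe_ordPow (fun _ _ => rfl) β f

/-! ### The maximum principle -/

theorem deriv_deriv_nonpos_of_isLocalMax {g : ℝ → ℝ} {x : ℝ} (hmax : IsLocalMax g x)
    (hg : ContinuousAt g x) : deriv (deriv g) x ≤ 0 := by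
  by_contra! hpos
  have hmin : IsLocalMin g x := isLocalMin_of_deriv_deriv_pos hpos hmax.deriv_eq_zero hg
  have hconst : g =ᶠ[𝓝 x] fun _ => g x := by
    filter_upwards [hmax, hmin] with s hs hs' using le_antisymm hs hs'
  have := hconst.deriv.deriv_eq
  simp only [deriv_const', deriv_const] at this
  exact hpos.ne' this

section Hessian

variable {E : Type*} [NormedAddCommGroup E] [NormedSpace ℝ E] {f : E → ℝ}

theorem deriv_deriv_comp_line (hf : ContDiff ℝ 2 f) (z h : E) :
    deriv (deriv fun s : ℝ => f (z + s • h)) 0 = fderiv ℝ (fderiv ℝ f) z h h := by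
  have hline : ∀ s : ℝ, HasDerivAt (fun s : ℝ => z + s • h) h s := fun s => by
    simpa using ((hasDerivAt_id s).smul_const h).const_add z
  have hderiv : (deriv fun s : ℝ => f (z + s • h)) = fun s => fderiv ℝ f (z + s • h) h :=
    funext fun s => ((hf.differentiable two_ne_zero _).hasFDerivAt.comp_hasDerivAt s
      (hline s)).deriv
  have hf' : HasFDerivAt (fderiv ℝ f) (fderiv ℝ (fderiv ℝ f) z) (z + (0 : ℝ) • h) := by
    simpa using ((hf.fderiv_right (m := 1) (by norm_num)).differentiable one_ne_zero z).hasFDerivAt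
  have hcomp : HasDerivAt (fun s : ℝ => fderiv ℝ f (z + s • h)) (fderiv ℝ (fderiv ℝ f) z h) 0 :=
    hf'.comp_hasDerivAt 0 (hline 0)
  rw [hderiv]
  simpa using (hcomp.clm_apply (hasDerivAt_const (0 : ℝ) h)).deriv

theorem fderiv_fderiv_nonpos_of_isLocalMax (hf : ContDiff ℝ 2 f) {z : E} (hz : IsLocalMax f z)
    (h : E) : fderiv ℝ (fderiv ℝ f) z h h ≤ 0 := by
  rw [← deriv_deriv_comp_line hf]
  have hline : Continuous fun s : ℝ => z + s • h := by fun_prop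
  have hz' : IsLocalMax (fun s : ℝ => f (z + s • h)) 0 :=
    IsLocalMax.comp_continuous (f := f) (by simpa using hz) hline.continuousAt
  exact deriv_deriv_nonpos_of_isLocalMax hz' (hf.continuous.comp hline).continuousAt

end Hessian

section QuadraticForm

variable {n : Type*} [Fintype n]

theorem dotProduct_mulVec_eq_sum (A : Matrix n n ℝ) (x : n → ℝ) :
    star x ⬝ᵥ A.mulVec x = ∑ j, ∑ l, A j l * (x j * x l) := by
  simp only [dotProduct, Matrix.mulVec, Finset.mul_sum, star_trivial]
  exact Finset.sum_congr rfl fun j _ => Finset.sum_congr rfl fun l _ => by ring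

theorem posSemidef_iff_sum {A : Matrix n n ℝ} :
    A.PosSemidef ↔ (∀ j l, A j l = A l j) ∧ ∀ x : n → ℝ, 0 ≤ ∑ j, ∑ l, A j l * (x j * x l) := by
  simp only [Matrix.posSemidef_iff_dotProduct_mulVec, dotProduct_mulVec_eq_sum]
  refine and_congr_left fun _ => ⟨fun h j l => ?_, fun h => ?_⟩
  · simpa using h.apply l j
  · ext j l; simpa using h l j

theorem sum_mul_nonneg_of_posSemidef {A H : Matrix n n ℝ}
    (hA : A.PosSemidef) (hH : H.PosSemidef) : 0 ≤ ∑ j, ∑ l, A j l * H j l := by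
  simpa using (posSemidef_iff_sum.1 (hA.hadamard hH)).2 fun _ => 1

end QuadraticForm

theorem fderiv_fderiv_eq_sum {f : Space d → ℝ} (hf : ContDiff ℝ 2 f) (z x : Space d) :
    fderiv ℝ (fderiv ℝ f) z x x =
      ∑ j, ∑ l, partialDeriv j (partialDeriv l f) z * (x j * x l) := by
  have hx : x = ∑ j, x j • (Pi.single j (1 : ℝ) : Space d) := by
    ext i; simp [Finset.sum_apply, Pi.single_apply]
  conv_lhs => rw [hx]
  simp only [map_sum, map_smul, sum_apply, smul_apply,
    smul_eq_mul, partialDeriv_partialDeriv hf, Finset.mul_sum]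
  rw [Finset.sum_comm]
  exact Finset.sum_congr rfl fun j _ => Finset.sum_congr rfl fun l _ => by ring

theorem posSemidef_neg_hessian_of_isLocalMax {f : Space d → ℝ} (hf : ContDiff ℝ 2 f)
    {z : Space d} (hz : IsLocalMax f z) :
    (Matrix.of fun j l => -partialDeriv j (partialDeriv l f) z).PosSemidef := by
  refine posSemidef_iff_sum.2 ⟨fun j l => ?_, fun x => ?_⟩
  · simp [partialDeriv_comm hf j l]
  · have := fderiv_fderiv_nonpos_of_isLocalMax hf hz x
    simp only [Matrix.of_apply, neg_mul, Finset.sum_neg_distrib]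
    rw [← fderiv_fderiv_eq_sum hf]
    linarith

/-- Coefficients of a second order operator that are frozen in space, i.e. continuous functions of
time only: a rate, a drift vector and a positive semidefinite diffusion matrix. -/
structure FrozenCoeff (d : ℕ) where
  rate : ℝ → ℝ
  drift : ℝ → Space d
  cov : ℝ → Matrix (Fin (d + 1)) (Fin (d + 1)) ℝ
  continuous_rate : Continuous rate
  continuous_drift : ∀ j, Continuous fun t => drift t j
  continuous_cov : ∀ j l, Continuous fun t => cov t j l
  posSemidef_cov : ∀ t, (cov t).PosSemidef

theorem FrozenCoeff.cov_symm (q : FrozenCoeff d) (t : ℝ) (j l : Fin (d + 1)) :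
    q.cov t j l = q.cov t l j :=
  (posSemidef_iff_sum.1 (q.posSemidef_cov t)).1 j l

/-- The generator `rate + drift · ∇ + (1/2) tr (cov ∇²)`, for functions that need not be smooth;
`genOp` is its restriction to smooth functions. -/
def genFn (q : FrozenCoeff d) (t : ℝ) : Op d := fun f z =>
  q.rate t * f z + ∑ j, q.drift t j * partialDeriv j f z +
    (1 / 2) * ∑ j, ∑ l, q.cov t j l * partialDeriv j (partialDeriv l f) z

theorem genFn_add (q : FrozenCoeff d) (t : ℝ) {f g : Space d → ℝ} (hf : ContDiff ℝ 2 f)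
    (hg : ContDiff ℝ 2 g) : genFn q t (f + g) = genFn q t f + genFn q t g := by
  have hf' := fun l => (contDiff_partialDeriv (m := 1) hf le_rfl l).differentiable one_ne_zero
  have hg' := fun l => (contDiff_partialDeriv (m := 1) hg le_rfl l).differentiable one_ne_zero
  ext z
  simp only [genFn, Pi.add_apply, partialDeriv_add (hf' _) (hg' _),
    partialDeriv_add (hf.differentiable two_ne_zero) (hg.differentiable two_ne_zero), mul_add,
    Finset.sum_add_distrib]
  ring

theorem genFn_smul (q : FrozenCoeff d) (t c : ℝ) {f : Space d → ℝ} (hf : ContDiff ℝ 2 f) :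
    genFn q t (c • f) = c • genFn q t f := by
  have hf' := fun l => (contDiff_partialDeriv (m := 1) hf le_rfl l).differentiable one_ne_zero
  ext z
  simp only [genFn, Pi.smul_apply, smul_eq_mul, partialDeriv_smul (hf' _),
    partialDeriv_smul (hf.differentiable two_ne_zero), mul_left_comm _ c, ← Finset.mul_sum]
  ring

theorem genFn_sub_smul (q : FrozenCoeff d) (t c : ℝ) {f g : Space d → ℝ} (hf : ContDiff ℝ 2 f)
    (hg : ContDiff ℝ 2 g) : genFn q t (f - c • g) = genFn q t f - c • genFn q t g := by
  have hg' : ContDiff ℝ 2 ((-c) • g) := contDiff_const.mul hg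
  rw [sub_eq_add_neg, ← neg_smul, genFn_add q t hf hg', genFn_smul q t _ hg, neg_smul,
    sub_eq_add_neg]

theorem genFn_le_of_isLocalMax (q : FrozenCoeff d) (t : ℝ) {f : Space d → ℝ}
    (hf : ContDiff ℝ 2 f) {z : Space d} (hz : IsLocalMax f z) :
    genFn q t f z ≤ q.rate t * f z := by
  have hgrad : ∀ j, partialDeriv j f z = 0 := fun j => by simp [partialDeriv, hz.fderiv_eq_zero]
  have hhess := sum_mul_nonneg_of_posSemidef (q.posSemidef_cov t)
    (posSemidef_neg_hessian_of_isLocalMax hf hz)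
  simp only [Matrix.of_apply, mul_neg, Finset.sum_neg_distrib] at hhess
  simp only [genFn, hgrad, mul_zero, Finset.sum_const_zero]
  linarith

/-- The class `C^{1,2}` of parabolic theory: `w` is continuous on `[t₀, t₁] × ℝ^{d+1}`, and before
time `t₁` it is `C²` in space and has time derivative `w'`. -/
structure IsC12On (t₀ t₁ : ℝ) (w w' : ℝ → Space d → ℝ) : Prop where
  continuousOn : ContinuousOn (fun p : ℝ × Space d => w p.1 p.2) (Icc t₀ t₁ ×ˢ univ)
  contDiff : ∀ t ∈ Ico t₀ t₁, ContDiff ℝ 2 (w t)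
  hasDerivWithinAt : ∀ t ∈ Ico t₀ t₁, ∀ z,
    HasDerivWithinAt (fun s => w s z) (w' t z) (Icc t₀ t₁) t

namespace IsC12On

variable {t₀ t₁ : ℝ} {w w' u u' : ℝ → Space d → ℝ}

theorem mono_right (hw : IsC12On t₀ t₁ w w') {t₂ : ℝ} (h : t₂ ≤ t₁) : IsC12On t₀ t₂ w w' where
  continuousOn := hw.continuousOn.mono (prod_mono_left (Icc_subset_Icc_right h))
  contDiff t ht := hw.contDiff t (Ico_subset_Ico_right h ht)
  hasDerivWithinAt t ht z :=
    (hw.hasDerivWithinAt t (Ico_subset_Ico_right h ht) z).mono (Icc_subset_Icc_right h)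

theorem const_smul (hw : IsC12On t₀ t₁ w w') (c : ℝ) :
    IsC12On t₀ t₁ (fun t => c • w t) (fun t => c • w' t) where
  continuousOn := continuousOn_const.mul hw.continuousOn
  contDiff t ht := contDiff_const.smul (hw.contDiff t ht)
  hasDerivWithinAt t ht z := (hw.hasDerivWithinAt t ht z).const_mul c

theorem sub (hw : IsC12On t₀ t₁ w w') (hu : IsC12On t₀ t₁ u u') :
    IsC12On t₀ t₁ (fun t => w t - u t) (fun t => w' t - u' t) where
  continuousOn := hw.continuousOn.sub hu.continuousOn
  contDiff t ht := (hw.contDiff t ht).sub (hu.contDiff t ht)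
  hasDerivWithinAt t ht z := (hw.hasDerivWithinAt t ht z).sub (hu.hasDerivWithinAt t ht z)

theorem deriv_add_mul_nonpos_of_isMax (hw : IsC12On t₀ t₁ w w') {M s : ℝ} {y : Space d}
    (hs : s ∈ Ico t₀ t₁)
    (hmax : ∀ r ∈ Icc t₀ t₁, Real.exp (M * r) * w r y ≤ Real.exp (M * s) * w s y) :
    w' s y + M * w s y ≤ 0 := by
  have hsub : Icc s t₁ ⊆ Icc t₀ t₁ := Icc_subset_Icc_left hs.1
  have hexp : HasDerivAt (fun r => Real.exp (M * r)) (Real.exp (M * s) * M) s := by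
    simpa using ((hasDerivAt_id s).const_mul M).exp
  have hder := hexp.hasDerivWithinAt.mul ((hw.hasDerivWithinAt s hs y).mono hsub)
  have htangent : t₁ - s ∈ posTangentConeAt (Icc s t₁) s :=
    sub_mem_posTangentConeAt_of_segment_subset (segment_eq_Icc hs.2.le).subset
  have hslope := IsLocalMaxOn.hasFDerivWithinAt_nonpos
    (Filter.eventually_of_mem self_mem_nhdsWithin fun r hr => hmax r (hsub hr))
    hder.hasFDerivWithinAt htangent
  simp only [ContinuousLinearMap.toSpanSingleton_apply, smul_eq_mul] at hslope
  have hfactor : (t₁ - s) * Real.exp (M * s) * (w' s y + M * w s y) ≤ 0 := by linarith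
  exact nonpos_of_mul_nonpos_right hfactor (mul_pos (sub_pos.2 hs.2) (Real.exp_pos _))

end IsC12On

theorem exists_isMaxOn_of_nonpos_outside_ball {X E : Type*} [TopologicalSpace X] [T2Space X]
    [NormedAddCommGroup E] [ProperSpace E] {I : Set X} (hI : IsCompact I) {U : X × E → ℝ}
    (hU : ContinuousOn U (I ×ˢ univ)) {R : ℝ} (hR : ∀ p ∈ I ×ˢ univ, R ≤ ‖p.2‖ → U p ≤ 0)
    {p : X × E} (hp : p ∈ I ×ˢ univ) (hpos : 0 < U p) :
    ∃ p₀ ∈ I ×ˢ univ, IsMaxOn U (I ×ˢ univ) p₀ := by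
  refine hU.exists_isMaxOn' (hI.isClosed.prod isClosed_univ) hp ?_
  rw [eventually_inf_principal]
  filter_upwards [(hI.prod (isCompact_closedBall (0 : E) R)).compl_mem_cocompact] with x hx hxI
  refine (hR x hxI (le_of_not_ge fun h => hx ⟨hxI.1, ?_⟩)).trans hpos.le
  simpa using h

theorem nonpos_of_strict_subsolution (q : FrozenCoeff d) {t₀ t₁ M R : ℝ}
    {w w' : ℝ → Space d → ℝ} (hw : IsC12On t₀ t₁ w w') (hM : ∀ t ∈ Icc t₀ t₁, q.rate t ≤ M)
    (hsub : ∀ t ∈ Ico t₀ t₁, ∀ z, 0 < w' t z + genFn q t (w t) z)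
    (hR : ∀ t ∈ Icc t₀ t₁, ∀ z, R ≤ ‖z‖ → w t z ≤ 0) (hterm : ∀ z, w t₁ z ≤ 0) :
    ∀ t ∈ Icc t₀ t₁, ∀ z, w t z ≤ 0 := by
  intro t ht z
  by_contra! hpos
  let U : ℝ × Space d → ℝ := fun p => Real.exp (M * p.1) * w p.1 p.2
  have hU : ContinuousOn U (Icc t₀ t₁ ×ˢ univ) :=
    (by fun_prop : Continuous fun p : ℝ × Space d => Real.exp (M * p.1)).continuousOn.mul
      hw.continuousOn
  have hUpos : 0 < U (t, z) := mul_pos (Real.exp_pos _) hpos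
  obtain ⟨⟨s, y⟩, ⟨hs, -⟩, hmax⟩ := exists_isMaxOn_of_nonpos_outside_ball isCompact_Icc hU
    (fun p hp h => mul_nonpos_of_nonneg_of_nonpos (Real.exp_pos _).le (hR p.1 hp.1 p.2 h))
    (⟨ht, mem_univ z⟩ : (t, z) ∈ Icc t₀ t₁ ×ˢ univ) hUpos
  have hmax' : ∀ r ∈ Icc t₀ t₁, ∀ x, U (r, x) ≤ U (s, y) := fun r hr x => hmax ⟨hr, mem_univ x⟩
  have hwpos : 0 < w s y :=
    pos_of_mul_pos_right (hUpos.trans_le (hmax' t ht z)) (Real.exp_pos _).le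
  have hst : s < t₁ := hs.2.lt_of_ne fun h => (hterm y).not_gt (h ▸ hwpos)
  have htime := hw.deriv_add_mul_nonpos_of_isMax ⟨hs.1, hst⟩ fun r hr => hmax' r hr y
  have hspace := genFn_le_of_isLocalMax q s (hw.contDiff s ⟨hs.1, hst⟩) <|
    Eventually.of_forall fun x => le_of_mul_le_mul_left (hmax' s hs x) (Real.exp_pos _)
  have hrate := mul_le_mul_of_nonneg_right (hM s hs) hwpos.le
  linarith [hsub s ⟨hs.1, hst⟩ y]

/-! ### Functions of exponential growth -/

/-- `|w(t,z)| ≤ K e^{c‖z‖}`, uniformly in `t ∈ s`. -/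
def HasExpGrowthOn {E : Type*} [NormedAddCommGroup E] (s : Set ℝ) (w : ℝ → E → ℝ) : Prop :=
  ∃ K c : ℝ, ∀ t ∈ s, ∀ z, |w t z| ≤ K * Real.exp (c * ‖z‖)

namespace HasExpGrowthOn

variable {E : Type*} [NormedAddCommGroup E] {s : Set ℝ} {w u : ℝ → E → ℝ}

theorem mono {s' : Set ℝ} (hw : HasExpGrowthOn s w) (h : s' ⊆ s) : HasExpGrowthOn s' w :=
  let ⟨K, c, hw⟩ := hw
  ⟨K, c, fun t ht => hw t (h ht)⟩

theorem exists_nonneg (hw : HasExpGrowthOn s w) : ∃ K c : ℝ, 0 ≤ K ∧ 0 ≤ c ∧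
    ∀ t ∈ s, ∀ z, |w t z| ≤ K * Real.exp (c * ‖z‖) := by
  obtain ⟨K, c, hw⟩ := hw
  refine ⟨|K|, |c|, abs_nonneg _, abs_nonneg _, fun t ht z => (hw t ht z).trans ?_⟩
  gcongr <;> exact le_abs_self _

theorem add (hw : HasExpGrowthOn s w) (hu : HasExpGrowthOn s u) :
    HasExpGrowthOn s fun t z => w t z + u t z := by
  obtain ⟨K, c, hK, -, hw⟩ := hw.exists_nonneg
  obtain ⟨L, b, hL, -, hu⟩ := hu.exists_nonneg
  refine ⟨K + L, max c b, fun t ht z => ?_⟩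
  calc |w t z + u t z| ≤ K * Real.exp (c * ‖z‖) + L * Real.exp (b * ‖z‖) :=
        (abs_add_le _ _).trans (add_le_add (hw t ht z) (hu t ht z))
    _ ≤ K * Real.exp (max c b * ‖z‖) + L * Real.exp (max c b * ‖z‖) := by
        gcongr
        exacts [le_max_left c b, le_max_right c b]
    _ = _ := by ring

theorem mul (hw : HasExpGrowthOn s w) (hu : HasExpGrowthOn s u) :
    HasExpGrowthOn s fun t z => w t z * u t z := by
  obtain ⟨K, c, hK, -, hw⟩ := hw.exists_nonneg
  obtain ⟨L, b, -, -, hu⟩ := hu.exists_nonneg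
  refine ⟨K * L, c + b, fun t ht z => ?_⟩
  rw [abs_mul, add_mul, Real.exp_add]
  exact (mul_le_mul (hw t ht z) (hu t ht z) (abs_nonneg _) (by positivity)).trans_eq (by ring)

theorem of_continuousOn (hs : IsCompact s) {b : ℝ → ℝ} (hb : ContinuousOn b s) :
    HasExpGrowthOn s fun t (_ : E) => b t := by
  obtain ⟨C, hC⟩ := hs.exists_bound_of_continuousOn hb
  exact ⟨C, 0, fun t ht z => by simpa using hC t ht⟩

theorem const_mul (hw : HasExpGrowthOn s w) (b : ℝ) : HasExpGrowthOn s fun t z => b * w t z :=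
  HasExpGrowthOn.mul ⟨|b|, 0, fun _ _ _ => by simp⟩ hw

theorem sub (hw : HasExpGrowthOn s w) (hu : HasExpGrowthOn s u) :
    HasExpGrowthOn s fun t z => w t z - u t z := by
  simpa [sub_eq_add_neg] using hw.add (hu.const_mul (-1))

theorem sum {ι : Type*} {J : Finset ι} {w : ι → ℝ → E → ℝ}
    (hw : ∀ i ∈ J, HasExpGrowthOn s (w i)) : HasExpGrowthOn s fun t z => ∑ i ∈ J, w i t z := by
  classical
  induction J using Finset.induction_on with
  | empty => exact ⟨0, 0, fun t _ z => by simp⟩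
  | insert i J hi ih =>
    simp only [Finset.sum_insert hi]
    exact (hw i (J.mem_insert_self i)).add (ih fun l hl => hw l (Finset.mem_insert_of_mem hl))

end HasExpGrowthOn

/-- The weight `∑ⱼ cosh (κ zⱼ)`, which dominates exponentials `e^{c‖z‖}` with `c < κ`. -/
def weight (κ : ℝ) (z : Space d) : ℝ := ∑ j, Real.cosh (κ * z j)

theorem contDiff_weight {n : WithTop ℕ∞} (κ : ℝ) : ContDiff ℝ n (weight (d := d) κ) :=
  ContDiff.sum fun j _ => Real.contDiff_cosh.comp (contDiff_const.mul (contDiff_apply _ _ j))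

theorem weight_pos (κ : ℝ) (z : Space d) : 0 < weight κ z :=
  Finset.sum_pos (fun _ _ => Real.cosh_pos _) Finset.univ_nonempty

theorem exp_norm_le_weight {κ : ℝ} (hκ : 0 ≤ κ) (z : Space d) :
    Real.exp (κ * ‖z‖) ≤ 2 * weight κ z := by
  obtain ⟨j, -, hj⟩ := Finset.exists_max_image Finset.univ (fun j => ‖z j‖) Finset.univ_nonempty
  have hz : ‖z‖ ≤ |z j| := (pi_norm_le_iff_of_nonneg (norm_nonneg _)).2
    fun i => hj i (Finset.mem_univ i)
  have hcosh : Real.exp (κ * |z j|) ≤ 2 * Real.cosh (κ * z j) := by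
    rw [← Real.cosh_abs, abs_mul, abs_of_nonneg hκ, Real.cosh_eq]
    linarith [Real.exp_pos (-(κ * |z j|))]
  have hle : Real.cosh (κ * z j) ≤ weight κ z :=
    Finset.single_le_sum (f := fun j => Real.cosh (κ * z j))
      (fun _ _ => (Real.cosh_pos _).le) (Finset.mem_univ j)
  calc Real.exp (κ * ‖z‖) ≤ Real.exp (κ * |z j|) := by gcongr
    _ ≤ 2 * weight κ z := by linarith

theorem weight_le_exp_norm {κ : ℝ} (hκ : 0 ≤ κ) (z : Space d) :
    weight κ z ≤ (d + 1) * Real.exp (κ * ‖z‖) := by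
  have hcosh : ∀ j ∈ Finset.univ, Real.cosh (κ * z j) ≤ Real.exp (κ * ‖z‖) := by
    intro j _
    calc Real.cosh (κ * z j) = Real.cosh (κ * |z j|) := by
          rw [← Real.cosh_abs, abs_mul, abs_of_nonneg hκ]
      _ ≤ Real.exp (κ * |z j|) := by
          rw [Real.cosh_eq]
          linarith [Real.exp_le_exp.2 (neg_le_self (by positivity : 0 ≤ κ * |z j|))]
      _ ≤ Real.exp (κ * ‖z‖) := by gcongr; exact norm_le_pi_norm z j
  simpa [weight] using Finset.sum_le_card_nsmul _ _ _ hcosh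

theorem exists_radius_exp_le_weight {c κ : ℝ} (hκ : 0 ≤ κ) (hc : c < κ) (K : ℝ) {ε : ℝ}
    (hε : 0 < ε) : ∃ R : ℝ, ∀ z : Space d, R ≤ ‖z‖ →
      K * Real.exp (c * ‖z‖) ≤ ε * weight κ z := by
  have hlim : Tendsto (fun x : ℝ => Real.exp ((κ - c) * x)) atTop atTop :=
    Real.tendsto_exp_atTop.comp (tendsto_id.const_mul_atTop (sub_pos.2 hc))
  obtain ⟨R, hR⟩ := eventually_atTop.1 (hlim.eventually_ge_atTop (2 * K / ε))
  refine ⟨R, fun z hz => ?_⟩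
  have hfar : 2 * K ≤ Real.exp ((κ - c) * ‖z‖) * ε := (div_le_iff₀ hε).1 (hR _ hz)
  have hsplit : Real.exp ((κ - c) * ‖z‖) * Real.exp (c * ‖z‖) ≤ 2 * weight κ z := by
    rw [← Real.exp_add, ← add_mul, sub_add_cancel]
    exact exp_norm_le_weight hκ z
  linarith [mul_le_mul_of_nonneg_right hfar (Real.exp_pos (c * ‖z‖)).le,
    mul_le_mul_of_nonneg_left hsplit hε.le]

theorem hasFDerivAt_comp_mul_apply {g : ℝ → ℝ} {g' κ : ℝ} {z : Space d} {j : Fin (d + 1)}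
    (hg : HasDerivAt g g' (κ * z j)) :
    HasFDerivAt (fun z : Space d => g (κ * z j))
      ((g' * κ) • (ContinuousLinearMap.proj j : Space d →L[ℝ] ℝ)) z := by
  have hlin : HasFDerivAt (fun z : Space d => κ * z j)
      (κ • (ContinuousLinearMap.proj j : Space d →L[ℝ] ℝ)) z :=
    (hasFDerivAt_apply j z).const_mul κ
  exact (hg.comp_hasFDerivAt z hlin).congr_fderiv (smul_smul _ _ _)

theorem partialDeriv_weight (κ : ℝ) (j : Fin (d + 1)) :
    partialDeriv j (weight (d := d) κ) = fun z => κ * Real.sinh (κ * z j) := by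
  ext z
  have h : HasFDerivAt (weight (d := d) κ) (∑ l, (Real.sinh (κ * z l) * κ) •
      (ContinuousLinearMap.proj l : Space d →L[ℝ] ℝ)) z :=
    HasFDerivAt.fun_sum fun l _ => hasFDerivAt_comp_mul_apply (Real.hasDerivAt_cosh _)
  simp [partialDeriv, h.fderiv, Pi.single_apply, mul_comm]

theorem partialDeriv_partialDeriv_weight (κ : ℝ) (j l : Fin (d + 1)) (z : Space d) :
    partialDeriv j (partialDeriv l (weight (d := d) κ)) z =
      if j = l then κ ^ 2 * Real.cosh (κ * z j) else 0 := by
  have h := (hasFDerivAt_comp_mul_apply (κ := κ) (z := z) (j := l)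
    (Real.hasDerivAt_sinh _)).const_mul κ
  rw [partialDeriv_weight, partialDeriv, h.fderiv]
  rcases eq_or_ne j l with rfl | hjl
  · simp; ring
  · simp [hjl, hjl.symm]

/-! ### Comparison for subsolutions of exponential growth -/

/-- `B` bounds the rate, the drift and the variances on the time set `s`. -/
structure FrozenCoeff.BoundedOn (q : FrozenCoeff d) (B : ℝ) (s : Set ℝ) : Prop where
  rate : ∀ t ∈ s, |q.rate t| ≤ B
  drift : ∀ t ∈ s, ∀ j, |q.drift t j| ≤ B
  cov : ∀ t ∈ s, ∀ j, |q.cov t j j| ≤ B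

theorem FrozenCoeff.BoundedOn.mono {q : FrozenCoeff d} {B : ℝ} {s s' : Set ℝ}
    (hq : q.BoundedOn B s) (h : s' ⊆ s) : q.BoundedOn B s' :=
  ⟨fun t ht => hq.rate t (h ht), fun t ht => hq.drift t (h ht), fun t ht => hq.cov t (h ht)⟩

/-- A growth rate that makes `e^{λ(t₁-t)}` times the weight a supersolution. -/
def growthRate (B κ : ℝ) : ℝ := B * (1 + κ + κ ^ 2) + 1

theorem growthRate_nonneg {B κ : ℝ} (hB : 0 ≤ B) (hκ : 0 ≤ κ) : 0 ≤ growthRate B κ := by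
  unfold growthRate; positivity

/-- The supersolution `e^{λ(t₁-t)} ∑ⱼ cosh (κ zⱼ)` of any equation with coefficients bounded
by `B`. -/
def barrier (B κ t₁ t : ℝ) : Space d → ℝ := Real.exp (growthRate B κ * (t₁ - t)) • weight κ

theorem barrier_pos (B κ t₁ t : ℝ) (z : Space d) : 0 < barrier B κ t₁ t z :=
  mul_pos (Real.exp_pos _) (weight_pos _ _)

theorem barrier_self (B κ t₁ : ℝ) : barrier B κ t₁ t₁ = weight (d := d) κ := by
  simp [barrier]

theorem barrier_anti {B κ t₁ s t : ℝ} (hB : 0 ≤ B) (hκ : 0 ≤ κ) (hst : s ≤ t) (z : Space d) :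
    barrier B κ t₁ t z ≤ barrier B κ t₁ s z := by
  have := growthRate_nonneg hB hκ
  exact mul_le_mul_of_nonneg_right (by gcongr) (weight_pos _ _).le

theorem barrier_mono_right {B κ s t t₁ : ℝ} (hB : 0 ≤ B) (hκ : 0 ≤ κ) (hst : s ≤ t)
    (z : Space d) : barrier B κ s t₁ z ≤ barrier B κ t t₁ z := by
  have := growthRate_nonneg hB hκ
  exact mul_le_mul_of_nonneg_right (by gcongr) (weight_pos _ _).le

theorem hasDerivAt_barrier (B κ t₁ t : ℝ) (z : Space d) :
    HasDerivAt (fun s => barrier B κ t₁ s z) (-growthRate B κ * barrier B κ t₁ t z) t := by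
  have hlin : HasDerivAt (fun s => growthRate B κ * (t₁ - s)) (-growthRate B κ) t := by
    simpa using ((hasDerivAt_id t).const_sub t₁).const_mul (growthRate B κ)
  exact (hlin.exp.mul_const (weight κ z)).congr_deriv
    (by simp only [barrier, Pi.smul_apply, smul_eq_mul]; ring)

theorem isC12On_barrier (B κ t₀ t₁ : ℝ) :
    IsC12On t₀ t₁ (barrier (d := d) B κ t₁) fun t => (-growthRate B κ) • barrier B κ t₁ t where
  continuousOn := by
    have hexp : Continuous fun p : ℝ × Space d => Real.exp (growthRate B κ * (t₁ - p.1)) := by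
      fun_prop
    exact (hexp.mul ((contDiff_weight (n := 0) κ).continuous.comp continuous_snd)).continuousOn
  contDiff _ _ := contDiff_const.mul (contDiff_weight κ)
  hasDerivWithinAt t _ z := (hasDerivAt_barrier B κ t₁ t z).hasDerivWithinAt

theorem hasExpGrowthOn_barrier {B κ t₀ t₁ : ℝ} (hB : 0 ≤ B) (hκ : 0 ≤ κ) :
    HasExpGrowthOn (Icc t₀ t₁) (barrier (d := d) B κ t₁) := by
  refine ⟨Real.exp (growthRate B κ * (t₁ - t₀)) * (d + 1), κ, fun t ht z => ?_⟩
  rw [abs_of_pos (barrier_pos _ _ _ _ _), mul_assoc]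
  exact (barrier_anti hB hκ ht.1 z).trans
    (mul_le_mul_of_nonneg_left (weight_le_exp_norm hκ z) (Real.exp_pos _).le)

theorem genFn_weight_lt {q : FrozenCoeff d} {B κ t : ℝ} {s : Set ℝ} (hq : q.BoundedOn B s)
    (hκ : 0 ≤ κ) (ht : t ∈ s) (z : Space d) :
    genFn q t (weight κ) z < growthRate B κ * weight κ z := by
  have hB : 0 ≤ B := (abs_nonneg _).trans (hq.rate t ht)
  have hcosh : ∀ j, 0 ≤ Real.cosh (κ * z j) := fun j => (Real.cosh_pos _).le
  have hrate : q.rate t * weight κ z ≤ B * weight κ z :=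
    mul_le_mul_of_nonneg_right ((le_abs_self _).trans (hq.rate t ht)) (weight_pos _ _).le
  have hdrift : ∑ j, q.drift t j * partialDeriv j (weight κ) z ≤ B * κ * weight κ z := by
    simp only [partialDeriv_weight, weight, Finset.mul_sum]
    refine Finset.sum_le_sum fun j _ => ?_
    have hsinh : |Real.sinh (κ * z j)| ≤ Real.cosh (κ * z j) := by
      rw [Real.abs_sinh, ← Real.cosh_abs (κ * z j)]
      exact (Real.sinh_lt_cosh _).le
    calc q.drift t j * (κ * Real.sinh (κ * z j))
        ≤ |q.drift t j| * (κ * |Real.sinh (κ * z j)|) := by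
          conv_rhs => rw [← abs_of_nonneg hκ, ← abs_mul, ← abs_mul, abs_of_nonneg hκ]
          exact le_abs_self _
      _ ≤ B * (κ * Real.cosh (κ * z j)) := by gcongr; exact hq.drift t ht j
      _ = B * κ * Real.cosh (κ * z j) := by ring
  have hcov : ∑ j, ∑ l, q.cov t j l * partialDeriv j (partialDeriv l (weight κ)) z ≤
      B * κ ^ 2 * weight κ z := by
    simp only [partialDeriv_partialDeriv_weight, mul_ite, mul_zero, Finset.sum_ite_eq,
      Finset.mem_univ, if_true, weight, Finset.mul_sum, mul_assoc B]
    exact Finset.sum_le_sum fun j _ => mul_le_mul_of_nonneg_right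
      ((le_abs_self _).trans (hq.cov t ht j)) (mul_nonneg (sq_nonneg _) (hcosh j))
  have hnonneg : 0 ≤ B * κ ^ 2 * weight κ z := mul_nonneg (by positivity) (weight_pos _ _).le
  rw [genFn, growthRate]
  linarith [weight_pos κ z]

theorem genFn_barrier_lt {q : FrozenCoeff d} {B κ t t₁ : ℝ} {s : Set ℝ} (hq : q.BoundedOn B s)
    (hκ : 0 ≤ κ) (ht : t ∈ s) (z : Space d) :
    genFn q t (barrier B κ t₁ t) z < growthRate B κ * barrier B κ t₁ t z := by
  rw [barrier, genFn_smul q t _ (contDiff_weight κ), Pi.smul_apply, Pi.smul_apply, smul_eq_mul,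
    smul_eq_mul, mul_left_comm]
  exact mul_lt_mul_of_pos_left (genFn_weight_lt hq hκ ht z) (Real.exp_pos _)

theorem nonpos_of_subsolution {q : FrozenCoeff d} {t₀ t₁ B : ℝ} (hq : q.BoundedOn B (Icc t₀ t₁))
    {w w' : ℝ → Space d → ℝ} (hw : IsC12On t₀ t₁ w w') (hgrowth : HasExpGrowthOn (Icc t₀ t₁) w)
    (hsub : ∀ t ∈ Ico t₀ t₁, ∀ z, 0 ≤ w' t z + genFn q t (w t) z) (hterm : ∀ z, w t₁ z ≤ 0) :
    ∀ t ∈ Icc t₀ t₁, ∀ z, w t z ≤ 0 := by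
  intro t ht z
  have hB : 0 ≤ B := (abs_nonneg _).trans (hq.rate t ht)
  obtain ⟨K, c, -, hc, hKc⟩ := hgrowth.exists_nonneg
  have hκ : 0 ≤ c + 1 := by positivity
  let β := barrier (d := d) B (c + 1) t₁
  have hβ : ∀ s z, 0 < β s z := barrier_pos B (c + 1) t₁
  have hβC12 : IsC12On t₀ t₁ β _ := isC12On_barrier B (c + 1) t₀ t₁
  have hperturbed : ∀ δ > 0, w t z - δ * β t z ≤ 0 := by
    intro δ hδ
    obtain ⟨R, hR⟩ := exists_radius_exp_le_weight (d := d) hκ (lt_add_one c) K hδ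
    refine nonpos_of_strict_subsolution q (M := B) (R := R) (hw.sub (hβC12.const_smul δ))
      (fun s hs => (le_abs_self _).trans (hq.rate s hs)) (fun s hs x => ?_) (fun s hs x hx => ?_)
      (fun x => ?_) t ht z
    · rw [genFn_sub_smul q s δ (hw.contDiff s hs) (hβC12.contDiff s hs)]
      have hgen := mul_lt_mul_of_pos_left
        (genFn_barrier_lt (t₁ := t₁) hq hκ (Ico_subset_Icc_self hs) x) hδ
      simp only [Pi.sub_apply, Pi.smul_apply, smul_eq_mul]
      linarith [hsub s hs x]
    · have hle : weight (c + 1) x ≤ β s x :=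
        barrier_self B (c + 1) t₁ ▸ barrier_anti hB hκ hs.2 x
      have := mul_le_mul_of_nonneg_left hle hδ.le
      exact sub_nonpos.2 (((le_abs_self _).trans (hKc s hs x)).trans ((hR x hx).trans this))
    · exact sub_nonpos.2 ((hterm x).trans (mul_pos hδ (hβ t₁ x)).le)
  refine le_of_forall_pos_le_add fun δ hδ => ?_
  have := hperturbed (δ / β t z) (div_pos hδ (hβ t z))
  rw [div_mul_cancel₀ _ (hβ t z).ne'] at this
  linarith

theorem le_barrier_of_subsolution {q : FrozenCoeff d} {t₀ t₁ B κ ε : ℝ}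
    (hq : q.BoundedOn B (Icc t₀ t₁)) (hκ : 0 ≤ κ) (hε : 0 ≤ ε) {w w' : ℝ → Space d → ℝ}
    (hw : IsC12On t₀ t₁ w w') (hgrowth : HasExpGrowthOn (Icc t₀ t₁) w)
    (hsub : ∀ t ∈ Ico t₀ t₁, ∀ z, 0 ≤ w' t z + genFn q t (w t) z)
    (hterm : ∀ z, w t₁ z ≤ ε * weight κ z) :
    ∀ t ∈ Icc t₀ t₁, ∀ z, w t z ≤ ε * barrier B κ t₁ t z := by
  intro t ht z
  have hB : 0 ≤ B := (abs_nonneg _).trans (hq.rate t ht)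
  have hβ := isC12On_barrier (d := d) B κ t₀ t₁
  have hgrowth' : HasExpGrowthOn (Icc t₀ t₁) fun t => w t - ε • barrier B κ t₁ t := by
    convert hgrowth.add ((hasExpGrowthOn_barrier hB hκ).const_mul (-ε)) using 3 with t z
    simp [sub_eq_add_neg]
  refine sub_nonpos.1 (nonpos_of_subsolution hq (hw.sub (hβ.const_smul ε)) hgrowth'
    (fun s hs x => ?_) (fun x => ?_) t ht z)
  · rw [genFn_sub_smul q s ε (hw.contDiff s hs) (hβ.contDiff s hs)]
    have hgen := mul_le_mul_of_nonneg_left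
      (genFn_barrier_lt (t₁ := t₁) hq hκ (Ico_subset_Icc_self hs) x).le hε
    simp only [Pi.sub_apply, Pi.smul_apply, smul_eq_mul]
    linarith [hsub s hs x]
  · simpa [barrier_self] using hterm x

theorem abs_le_barrier_of_solution {q : FrozenCoeff d} {t₀ t₁ B κ ε : ℝ}
    (hq : q.BoundedOn B (Icc t₀ t₁)) (hκ : 0 ≤ κ) (hε : 0 ≤ ε) {w : ℝ → Space d → ℝ}
    (hw : IsC12On t₀ t₁ w fun t => -genFn q t (w t)) (hgrowth : HasExpGrowthOn (Icc t₀ t₁) w)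
    (hterm : ∀ z, |w t₁ z| ≤ ε * weight κ z) :
    ∀ t ∈ Icc t₀ t₁, ∀ z, |w t z| ≤ ε * barrier B κ t₁ t z := by
  intro t ht z
  have hgrowth' : HasExpGrowthOn (Icc t₀ t₁) fun t => (-1 : ℝ) • w t := hgrowth.const_mul (-1)
  have hupper := le_barrier_of_subsolution hq hκ hε hw hgrowth (fun _ _ _ => by simp)
    (fun z => (le_abs_self _).trans (hterm z)) t ht z
  have hlower := le_barrier_of_subsolution hq hκ hε (hw.const_smul (-1)) hgrowth'
    (fun s hs z => by rw [genFn_smul q s _ (hw.contDiff s hs)]; simp)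
    (fun z => by simpa using (neg_le_abs _).trans (hterm z)) t ht z
  exact abs_le.2 ⟨by simpa [neg_le] using hlower, hupper⟩

/-! ### The generator on smooth functions -/

/-- The operator `rate + drift · ∇ + (1/2) tr (cov ∇²)` on smooth functions. -/
def genOp (q : FrozenCoeff d) (t : ℝ) : SmoothOp d :=
  q.rate t • 1 + ∑ j, q.drift t j • derivOp j +
    (1 / 2 : ℝ) • ∑ j, ∑ l, q.cov t j l • (derivOp j * derivOp l)

theorem coe_genOp (q : FrozenCoeff d) (t : ℝ) (f : SmoothFn d) :
    (genOp q t f : Space d → ℝ) = genFn q t f := by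
  ext z
  simp [genOp, genFn, LinearMap.sum_apply, ← coe_derivOp]

theorem commute_genOp_derivOp (q : FrozenCoeff d) (t : ℝ) (i : Fin (d + 1)) :
    Commute (genOp q t) (derivOp i) := by
  have h : ∀ j, Commute (derivOp j : SmoothOp d) (derivOp i) := fun j => commute_derivOp j i
  refine (((Commute.one_left _).smul_left _).add_left ?_).add_left (Commute.smul_left ?_ _)
  · exact Commute.sum_left _ _ _ fun j _ => (h j).smul_left _
  · exact Commute.sum_left _ _ _ fun j _ => Commute.sum_left _ _ _ fun l _ =>
      ((h j).mul_left (h l)).smul_left _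

/-- The carré du champ `∑ cov_{jl} ∂_j f ∂_l g`. -/
def gradForm (q : FrozenCoeff d) (t : ℝ) (f g : SmoothFn d) : SmoothFn d :=
  ∑ j, ∑ l, q.cov t j l • (derivOp j f * derivOp l g)

theorem gradForm_comm (q : FrozenCoeff d) (t : ℝ) (f g : SmoothFn d) :
    gradForm q t f g = gradForm q t g f := by
  unfold gradForm
  rw [Finset.sum_comm]
  exact Finset.sum_congr rfl fun j _ => Finset.sum_congr rfl fun l _ => by
    rw [q.cov_symm, mul_comm]

theorem genOp_mul (q : FrozenCoeff d) (t : ℝ) (f g : SmoothFn d) :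
    genOp q t (f * g) =
      f * genOp q t g + g * genOp q t f - q.rate t • (f * g) + gradForm q t f g := by
  have hsecond : ∀ j l, derivOp j (derivOp l (f * g)) = f * derivOp j (derivOp l g) +
      g * derivOp j (derivOp l f) + (derivOp j f * derivOp l g + derivOp j g * derivOp l f) := by
    intro j l
    simp only [derivOp_mul, map_add]
    ring
  have hcross : ∑ j, ∑ l, q.cov t j l • (derivOp j f * derivOp l g + derivOp j g * derivOp l f) =
      (2 : ℝ) • gradForm q t f g := by
    simp only [smul_add, Finset.sum_add_distrib, two_smul]
    exact congrArg (gradForm q t f g + ·) (gradForm_comm q t g f)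
  simp only [genOp, LinearMap.add_apply, LinearMap.smul_apply, LinearMap.sum_apply,
    Module.End.mul_apply, Module.End.one_apply, hsecond, smul_add _ (_ + _) (_ + _),
    Finset.sum_add_distrib, hcross]
  simp only [derivOp_mul, smul_add, Finset.sum_add_distrib, mul_add, Finset.mul_sum,
    mul_smul_comm, mul_comm g f]
  module

/-- The same coefficients with twice the rate, which govern products of two solutions. -/
def FrozenCoeff.double (q : FrozenCoeff d) : FrozenCoeff d :=
  { q with rate := fun t => 2 * q.rate t, continuous_rate := q.continuous_rate.const_mul 2 }

theorem FrozenCoeff.BoundedOn.double {q : FrozenCoeff d} {B : ℝ} {s : Set ℝ}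
    (hq : q.BoundedOn B s) : q.double.BoundedOn (2 * B) s where
  rate t ht := by
    have := hq.rate t ht
    simp only [FrozenCoeff.double, abs_mul, abs_two]
    linarith
  drift t ht j := (hq.drift t ht j).trans (by linarith [(abs_nonneg _).trans (hq.drift t ht j)])
  cov t ht j := (hq.cov t ht j).trans (by linarith [(abs_nonneg _).trans (hq.cov t ht j)])

theorem genOp_double_mul (q : FrozenCoeff d) (t : ℝ) (f g : SmoothFn d) :
    genOp q.double t (f * g) = f * genOp q t g + g * genOp q t f + gradForm q t f g := by
  have hdouble : genOp q.double t = genOp q t + q.rate t • 1 := by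
    simp only [genOp, FrozenCoeff.double]
    module
  rw [hdouble, LinearMap.add_apply, genOp_mul, LinearMap.smul_apply, Module.End.one_apply]
  abel

/-! ### Integrated coefficients -/

theorem hasDerivAt_integral_left {g : ℝ → ℝ} (hg : Continuous g) (T t : ℝ) :
    HasDerivAt (fun t => ∫ r in t..T, g r) (-g t) t :=
  intervalIntegral.integral_hasDerivAt_left (hg.intervalIntegrable t T)
    (hg.stronglyMeasurableAtFilter _ _) hg.continuousAt

theorem continuous_integral_left {g : ℝ → ℝ} (hg : Continuous g) (T : ℝ) :
    Continuous fun t => ∫ r in t..T, g r :=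
  continuous_iff_continuousAt.2 fun t => (hasDerivAt_integral_left hg T t).continuousAt

theorem sum_integral_mul {n : Type*} [Fintype n] {c : ℝ → Matrix n n ℝ} {t s : ℝ}
    (hc : ∀ j l, ContinuousOn (fun r => c r j l) (uIcc t s)) (x : n → ℝ) :
    ∑ j, ∑ l, (∫ r in t..s, c r j l) * (x j * x l) =
      ∫ r in t..s, ∑ j, ∑ l, c r j l * (x j * x l) := by
  have hcont : ∀ j l, ContinuousOn (fun r => c r j l * (x j * x l)) (uIcc t s) := fun j l =>
    (hc j l).mul continuousOn_const
  rw [intervalIntegral.integral_finsetSum fun j _ =>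
    (continuousOn_finsetSum _ fun l _ => hcont j l).intervalIntegrable]
  refine Finset.sum_congr rfl fun j _ => ?_
  rw [intervalIntegral.integral_finsetSum fun l _ => (hcont j l).intervalIntegrable]
  exact Finset.sum_congr rfl fun l _ => (intervalIntegral.integral_mul_const _ _).symm

namespace FrozenCoeff

/-- The integrated drift `∫_t^s drift`. -/
def driftInt (q : FrozenCoeff d) (t s : ℝ) : Space d := fun j => ∫ r in t..s, q.drift r j

/-- The integrated covariance `∫_t^s cov`. -/
def covInt (q : FrozenCoeff d) (t s : ℝ) : Matrix (Fin (d + 1)) (Fin (d + 1)) ℝ :=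
  Matrix.of fun j l => ∫ r in t..s, q.cov r j l

variable (q : FrozenCoeff d)

theorem hasDerivAt_driftInt (s t : ℝ) (j : Fin (d + 1)) :
    HasDerivAt (fun t => q.driftInt t s j) (-q.drift t j) t :=
  hasDerivAt_integral_left (q.continuous_drift j) s t

theorem continuous_driftInt (s : ℝ) (j : Fin (d + 1)) : Continuous fun t => q.driftInt t s j :=
  continuous_integral_left (q.continuous_drift j) s

theorem hasDerivAt_covInt (s t : ℝ) (j l : Fin (d + 1)) :
    HasDerivAt (fun t => q.covInt t s j l) (-q.cov t j l) t :=
  hasDerivAt_integral_left (q.continuous_cov j l) s t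

theorem continuous_covInt (s : ℝ) (j l : Fin (d + 1)) : Continuous fun t => q.covInt t s j l :=
  continuous_integral_left (q.continuous_cov j l) s

theorem continuous_driftInt_right (t : ℝ) (j : Fin (d + 1)) :
    Continuous fun s => q.driftInt t s j :=
  intervalIntegral.continuous_primitive
    (fun _ _ => (q.continuous_drift j).intervalIntegrable _ _) t

theorem continuous_covInt_right (t : ℝ) (j l : Fin (d + 1)) :
    Continuous fun s => q.covInt t s j l :=
  intervalIntegral.continuous_primitive
    (fun _ _ => (q.continuous_cov j l).intervalIntegrable _ _) t

theorem covInt_self (t : ℝ) (j l : Fin (d + 1)) : q.covInt t t j l = 0 :=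
  intervalIntegral.integral_same

theorem driftInt_self (t : ℝ) (j : Fin (d + 1)) : q.driftInt t t j = 0 :=
  intervalIntegral.integral_same

theorem driftInt_add (t r s : ℝ) : q.driftInt t s = q.driftInt t r + q.driftInt r s := by
  ext j
  exact (intervalIntegral.integral_add_adjacent_intervals
    ((q.continuous_drift j).intervalIntegrable _ _)
    ((q.continuous_drift j).intervalIntegrable _ _)).symm

theorem covInt_add (t r s : ℝ) : q.covInt t s = q.covInt t r + q.covInt r s := by
  ext j l
  exact (intervalIntegral.integral_add_adjacent_intervals
    ((q.continuous_cov j l).intervalIntegrable _ _)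
    ((q.continuous_cov j l).intervalIntegrable _ _)).symm

theorem covInt_symm (t s : ℝ) (j l : Fin (d + 1)) : q.covInt t s j l = q.covInt t s l j :=
  intervalIntegral.integral_congr fun r _ => q.cov_symm r j l

theorem posSemidef_covInt {t s : ℝ} (hts : t ≤ s) : (q.covInt t s).PosSemidef := by
  refine posSemidef_iff_sum.2 ⟨q.covInt_symm t s, fun x => ?_⟩
  change 0 ≤ ∑ j, ∑ l, (∫ r in t..s, q.cov r j l) * (x j * x l)
  rw [sum_integral_mul fun j l => (q.continuous_cov j l).continuousOn]
  exact intervalIntegral.integral_nonneg hts fun r _ =>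
    (posSemidef_iff_sum.1 (q.posSemidef_cov r)).2 x

theorem sum_covInt_mul_anti {r t s : ℝ} (hrt : r ≤ t) (x : Space d) :
    ∑ j, ∑ l, q.covInt t s j l * (x j * x l) ≤ ∑ j, ∑ l, q.covInt r s j l * (x j * x l) := by
  have := (posSemidef_iff_sum.1 (q.posSemidef_covInt hrt)).2 x
  simp only [q.covInt_add r t s, Matrix.add_apply, add_mul, Finset.sum_add_distrib]
  linarith

end FrozenCoeff

theorem exists_lower_bound_of_posDef {n : Type*} [Fintype n] {C : Matrix n n ℝ}
    (hC : C.PosDef) : ∃ δ : ℝ, 0 < δ ∧ ∀ x : n → ℝ, ∀ i,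
      δ * x i ^ 2 ≤ ∑ j, ∑ l, C j l * (x j * x l) := by
  let Q : (n → ℝ) → ℝ := fun x => ∑ j, ∑ l, C j l * (x j * x l)
  have hQ : Continuous Q := by fun_prop
  have hQ_pos : ∀ x, x ≠ 0 → 0 < Q x := fun x hx => by
    simpa only [dotProduct_mulVec_eq_sum] using hC.dotProduct_mulVec_pos hx
  have hQ_smul : ∀ (c : ℝ) (x : n → ℝ), Q (c • x) = c ^ 2 * Q x := fun c x => by
    simp only [Q, Finset.mul_sum, Pi.smul_apply, smul_eq_mul]
    exact Finset.sum_congr rfl fun j _ => Finset.sum_congr rfl fun l _ => by ring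
  rcases isEmpty_or_nonempty n with hn | hn
  · exact ⟨1, one_pos, fun _ i => isEmptyElim i⟩
  have hne : (Metric.sphere (0 : n → ℝ) 1).Nonempty := NormedSpace.sphere_nonempty.2 zero_le_one
  obtain ⟨y, hy, hmin⟩ := (isCompact_sphere (0 : n → ℝ) 1).exists_isMinOn hne hQ.continuousOn
  have hy0 : 0 < Q y := hQ_pos y (by rintro rfl; simp at hy)
  refine ⟨Q y, hy0, fun x i => ?_⟩
  rcases eq_or_ne x 0 with rfl | hx
  · simp
  have hx' : 0 < ‖x‖ := norm_pos_iff.2 hx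
  have hnormalized : Q y ≤ Q (‖x‖⁻¹ • x) := hmin (by simp [norm_smul, hx'.ne'])
  rw [hQ_smul, inv_pow, ← div_eq_inv_mul, le_div_iff₀ (by positivity)] at hnormalized
  have hcoord : x i ^ 2 ≤ ‖x‖ ^ 2 := by
    simpa using pow_le_pow_left₀ (norm_nonneg _) (norm_le_pi_norm x i) 2
  exact (mul_le_mul_of_nonneg_left hcoord hy0.le).trans hnormalized

/-! ### Trigonometric solutions -/

/-- The exponent of the amplitude of the wave with frequency `ξ`. -/
def waveExponent (q : FrozenCoeff d) (T : ℝ) (ξ : Space d) (t : ℝ) : ℝ :=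
  (∫ r in t..T, q.rate r) - (1 / 2) * ∑ j, ∑ l, q.covInt t T j l * (ξ j * ξ l)

/-- The phase of the wave with frequency `ξ`. -/
def wavePhase (q : FrozenCoeff d) (T : ℝ) (ξ : Space d) (θ t : ℝ) (z : Space d) : ℝ :=
  ∑ j, ξ j * (z j + q.driftInt t T j) + θ

theorem contDiff_wavePhase (q : FrozenCoeff d) (T : ℝ) (ξ : Space d) (θ t : ℝ) :
    ContDiff ℝ ∞ (wavePhase q T ξ θ t) :=
  (ContDiff.sum fun j _ => contDiff_const.mul ((contDiff_apply _ _ j).add contDiff_const)).add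
    contDiff_const

/-- The solution of `∂_t u + genOp u = 0` with terminal value `cos (ξ · z + θ)` at time `T`. -/
def wave (q : FrozenCoeff d) (T : ℝ) (ξ : Space d) (θ : ℝ) (t : ℝ) : SmoothFn d :=
  ⟨fun z => Real.exp (waveExponent q T ξ t) * Real.cos (wavePhase q T ξ θ t z),
    show ContDiff ℝ ∞ _ from
      contDiff_const.mul (Real.contDiff_cos.comp (contDiff_wavePhase q T ξ θ t))⟩

section wave

variable (q : FrozenCoeff d) (T : ℝ) (ξ : Space d) (θ : ℝ)

theorem hasDerivAt_waveExponent (t : ℝ) :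
    HasDerivAt (waveExponent q T ξ)
      (-q.rate t + (1 / 2) * ∑ j, ∑ l, q.cov t j l * (ξ j * ξ l)) t := by
  refine ((hasDerivAt_integral_left q.continuous_rate T t).sub
    ((HasDerivAt.fun_sum fun j _ => HasDerivAt.fun_sum fun l _ =>
      (q.hasDerivAt_covInt T t j l).mul_const _).const_mul _)).congr_deriv ?_
  simp only [neg_mul, Finset.sum_neg_distrib]
  ring

theorem continuous_waveExponent : Continuous (waveExponent q T ξ) :=
  continuous_iff_continuousAt.2 fun t => (hasDerivAt_waveExponent q T ξ t).continuousAt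

theorem hasDerivAt_wavePhase (t : ℝ) (z : Space d) :
    HasDerivAt (fun s => wavePhase q T ξ θ s z) (-∑ j, q.drift t j * ξ j) t := by
  refine ((HasDerivAt.fun_sum fun j _ =>
    ((q.hasDerivAt_driftInt T t j).const_add _).const_mul _).add_const _).congr_deriv ?_
  rw [← Finset.sum_neg_distrib]
  exact Finset.sum_congr rfl fun j _ => by ring

theorem continuous_wavePhase :
    Continuous fun p : ℝ × Space d => wavePhase q T ξ θ p.1 p.2 := by
  have := q.continuous_driftInt T
  unfold wavePhase
  fun_prop

theorem wavePhase_add_angle (θ' t : ℝ) (z : Space d) :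
    wavePhase q T ξ (θ + θ') t z = wavePhase q T ξ θ t z + θ' :=
  (add_assoc _ _ _).symm

theorem wave_add_pi_div_two_apply (t : ℝ) (z : Space d) :
    (wave q T ξ (θ + Real.pi / 2) t : Space d → ℝ) z =
      -(Real.exp (waveExponent q T ξ t) * Real.sin (wavePhase q T ξ θ t z)) := by
  simp only [wave, wavePhase_add_angle, Real.cos_add_pi_div_two, mul_neg]

theorem wave_add_pi (t : ℝ) : wave q T ξ (θ + Real.pi / 2 + Real.pi / 2) t = -wave q T ξ θ t := by
  ext z
  rw [wave_add_pi_div_two_apply, wavePhase_add_angle, Real.sin_add_pi_div_two]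
  rfl

theorem derivOp_wave (t : ℝ) (j : Fin (d + 1)) :
    derivOp j (wave q T ξ θ t) = ξ j • wave q T ξ (θ + Real.pi / 2) t := by
  ext z
  have hphase : HasFDerivAt (wavePhase q T ξ θ t)
      (∑ j, ξ j • (ContinuousLinearMap.proj j : Space d →L[ℝ] ℝ)) z :=
    (HasFDerivAt.fun_sum fun j _ => ((hasFDerivAt_apply j z).add_const _).const_mul _).add_const _
  have hwave := hphase.cos.const_mul (Real.exp (waveExponent q T ξ t))
  rw [Subalgebra.coe_smul, Pi.smul_apply, smul_eq_mul, wave_add_pi_div_two_apply]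
  simp only [coe_derivOp, partialDeriv, wave]
  rw [hwave.fderiv]
  simp only [smul_apply, sum_apply, ContinuousLinearMap.proj_apply, Pi.single_apply, smul_eq_mul,
    mul_ite, mul_one, mul_zero, Finset.sum_ite_eq', Finset.mem_univ, ↓reduceIte]
  ring

theorem genOp_wave (t : ℝ) :
    genOp q t (wave q T ξ θ t) =
      (q.rate t - (1 / 2) * ∑ j, ∑ l, q.cov t j l * (ξ j * ξ l)) • wave q T ξ θ t +
        (∑ j, q.drift t j * ξ j) • wave q T ξ (θ + Real.pi / 2) t := by
  simp only [genOp, LinearMap.add_apply, LinearMap.smul_apply, LinearMap.sum_apply,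
    Module.End.mul_apply, Module.End.one_apply, derivOp_wave, map_smul, wave_add_pi, smul_neg,
    smul_smul, Finset.sum_neg_distrib, ← Finset.sum_smul, fun j l => mul_comm (ξ l) (ξ j)]
  module

theorem hasDerivAt_wave (t : ℝ) (z : Space d) :
    HasDerivAt (fun s => (wave q T ξ θ s : Space d → ℝ) z)
      (-(genOp q t (wave q T ξ θ t) : Space d → ℝ) z) t := by
  refine ((hasDerivAt_waveExponent q T ξ t).exp.mul
    (hasDerivAt_wavePhase q T ξ θ t z).cos).congr_deriv ?_
  rw [genOp_wave]
  simp only [Subalgebra.coe_add, Subalgebra.coe_smul, Pi.add_apply, Pi.smul_apply, smul_eq_mul,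
    wave_add_pi_div_two_apply]
  simp only [wave]
  ring

theorem continuous_wave :
    Continuous fun p : ℝ × Space d => (wave q T ξ θ p.1 : Space d → ℝ) p.2 :=
  (Real.continuous_exp.comp ((continuous_waveExponent q T ξ).comp continuous_fst)).mul
    (Real.continuous_cos.comp (continuous_wavePhase q T ξ θ))

theorem hasExpGrowthOn_wave {s : Set ℝ} (hs : IsCompact s) :
    HasExpGrowthOn s fun t => (wave q T ξ θ t : Space d → ℝ) := by
  have hexp : Continuous fun t => Real.exp (waveExponent q T ξ t) :=
    Real.continuous_exp.comp (continuous_waveExponent q T ξ)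
  exact (HasExpGrowthOn.of_continuousOn hs hexp.continuousOn).mul
    ⟨1, 0, fun t _ z => by simpa using Real.abs_cos_le_one _⟩

end wave

/-- Finite linear combinations of trigonometric solutions. -/
def trigSol (q : FrozenCoeff d) (T : ℝ) : Submodule ℝ (ℝ → SmoothFn d) :=
  Submodule.span ℝ (range fun p : Space d × ℝ => wave q T p.1 p.2)

section trigSol

variable {q : FrozenCoeff d} {T : ℝ} {u : ℝ → SmoothFn d}

theorem derivOp_mem_trigSol (hu : u ∈ trigSol q T) (j : Fin (d + 1)) :
    (fun t => derivOp j (u t)) ∈ trigSol q T := by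
  suffices trigSol q T ≤ (trigSol q T).comap (LinearMap.compLeft (derivOp j) ℝ) from this hu
  refine Submodule.span_le.2 ?_
  rintro _ ⟨⟨ξ, θ⟩, rfl⟩
  have hwave : (fun t => derivOp j (wave q T ξ θ t)) = ξ j • wave q T ξ (θ + Real.pi / 2) :=
    funext fun t => derivOp_wave q T ξ θ t j
  change (fun t => derivOp j (wave q T ξ θ t)) ∈ trigSol q T
  rw [hwave]
  exact Submodule.smul_mem _ _ (Submodule.subset_span ⟨(ξ, θ + Real.pi / 2), rfl⟩)

theorem multiDerivOp_mem_trigSol (hu : u ∈ trigSol q T) (β : MultiIndex d) :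
    (fun t => multiDerivOp β (u t)) ∈ trigSol q T := by
  induction β using MultiIndex.induction with
  | zero => simpa [ordPow_zero] using hu
  | add_single β j ih => simpa [multiDerivOp_add_single] using derivOp_mem_trigSol ih j

theorem continuous_of_mem_trigSol (hu : u ∈ trigSol q T) :
    Continuous fun p : ℝ × Space d => (u p.1 : Space d → ℝ) p.2 := by
  induction hu using Submodule.span_induction with
  | mem x hx =>
    obtain ⟨⟨ξ, θ⟩, rfl⟩ := hx
    exact continuous_wave q T ξ θ
  | zero => exact continuous_const
  | add x y _ _ hx hy => exact hx.add hy
  | smul a x _ hx => exact hx.const_mul a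

theorem hasDerivAt_of_mem_trigSol (hu : u ∈ trigSol q T) (t : ℝ) (z : Space d) :
    HasDerivAt (fun s => (u s : Space d → ℝ) z) (-(genOp q t (u t) : Space d → ℝ) z) t := by
  induction hu using Submodule.span_induction with
  | mem x hx =>
    obtain ⟨⟨ξ, θ⟩, rfl⟩ := hx
    exact hasDerivAt_wave q T ξ θ t z
  | zero => simpa using hasDerivAt_const t (0 : ℝ)
  | add x y _ _ hx hy => exact (hx.add hy).congr_deriv (by simp [add_comm])
  | smul a x _ hx => exact (hx.const_mul a).congr_deriv (by simp)

theorem hasExpGrowthOn_of_mem_trigSol (hu : u ∈ trigSol q T) {s : Set ℝ} (hs : IsCompact s) :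
    HasExpGrowthOn s fun t => (u t : Space d → ℝ) := by
  induction hu using Submodule.span_induction with
  | mem x hx =>
    obtain ⟨⟨ξ, θ⟩, rfl⟩ := hx
    exact hasExpGrowthOn_wave q T ξ θ hs
  | zero => exact ⟨0, 0, by simp⟩
  | add x y _ _ hx hy => exact hx.add hy
  | smul a x _ hx => exact hx.const_mul a

theorem isC12On_of_mem_trigSol (hu : u ∈ trigSol q T) (t₀ t₁ : ℝ) :
    IsC12On t₀ t₁ (fun t => (u t : Space d → ℝ)) fun t => -genFn q t (u t) where
  continuousOn := (continuous_of_mem_trigSol hu).continuousOn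
  contDiff t _ := (u t).contDiff_two
  hasDerivWithinAt t _ z := by
    simpa [coe_genOp] using (hasDerivAt_of_mem_trigSol hu t z).hasDerivWithinAt

end trigSol

/-! ### The gradient estimate -/

/-- Bernstein's auxiliary function `u² + ∑ C_{jl}(t,t₁) ∂_j u ∂_l u`, where
`C(t,t₁) = ∫_t^{t₁} cov`. -/
def bernstein (q : FrozenCoeff d) (t₁ : ℝ) (u : ℝ → SmoothFn d) (t : ℝ) : SmoothFn d :=
  u t * u t + ∑ j, ∑ l, q.covInt t t₁ j l • (derivOp j (u t) * derivOp l (u t))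

/-- The time derivative of `bernstein` along a solution `u`. -/
def bernsteinDeriv (q : FrozenCoeff d) (t₁ : ℝ) (u : ℝ → SmoothFn d) (t : ℝ) : SmoothFn d :=
  (-genOp q t (u t)) * u t + u t * (-genOp q t (u t)) +
    ∑ j, ∑ l, ((-q.cov t j l) • (derivOp j (u t) * derivOp l (u t)) +
      q.covInt t t₁ j l • ((-genOp q t (derivOp j (u t))) * derivOp l (u t) +
        derivOp j (u t) * (-genOp q t (derivOp l (u t)))))

theorem bernstein_apply (q : FrozenCoeff d) (t₁ : ℝ) (u : ℝ → SmoothFn d) (t : ℝ) (z : Space d) :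
    (bernstein q t₁ u t : Space d → ℝ) z = (u t : Space d → ℝ) z * (u t : Space d → ℝ) z +
      ∑ j, ∑ l, q.covInt t t₁ j l *
        ((derivOp j (u t) : Space d → ℝ) z * (derivOp l (u t) : Space d → ℝ) z) := by
  simp [bernstein]

section bernstein

variable {q : FrozenCoeff d} {T : ℝ} {u : ℝ → SmoothFn d}

theorem hasDerivAt_bernstein (hu : u ∈ trigSol q T) (t₁ t : ℝ) (z : Space d) :
    HasDerivAt (fun s => (bernstein q t₁ u s : Space d → ℝ) z)
      ((bernsteinDeriv q t₁ u t : Space d → ℝ) z) t := by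
  simp only [bernstein_apply]
  have hval := hasDerivAt_of_mem_trigSol hu t z
  have hgrad := fun j => hasDerivAt_of_mem_trigSol (derivOp_mem_trigSol hu j) t z
  refine ((hval.mul hval).add (HasDerivAt.fun_sum fun j _ => HasDerivAt.fun_sum fun l _ =>
    (q.hasDerivAt_covInt t₁ t j l).mul ((hgrad j).mul (hgrad l)))).congr_deriv ?_
  simp only [bernsteinDeriv, Subalgebra.coe_add, Subalgebra.coe_mul, Subalgebra.coe_neg,
    Subalgebra.coe_smul, SmoothFn.coe_sum, Pi.add_apply, Pi.mul_apply, Pi.neg_apply,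
    Pi.smul_apply, smul_eq_mul]

theorem isC12On_bernstein (hu : u ∈ trigSol q T) (t₀ t₁ : ℝ) :
    IsC12On t₀ t₁ (fun t => (bernstein q t₁ u t : Space d → ℝ))
      fun t => (bernsteinDeriv q t₁ u t : Space d → ℝ) where
  continuousOn := by
    have hval := continuous_of_mem_trigSol hu
    have hgrad := fun j => continuous_of_mem_trigSol (derivOp_mem_trigSol hu j)
    have hcov := fun j l => (q.continuous_covInt t₁ j l).comp (continuous_fst (Y := Space d))
    simp only [bernstein_apply]
    exact ((hval.mul hval).add (continuous_finsetSum _ fun j _ => continuous_finsetSum _ fun l _ =>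
      (hcov j l).mul ((hgrad j).mul (hgrad l)))).continuousOn
  contDiff t _ := SmoothFn.contDiff_two _
  hasDerivWithinAt t _ z := (hasDerivAt_bernstein hu t₁ t z).hasDerivWithinAt

theorem hasExpGrowthOn_bernstein (hu : u ∈ trigSol q T) (t₁ : ℝ) {s : Set ℝ} (hs : IsCompact s) :
    HasExpGrowthOn s fun t => (bernstein q t₁ u t : Space d → ℝ) := by
  have hval := hasExpGrowthOn_of_mem_trigSol hu hs
  have hgrad := fun j => hasExpGrowthOn_of_mem_trigSol (derivOp_mem_trigSol hu j) hs
  have hcov := fun j l => HasExpGrowthOn.of_continuousOn (E := Space d) hs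
    (q.continuous_covInt t₁ j l).continuousOn
  convert (hval.mul hval).add (HasExpGrowthOn.sum fun j (_ : j ∈ Finset.univ) =>
    HasExpGrowthOn.sum fun l (_ : l ∈ Finset.univ) =>
      (hcov j l).mul ((hgrad j).mul (hgrad l))) using 3 with t z
  exact bernstein_apply q t₁ u t z

theorem genOp_double_bernstein (t₁ t : ℝ) :
    genOp q.double t (bernstein q t₁ u t) = -bernsteinDeriv q t₁ u t +
      ∑ j, ∑ l, q.covInt t t₁ j l • gradForm q t (derivOp j (u t)) (derivOp l (u t)) := by
  simp only [bernstein, map_add, map_sum, map_smul, genOp_double_mul]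
  ext z
  simp only [bernsteinDeriv, gradForm, Subalgebra.coe_add, Subalgebra.coe_mul, Subalgebra.coe_neg,
    Subalgebra.coe_smul, SmoothFn.coe_sum, Pi.add_apply, Pi.mul_apply, Pi.neg_apply,
    Pi.smul_apply, smul_eq_mul]
  rw [neg_add, add_assoc (_ + _) _ _, add_assoc (-_) _ _]
  congr 1
  · ring
  · simp only [← Finset.sum_add_distrib, ← Finset.sum_neg_distrib]
    refine Finset.sum_congr rfl fun j _ => Finset.sum_congr rfl fun l _ => ?_
    ring

theorem sum_covInt_gradForm_nonneg {t t₁ : ℝ} (ht : t ≤ t₁) (f : SmoothFn d) (z : Space d) :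
    0 ≤ ∑ j, ∑ l, q.covInt t t₁ j l *
      (gradForm q t (derivOp j f) (derivOp l f) : Space d → ℝ) z := by
  let H : Matrix (Fin (d + 1)) (Fin (d + 1)) ℝ :=
    Matrix.of fun i j => (derivOp i (derivOp j f) : Space d → ℝ) z
  refine (sum_mul_nonneg_of_posSemidef (q.posSemidef_covInt ht)
    ((q.posSemidef_cov t).conjTranspose_mul_mul_same H)).trans_eq ?_
  refine Finset.sum_congr rfl fun j _ => Finset.sum_congr rfl fun l _ => congrArg _ ?_
  simp only [gradForm, SmoothFn.coe_sum, Subalgebra.coe_smul, Pi.smul_apply, smul_eq_mul,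
    Subalgebra.coe_mul, Pi.mul_apply, Matrix.mul_apply, Matrix.conjTranspose_apply, star_trivial,
    H, Matrix.of_apply, Finset.sum_mul]
  rw [Finset.sum_comm]
  exact Finset.sum_congr rfl fun i _ => Finset.sum_congr rfl fun k _ => by ring

theorem bernstein_le_barrier (hu : u ∈ trigSol q T) {t₀ t₁ B κ ε : ℝ}
    (hq : q.BoundedOn B (Icc t₀ t₁)) (hκ : 0 ≤ κ) (hε : 0 ≤ ε)
    (hterm : ∀ z, (u t₁ : Space d → ℝ) z ^ 2 ≤ ε * weight κ z) :
    ∀ t ∈ Icc t₀ t₁, ∀ z,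
      (bernstein q t₁ u t : Space d → ℝ) z ≤ ε * barrier (2 * B) κ t₁ t z := by
  refine le_barrier_of_subsolution hq.double hκ hε (isC12On_bernstein hu t₀ t₁)
    (hasExpGrowthOn_bernstein hu t₁ isCompact_Icc) (fun t ht z => ?_) fun z => ?_
  · rw [← coe_genOp, genOp_double_bernstein]
    simpa using sum_covInt_gradForm_nonneg ht.2.le (u t) z
  · rw [bernstein_apply]
    simpa [q.covInt_self, ← sq] using hterm z

theorem sq_le_barrier_of_mem_trigSol (hu : u ∈ trigSol q T) {t₀ t₁ B κ ε : ℝ}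
    (hq : q.BoundedOn B (Icc t₀ t₁)) (hκ : 0 ≤ κ) (hε : 0 ≤ ε)
    (hterm : ∀ z, (u t₁ : Space d → ℝ) z ^ 2 ≤ ε * weight κ z) {t : ℝ} (ht : t ∈ Icc t₀ t₁)
    (z : Space d) : (u t : Space d → ℝ) z ^ 2 ≤ ε * barrier (2 * B) κ t₁ t z := by
  have hle := bernstein_le_barrier hu hq hκ hε hterm t ht z
  have hgrad := (posSemidef_iff_sum.1 (q.posSemidef_covInt ht.2)).2 fun j =>
    (derivOp j (u t) : Space d → ℝ) z
  rw [bernstein_apply, ← sq] at hle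
  linarith

theorem derivOp_sq_le_barrier_of_mem_trigSol (hu : u ∈ trigSol q T) {t₀ t₁ B κ ε δ : ℝ}
    (hq : q.BoundedOn B (Icc t₀ t₁)) (hκ : 0 ≤ κ) (hε : 0 ≤ ε)
    (hterm : ∀ z, (u t₁ : Space d → ℝ) z ^ 2 ≤ ε * weight κ z) {t : ℝ} (ht : t ∈ Icc t₀ t₁)
    (hδ : 0 < δ)
    (hlow : ∀ x : Space d, ∀ i, δ * x i ^ 2 ≤ ∑ j, ∑ l, q.covInt t t₁ j l * (x j * x l))
    (j : Fin (d + 1)) (z : Space d) :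
    (derivOp j (u t) : Space d → ℝ) z ^ 2 ≤ δ⁻¹ * (ε * barrier (2 * B) κ t₁ t z) := by
  have hle := bernstein_le_barrier hu hq hκ hε hterm t ht z
  have hgrad := hlow (fun j => (derivOp j (u t) : Space d → ℝ) z) j
  rw [bernstein_apply, ← sq] at hle
  rw [← div_eq_inv_mul, le_div_iff₀ hδ]
  linarith [sq_nonneg ((u t : Space d → ℝ) z)]

/-- The bound involves the terminal value only, so it passes to limits of trigonometric
solutions. -/
theorem exists_multiDerivOp_sq_le {t₀ B κ : ℝ} (hq : q.BoundedOn B (Icc t₀ T)) (hB : 0 ≤ B)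
    (hκ : 0 ≤ κ) (ht₀ : t₀ ≤ 0)
    (hC : ∀ t s : ℝ, 0 ≤ t → t < s → s ≤ T → (q.covInt t s).PosDef) (β : MultiIndex d)
    {T' : ℝ} (hT'₀ : 0 ≤ T') (hT' : T' < T) :
    ∃ K : ℝ, 0 ≤ K ∧ ∀ u ∈ trigSol q T, ∀ ε : ℝ, 0 ≤ ε →
      (∀ z, (u T : Space d → ℝ) z ^ 2 ≤ ε * weight κ z) → ∀ t ∈ Icc t₀ T', ∀ z,
        (multiDerivOp β (u t) : Space d → ℝ) z ^ 2 ≤ K * ε * weight κ z := by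
  have hbarrier : ∀ t₁, ∀ t ∈ Icc t₀ t₁, ∀ z : Space d, barrier (2 * B) κ t₁ t z ≤
      Real.exp (growthRate (2 * B) κ * (t₁ - t₀)) * weight κ z := fun t₁ t ht z =>
    barrier_anti (mul_nonneg zero_le_two hB) hκ ht.1 z
  induction β using MultiIndex.induction generalizing T' with
  | zero =>
    refine ⟨Real.exp (growthRate (2 * B) κ * (T - t₀)), (Real.exp_pos _).le,
      fun u hu ε hε hterm t ht z => ?_⟩
    have htT : t ∈ Icc t₀ T := ⟨ht.1, ht.2.trans hT'.le⟩
    rw [multiDerivOp, ordPow_zero, mul_comm _ ε, mul_assoc]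
    exact (sq_le_barrier_of_mem_trigSol hu hq hκ hε hterm htT z).trans
      (mul_le_mul_of_nonneg_left (hbarrier T t htT z) hε)
  | add_single β j ih =>
    set t₁ := (T' + T) / 2 with ht₁
    obtain ⟨K, hK₀, hK⟩ := ih (T' := t₁) (by linarith) (by linarith)
    obtain ⟨δ, hδ, hlow⟩ := exists_lower_bound_of_posDef
      (hC T' t₁ hT'₀ (by linarith) (by linarith))
    refine ⟨δ⁻¹ * K * Real.exp (growthRate (2 * B) κ * (t₁ - t₀)), by positivity,
      fun u hu ε hε hterm t ht z => ?_⟩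
    have htt₁ : t ∈ Icc t₀ t₁ := ⟨ht.1, ht.2.trans (by linarith)⟩
    rw [multiDerivOp_add_single, Module.End.mul_apply]
    calc _ ≤ δ⁻¹ * (K * ε * barrier (2 * B) κ t₁ t z) :=
          derivOp_sq_le_barrier_of_mem_trigSol (multiDerivOp_mem_trigSol hu β)
            (hq.mono (Icc_subset_Icc_right (by linarith))) hκ (by positivity)
            (hK u hu ε hε hterm t₁ ⟨by linarith, le_rfl⟩) htt₁ hδ
            (fun x i => (hlow x i).trans (q.sum_covInt_mul_anti ht.2 x)) j z
      _ ≤ δ⁻¹ * (K * ε * (Real.exp (growthRate (2 * B) κ * (t₁ - t₀)) * weight κ z)) := by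
          gcongr; exact hbarrier t₁ t htt₁ z
      _ = _ := by ring

end bernstein

/-! ### Weighted density of trigonometric polynomials -/

/-- Linear combinations of the functions `cos (ξ · z + θ)`. -/
def trigPoly (d : ℕ) : Submodule ℝ (Space d → ℝ) :=
  Submodule.span ℝ (range fun p : Space d × ℝ => fun z => Real.cos (∑ j, p.1 j * z j + p.2))

theorem cos_mem_trigPoly (ξ : Space d) (θ : ℝ) :
    (fun z => Real.cos (∑ j, ξ j * z j + θ)) ∈ trigPoly d :=
  Submodule.subset_span ⟨(ξ, θ), rfl⟩

theorem wave_self (q : FrozenCoeff d) (T : ℝ) (ξ : Space d) (θ : ℝ) :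
    (wave q T ξ θ T : Space d → ℝ) = fun z => Real.cos (∑ j, ξ j * z j + θ) := by
  ext z
  simp [wave, waveExponent, wavePhase, FrozenCoeff.covInt, FrozenCoeff.driftInt]

theorem exists_mem_trigSol_eq (q : FrozenCoeff d) (T : ℝ) {p : Space d → ℝ}
    (hp : p ∈ trigPoly d) : ∃ u ∈ trigSol q T, (u T : Space d → ℝ) = p := by
  induction hp using Submodule.span_induction with
  | mem x hx =>
    obtain ⟨⟨ξ, θ⟩, rfl⟩ := hx
    exact ⟨wave q T ξ θ, Submodule.subset_span ⟨(ξ, θ), rfl⟩, wave_self q T ξ θ⟩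
  | zero => exact ⟨0, zero_mem _, rfl⟩
  | add x y _ _ hx hy =>
    obtain ⟨u, hu, rfl⟩ := hx
    obtain ⟨v, hv, rfl⟩ := hy
    exact ⟨u + v, add_mem hu hv, rfl⟩
  | smul a x _ hx =>
    obtain ⟨u, hu, rfl⟩ := hx
    exact ⟨a • u, Submodule.smul_mem _ _ hu, rfl⟩

/-- The point of the torus with coordinates `z_j / (4R) + 1/4`. -/
def toTorus (R : ℝ) (z : Space d) : UnitAddTorus (Fin (d + 1)) :=
  fun j => ((z j / (4 * R) + 1 / 4 : ℝ) : UnitAddCircle)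

/-- The map from the torus to the cube of radius `R` that inverts `toTorus R` on that cube; it
folds the torus, since it depends on the distances `‖x j‖` to `0` only. -/
def ofTorus (R : ℝ) (x : UnitAddTorus (Fin (d + 1))) : Space d :=
  fun j => 4 * R * (‖x j‖ - 1 / 4)

theorem continuous_ofTorus (R : ℝ) : Continuous (ofTorus (d := d) R) := by
  unfold ofTorus
  fun_prop

theorem norm_ofTorus_le {R : ℝ} (hR : 0 ≤ R) (x : UnitAddTorus (Fin (d + 1))) :
    ‖ofTorus R x‖ ≤ R := by
  refine (pi_norm_le_iff_of_nonneg hR).2 fun j => ?_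
  have hhalf : ‖x j‖ ≤ |(1 : ℝ)| / 2 := AddCircle.norm_le_half_period 1 one_ne_zero
  have hnonneg := norm_nonneg (x j)
  rw [abs_one] at hhalf
  simp only [ofTorus, Real.norm_eq_abs]
  rw [abs_le]
  constructor <;> nlinarith

theorem ofTorus_toTorus {R : ℝ} (hR : 0 < R) {z : Space d} (hz : ‖z‖ ≤ R) :
    ofTorus R (toTorus R z) = z := by
  ext j
  obtain ⟨hneg, hpos⟩ := abs_le.1 ((norm_le_pi_norm z j).trans hz)
  have hlower : -(1 / 4) ≤ z j / (4 * R) := by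
    rw [le_div_iff₀ (by positivity)]; linarith
  have hupper : z j / (4 * R) ≤ 1 / 4 := by
    rw [div_le_iff₀ (by positivity)]; linarith
  have hnorm : ‖((z j / (4 * R) + 1 / 4 : ℝ) : UnitAddCircle)‖ = |z j / (4 * R) + 1 / 4| := by
    rw [AddCircle.norm_coe_eq_abs_iff 1 one_ne_zero, abs_one, abs_of_nonneg (by linarith)]
    linarith
  simp only [ofTorus, toTorus]
  rw [hnorm, abs_of_nonneg (by linarith)]
  field_simp
  ring

theorem mFourier_toTorus (R : ℝ) (n : Fin (d + 1) → ℤ) (z : Space d) :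
    UnitAddTorus.mFourier n (toTorus R z) = Complex.exp
      (((∑ j, (2 * Real.pi * n j / (4 * R)) * z j + ∑ j, 2 * Real.pi * n j / 4 : ℝ) : ℂ) *
        Complex.I) := by
  simp only [UnitAddTorus.mFourier, ContinuousMap.coe_mk, toTorus, fourier_coe_apply]
  rw [← Complex.exp_sum, ← Finset.sum_add_distrib]
  push_cast
  rw [Finset.sum_mul]
  exact congrArg _ (Finset.sum_congr rfl fun j _ => by ring)

theorem re_im_mem_trigPoly (R : ℝ) {g : C(UnitAddTorus (Fin (d + 1)), ℂ)}
    (hg : g ∈ Submodule.span ℂ (range (UnitAddTorus.mFourier (d := Fin (d + 1))))) :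
    (fun z => (g (toTorus R z)).re) ∈ trigPoly d ∧
      (fun z => (g (toTorus R z)).im) ∈ trigPoly d := by
  induction hg using Submodule.span_induction with
  | mem x hx =>
    obtain ⟨n, rfl⟩ := hx
    simp only [mFourier_toTorus, Complex.exp_ofReal_mul_I_re, Complex.exp_ofReal_mul_I_im,
      ← Real.cos_sub_pi_div_two, add_sub_assoc]
    exact ⟨cos_mem_trigPoly _ _, cos_mem_trigPoly _ _⟩
  | zero => exact ⟨(trigPoly d).zero_mem, (trigPoly d).zero_mem⟩
  | add x y _ _ hx hy => exact ⟨add_mem hx.1 hy.1, add_mem hx.2 hy.2⟩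
  | smul a x _ hx =>
    exact ⟨(trigPoly d).sub_mem ((trigPoly d).smul_mem a.re hx.1)
        ((trigPoly d).smul_mem a.im hx.2),
      (trigPoly d).add_mem ((trigPoly d).smul_mem a.re hx.2) ((trigPoly d).smul_mem a.im hx.1)⟩

theorem exists_trigPoly_near_folded {φ : Space d → ℝ} (hφ : Continuous φ) (R : ℝ) {ε : ℝ}
    (hε : 0 < ε) : ∃ p ∈ trigPoly d, ∀ z, |φ (ofTorus R (toTorus R z)) - p z| ≤ ε := by
  let G : C(UnitAddTorus (Fin (d + 1)), ℂ) :=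
    ⟨fun x => (φ (ofTorus R x) : ℂ),
      Complex.continuous_ofReal.comp (hφ.comp (continuous_ofTorus R))⟩
  have hG : G ∈ (Submodule.span ℂ
      (range (UnitAddTorus.mFourier (d := Fin (d + 1))))).topologicalClosure := by
    rw [UnitAddTorus.span_mFourier_closure_eq_top]; trivial
  obtain ⟨g, hg, hgG⟩ := Metric.mem_closure_iff.1 hG ε hε
  refine ⟨_, (re_im_mem_trigPoly R hg).1, fun z => ?_⟩
  have hdist := (ContinuousMap.dist_apply_le_dist (f := G) (g := g) (toTorus R z)).trans hgG.le
  rw [dist_eq_norm] at hdist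
  simpa [G] using (Complex.abs_re_le_norm _).trans hdist

theorem one_le_weight (κ : ℝ) (z : Space d) : 1 ≤ weight κ z :=
  (Real.one_le_cosh _).trans (Finset.single_le_sum (f := fun j => Real.cosh (κ * z j))
    (fun _ _ => (Real.cosh_pos _).le) (Finset.mem_univ 0))

theorem exists_trigPoly_near {φ : Space d → ℝ} (hφ : Continuous φ) {K c κ ε : ℝ}
    (hgrowth : ∀ z, |φ z| ≤ K * Real.exp (c * ‖z‖)) (hc : 0 ≤ c) (hκ : c < κ) (hε : 0 < ε) :
    ∃ p ∈ trigPoly d, ∀ z, |φ z - p z| ≤ ε * weight κ z := by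
  obtain ⟨R₀, hR₀⟩ := exists_radius_exp_le_weight (d := d) (hc.trans hκ.le) hκ (K + K + ε) hε
  have hK : 0 ≤ K := by simpa using (abs_nonneg _).trans (hgrowth 0)
  set R : ℝ := max R₀ 1
  have hR : 0 < R := lt_max_of_lt_right one_pos
  obtain ⟨p, hp, hφp⟩ := exists_trigPoly_near_folded hφ R hε
  refine ⟨p, hp, fun z => ?_⟩
  have hfold := hφp z
  rcases le_or_gt ‖z‖ R with hz | hz
  · rw [ofTorus_toTorus hR hz] at hfold
    exact hfold.trans (le_mul_of_one_le_right hε.le (one_le_weight κ z))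
  · have hexp : Real.exp (c * ‖ofTorus R (toTorus R z)‖) ≤ Real.exp (c * ‖z‖) :=
      Real.exp_le_exp.2 (mul_le_mul_of_nonneg_left ((norm_ofTorus_le hR.le _).trans hz.le) hc)
    calc |φ z - p z|
        ≤ |φ z| + |φ (ofTorus R (toTorus R z))| + |φ (ofTorus R (toTorus R z)) - p z| := by
          rw [abs_sub_comm (φ (ofTorus R (toTorus R z)))]
          calc |φ z - p z| = |φ z + -φ (ofTorus R (toTorus R z)) +
                -(p z - φ (ofTorus R (toTorus R z)))| := by ring_nf
            _ ≤ _ := (abs_add_three _ _ _).trans_eq (by rw [abs_neg, abs_neg])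
      _ ≤ K * Real.exp (c * ‖z‖) + K * Real.exp (c * ‖z‖) + ε * Real.exp (c * ‖z‖) := by
          gcongr
          · exact hgrowth z
          · exact (hgrowth _).trans (mul_le_mul_of_nonneg_left hexp hK)
          · exact hfold.trans (le_mul_of_one_le_right hε.le (Real.one_le_exp (by positivity)))
      _ = (K + K + ε) * Real.exp (c * ‖z‖) := by ring
      _ ≤ ε * weight κ z := hR₀ z ((le_max_left _ _).trans hz.le)

/-! ### Limits of trigonometric solutions -/

section JointLimit

variable {ι X E : Type*} [TopologicalSpace X] {l : Filter ι} [l.NeBot] {F : ι → X → E} {g : X → E}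
  {x : X}

theorem continuousAt_of_tendsto_prod [TopologicalSpace E] [RegularSpace E]
    (hx : Tendsto (fun y : ι × X => F y.1 y.2) (l ×ˢ 𝓝 x) (𝓝 (g x)))
    (h : ∀ᶠ y in 𝓝 x, Tendsto (fun n => F n y) l (𝓝 (g y))) : ContinuousAt g x := by
  refine (closed_nhds_basis (g x)).tendsto_right_iff.2 fun s ⟨hs, hclosed⟩ => ?_
  filter_upwards [h, (eventually_swap_iff.1 (hx.eventually_mem hs)).curry] with y hy hFs
  exact hclosed.mem_of_tendsto hy hFs

theorem tendstoUniformlyOnFilter_of_tendsto_prod [UniformSpace E]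
    (hx : Tendsto (fun y : ι × X => F y.1 y.2) (l ×ˢ 𝓝 x) (𝓝 (g x)))
    (h : ∀ᶠ y in 𝓝 x, Tendsto (fun n => F n y) l (𝓝 (g y))) :
    TendstoUniformlyOnFilter F g l (𝓝 x) := by
  rw [tendstoUniformlyOnFilter_iff_tendsto]
  exact (((continuousAt_of_tendsto_prod hx h).tendsto.comp tendsto_snd).prodMk_nhds hx).mono_right
    (nhds_le_uniformity (g x))

end JointLimit

theorem hasDerivAt_of_tendsto_prod {ι : Type*} {l : Filter ι} [l.NeBot] {f f' : ι → ℝ → ℝ}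
    {g g' : ℝ → ℝ} {t : ℝ} (hf : ∀ n s, HasDerivAt (f n) (f' n s) s)
    (hf' : ∀ᶠ s in 𝓝 t, Tendsto (fun x : ι × ℝ => f' x.1 x.2) (l ×ˢ 𝓝 s) (𝓝 (g' s)))
    (hg : ∀ᶠ s in 𝓝 t, Tendsto (fun n => f n s) l (𝓝 (g s))) : HasDerivAt g (g' t) t :=
  hasDerivAt_of_tendstoUniformlyOnFilter
    (tendstoUniformlyOnFilter_of_tendsto_prod hf'.self_of_nhds
      (hf'.mono fun _ hs => hs.comp (tendsto_id.prodMk tendsto_const_nhds)))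
    (.of_forall fun x => hf x.1 x.2) hg

/-- On `I × ℝ^{d+1}`, all space derivatives `∂_z^β u_N` converge to `w_β`, jointly in `N` and
`(t, z)`. In this form of locally uniform convergence, sums and products pass to the limit. -/
def DerivsTendsto (I : Set ℝ) (u : ℕ → ℝ → SmoothFn d)
    (w : MultiIndex d → ℝ → Space d → ℝ) : Prop :=
  ∀ β, ∀ t ∈ I, ∀ z, Tendsto
    (fun x : ℕ × (ℝ × Space d) => (multiDerivOp β (u x.1 x.2.1) : Space d → ℝ) x.2.2)
    (atTop ×ˢ 𝓝 (t, z)) (𝓝 (w β t z))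

theorem multiDerivOp_genOp (q : FrozenCoeff d) (t : ℝ) (β : MultiIndex d) (f : SmoothFn d) :
    multiDerivOp β (genOp q t f) = genOp q t (multiDerivOp β f) := by
  induction β using MultiIndex.induction with
  | zero => simp [ordPow_zero]
  | add_single β j ih =>
    rw [multiDerivOp_add_single, Module.End.mul_apply, Module.End.mul_apply, ih]
    exact (LinearMap.congr_fun (commute_genOp_derivOp q t j).eq _).symm

theorem genOp_multiDerivOp_apply (q : FrozenCoeff d) (t : ℝ) (β : MultiIndex d) (f : SmoothFn d)
    (z : Space d) : (genOp q t (multiDerivOp β f) : Space d → ℝ) z =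
      q.rate t * (multiDerivOp β f : Space d → ℝ) z +
      ∑ j, q.drift t j * (multiDerivOp (β + Pi.single j 1) f : Space d → ℝ) z +
      (1 / 2) * ∑ j, ∑ l, q.cov t j l *
        (multiDerivOp (β + Pi.single l 1 + Pi.single j 1) f : Space d → ℝ) z := by
  simp only [coe_genOp, genFn, multiDerivOp_add_single, Module.End.mul_apply, coe_derivOp]

/-- The linear form `x ↦ ∑ⱼ gⱼ xⱼ`; with `g` a gradient, it is the Fréchet derivative. -/
def linForm (g : Fin (d + 1) → ℝ) : Space d →L[ℝ] ℝ := ∑ j, g j • ContinuousLinearMap.proj j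

theorem linForm_apply (g : Fin (d + 1) → ℝ) (x : Space d) : linForm g x = ∑ j, g j * x j := by
  simp [linForm]

theorem continuous_linForm : Continuous (linForm (d := d)) := by
  unfold linForm
  fun_prop

theorem SmoothFn.hasFDerivAt (f : SmoothFn d) (z : Space d) :
    HasFDerivAt (f : Space d → ℝ) (linForm fun j => (derivOp j f : Space d → ℝ) z) z := by
  convert (f.differentiable z).hasFDerivAt using 1
  refine ContinuousLinearMap.ext fun x => ?_
  have hx : x = ∑ j, x j • (Pi.single j (1 : ℝ) : Space d) := by
    ext i; simp [Finset.sum_apply, Pi.single_apply]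
  conv_rhs => rw [hx]
  simp [linForm_apply, map_sum, coe_derivOp, partialDeriv, mul_comm]

namespace DerivsTendsto

variable {I : Set ℝ} {u : ℕ → ℝ → SmoothFn d} {w : MultiIndex d → ℝ → Space d → ℝ}
  {V : ℝ → SmoothFn d}

theorem tendsto_apply (h : DerivsTendsto I u w) (β : MultiIndex d) {t : ℝ} (ht : t ∈ I)
    (z : Space d) :
    Tendsto (fun N => (multiDerivOp β (u N t) : Space d → ℝ) z) atTop (𝓝 (w β t z)) :=
  (h β t ht z).comp (tendsto_id.prodMk tendsto_const_nhds)

theorem hasFDerivAt (h : DerivsTendsto I u w) (β : MultiIndex d) {t : ℝ} (ht : t ∈ I)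
    (z : Space d) :
    HasFDerivAt (w β t) (linForm fun j => w (β + Pi.single j 1) t z) z := by
  have hslice : Tendsto (fun x : ℕ × Space d => (x.1, (t, x.2))) (atTop ×ˢ 𝓝 z)
      (atTop ×ˢ 𝓝 (t, z)) :=
    tendsto_id.prodMap ((Continuous.prodMk_right t).tendsto z)
  have hunif : TendstoUniformlyOnFilter
      (fun N z => linForm fun j => (multiDerivOp (β + Pi.single j 1) (u N t) : Space d → ℝ) z)
      (fun z => linForm fun j => w (β + Pi.single j 1) t z) atTop (𝓝 z) :=
    tendstoUniformlyOnFilter_of_tendsto_prod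
      ((continuous_linForm.tendsto _).comp
        (tendsto_pi_nhds.2 fun j => (h _ t ht z).comp hslice))
      (.of_forall fun y => (continuous_linForm.tendsto _).comp
        (tendsto_pi_nhds.2 fun j => h.tendsto_apply _ ht y))
  refine hasFDerivAt_of_tendstoUniformlyOnFilter hunif (.of_forall fun x => ?_)
    (.of_forall fun y => h.tendsto_apply β ht y)
  simpa only [multiDerivOp_add_single] using! SmoothFn.hasFDerivAt (multiDerivOp β (u x.1 t)) x.2

theorem contDiff (h : DerivsTendsto I u w) (β : MultiIndex d) {t : ℝ} (ht : t ∈ I) :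
    ContDiff ℝ ∞ (w β t) := by
  refine contDiff_infty.2 fun n => ?_
  induction n generalizing β with
  | zero =>
    exact contDiff_zero.2 (continuous_iff_continuousAt.2 fun z =>
      (h.hasFDerivAt β ht z).continuousAt)
  | succ n ih =>
    push_cast
    exact contDiff_succ_iff_hasFDerivAt.2 ⟨_, ContDiff.sum fun j _ =>
      (ih (β + Pi.single j 1)).smul contDiff_const, h.hasFDerivAt β ht⟩

theorem exists_smoothFn (h : DerivsTendsto I u w) :
    ∃ V : ℝ → SmoothFn d, ∀ β, ∀ t ∈ I, (multiDerivOp β (V t) : Space d → ℝ) = w β t := by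
  classical
  refine ⟨fun t => if ht : t ∈ I then ⟨w 0 t, h.contDiff 0 ht⟩ else 0, fun β t ht => ?_⟩
  induction β using MultiIndex.induction with
  | zero => simp [ordPow_zero, dif_pos ht]
  | add_single β j ih =>
    ext z
    rw [multiDerivOp_add_single, Module.End.mul_apply, coe_derivOp, ih, partialDeriv,
      (h.hasFDerivAt β ht z).fderiv]
    simp [linForm_apply, Pi.single_apply]

theorem continuousOn (hI : IsOpen I) (h : DerivsTendsto I u w) (β : MultiIndex d) :
    ContinuousOn (fun p : ℝ × Space d => w β p.1 p.2) (I ×ˢ univ) := by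
  rintro ⟨t, z⟩ ⟨ht, -⟩
  have hnear : ∀ᶠ x : ℝ × Space d in 𝓝 (t, z), x.1 ∈ I :=
    continuousAt_fst.eventually_mem (hI.mem_nhds ht)
  have hcont : ContinuousAt (fun p : ℝ × Space d => w β p.1 p.2) (t, z) :=
    continuousAt_of_tendsto_prod
      (F := fun N (p : ℝ × Space d) => (multiDerivOp β (u N p.1) : Space d → ℝ) p.2) (h β t ht z)
      (hnear.mono fun x hx => h.tendsto_apply β hx x.2)
  exact hcont.continuousWithinAt

theorem tendsto_genOp (h : DerivsTendsto I u fun β t => multiDerivOp β (V t)) (q : FrozenCoeff d)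
    (β : MultiIndex d) {t : ℝ} (ht : t ∈ I) (z : Space d) :
    Tendsto (fun x : ℕ × (ℝ × Space d) =>
        (genOp q x.2.1 (multiDerivOp β (u x.1 x.2.1)) : Space d → ℝ) x.2.2)
      (atTop ×ˢ 𝓝 (t, z)) (𝓝 ((genOp q t (multiDerivOp β (V t)) : Space d → ℝ) z)) := by
  have htime : Tendsto (fun x : ℕ × (ℝ × Space d) => x.2.1) (atTop ×ˢ 𝓝 (t, z)) (𝓝 t) :=
    continuousAt_fst.tendsto.comp tendsto_snd
  have hcoeff : ∀ {b : ℝ → ℝ}, Continuous b → ∀ γ, Tendsto (fun x : ℕ × (ℝ × Space d) =>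
      b x.2.1 * (multiDerivOp γ (u x.1 x.2.1) : Space d → ℝ) x.2.2) (atTop ×ˢ 𝓝 (t, z))
      (𝓝 (b t * (multiDerivOp γ (V t) : Space d → ℝ) z)) := fun hb γ =>
    ((hb.tendsto t).comp htime).mul (h γ t ht z)
  simp only [genOp_multiDerivOp_apply]
  exact ((hcoeff q.continuous_rate _).add
    (tendsto_finsetSum _ fun j _ => hcoeff (q.continuous_drift j) _)).add
    ((tendsto_finsetSum _ fun j _ => tendsto_finsetSum _ fun l _ =>
      hcoeff (q.continuous_cov j l) _).const_mul _)

theorem hasDerivAt (hI : IsOpen I) (h : DerivsTendsto I u fun β t => multiDerivOp β (V t))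
    {q : FrozenCoeff d} (hu : ∀ N β t z, HasDerivAt
      (fun s => (multiDerivOp β (u N s) : Space d → ℝ) z)
      (-(genOp q t (multiDerivOp β (u N t)) : Space d → ℝ) z) t)
    (β : MultiIndex d) {t : ℝ} (ht : t ∈ I) (z : Space d) :
    HasDerivAt (fun s => (multiDerivOp β (V s) : Space d → ℝ) z)
      (-(genOp q t (multiDerivOp β (V t)) : Space d → ℝ) z) t := by
  have hnear := hI.eventually_mem ht
  refine hasDerivAt_of_tendsto_prod (g' := fun s =>
    -(genOp q s (multiDerivOp β (V s)) : Space d → ℝ) z) (fun N s => hu N β s z)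
    (hnear.mono fun s hs => ?_) (hnear.mono fun s hs => h.tendsto_apply β hs z)
  exact ((h.tendsto_genOp q β hs z).comp
    (tendsto_id.prodMap ((Continuous.prodMk_left z).tendsto s))).neg

end DerivsTendsto

section WeightedCauchy

variable {t₀ T κ : ℝ} {r : ℕ → ℝ} {F : ℕ → ℝ → Space d → ℝ} {w : ℝ → Space d → ℝ}

theorem exists_limit_of_weighted_cauchy (hr : Tendsto r atTop (𝓝 0))
    (hF : ∀ T' < T, ∃ K, ∀ N M, N ≤ M → ∀ t ∈ Icc t₀ T', ∀ z,
      |F N t z - F M t z| ≤ K * r N * weight κ z) :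
    ∃ w : ℝ → Space d → ℝ, ∀ T' < T, ∃ K, ∀ N, ∀ t ∈ Icc t₀ T', ∀ z,
      |w t z - F N t z| ≤ K * r N * weight κ z := by
  refine ⟨fun t z => limUnder atTop fun N => F N t z, fun T' hT' => ?_⟩
  obtain ⟨K, hK⟩ := hF T' hT'
  refine ⟨K, fun N t ht z => ?_⟩
  have hrate : Tendsto (fun N => K * r N * weight κ z) atTop (𝓝 0) := by
    simpa using (hr.const_mul K).mul_const (weight κ z)
  have hlim := (cauchySeq_of_le_tendsto_0' (s := fun N => F N t z)
    (fun N => K * r N * weight κ z) (fun N M hNM => hK N M hNM t ht z) hrate).tendsto_limUnder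
  refine le_of_tendsto (hlim.sub_const _).abs ?_
  filter_upwards [eventually_ge_atTop N] with M hM
  rw [abs_sub_comm]
  exact hK N M hM t ht z

theorem tendsto_prod_of_weighted_bound (hr : Tendsto r atTop (𝓝 0))
    (hF : ∀ N, Continuous fun p : ℝ × Space d => F N p.1 p.2)
    (hw : ∀ T' < T, ∃ K, ∀ N, ∀ t ∈ Icc t₀ T', ∀ z,
      |w t z - F N t z| ≤ K * r N * weight κ z) {t : ℝ} (ht : t ∈ Ioo t₀ T) (z : Space d) :
    Tendsto (fun x : ℕ × (ℝ × Space d) => F x.1 x.2.1 x.2.2) (atTop ×ˢ 𝓝 (t, z))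
      (𝓝 (w t z)) := by
  obtain ⟨T', htT', hT'⟩ := exists_between ht.2
  obtain ⟨K, hK⟩ := hw T' hT'
  have hunif : TendstoUniformlyOnFilter (fun N (p : ℝ × Space d) => F N p.1 p.2)
      (fun p => w p.1 p.2) atTop (𝓝 (t, z)) := by
    rw [tendstoUniformlyOnFilter_iff_tendsto, tendsto_uniformity_iff_dist_tendsto_zero]
    have hrate : Tendsto (fun x : ℕ × (ℝ × Space d) => K * r x.1 * weight κ x.2.2)
        (atTop ×ˢ 𝓝 (t, z)) (𝓝 0) := by
      have hweight : Tendsto (fun x : ℕ × (ℝ × Space d) => weight κ x.2.2)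
          (atTop ×ˢ 𝓝 (t, z)) (𝓝 (weight κ z)) :=
        (((contDiff_weight (n := 0) κ).continuous.comp continuous_snd).tendsto (t, z)).comp
          tendsto_snd
      simpa using ((hr.comp tendsto_fst).const_mul K).mul hweight
    refine squeeze_zero' (.of_forall fun _ => dist_nonneg) ?_ hrate
    have hnear : ∀ᶠ p : ℝ × Space d in 𝓝 (t, z), p.1 ∈ Icc t₀ T' :=
      continuousAt_fst.eventually_mem (Icc_mem_nhds ht.1 htT')
    filter_upwards [tendsto_snd.eventually hnear] with x hx using hK x.1 x.2.1 hx x.2.2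
  have hlim : Tendsto (fun N => F N t z) atTop (𝓝 (w t z)) := by
    have hrate : Tendsto (fun N => K * r N * weight κ z) atTop (𝓝 0) := by
      simpa using (hr.const_mul K).mul_const (weight κ z)
    exact tendsto_iff_dist_tendsto_zero.2 (squeeze_zero (fun _ => dist_nonneg)
      (fun N => (dist_comm _ _).trans_le (hK N t ⟨ht.1.le, htT'.le⟩ z)) hrate)
  have hcont := hunif.tendsto_of_eventually_tendsto
    (.of_forall fun N => (hF N).tendsto (t, z)) hlim
  exact (Uniform.tendsto_congr (tendstoUniformlyOnFilter_iff_tendsto.1 hunif)).1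
    (hcont.comp tendsto_snd)

end WeightedCauchy

theorem weight_sq_le (κ : ℝ) (z : Space d) :
    weight κ z ^ 2 ≤ (d + 1) * weight (2 * κ) z := by
  have hcosh : ∑ j, Real.cosh (κ * z j) ^ 2 ≤ weight (2 * κ) z := by
    refine Finset.sum_le_sum fun j _ => ?_
    rw [mul_assoc, Real.cosh_two_mul]
    linarith [sq_nonneg (Real.sinh (κ * z j))]
  calc weight κ z ^ 2 ≤ (d + 1) * ∑ j, Real.cosh (κ * z j) ^ 2 := by
        simpa [weight] using sq_sum_le_card_mul_sum_sq (s := (Finset.univ : Finset (Fin (d + 1))))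
          (f := fun j => Real.cosh (κ * z j))
    _ ≤ (d + 1) * weight (2 * κ) z := by gcongr

theorem exists_abs_multiDerivOp_le {q : FrozenCoeff d} {T t₀ B κ : ℝ} (hT : 0 < T)
    (hq : q.BoundedOn B (Icc t₀ T)) (hB : 0 ≤ B) (hκ : 0 ≤ κ) (ht₀ : t₀ ≤ 0)
    (hC : ∀ t s : ℝ, 0 ≤ t → t < s → s ≤ T → (q.covInt t s).PosDef) (β : MultiIndex d)
    {T' : ℝ} (hT' : T' < T) :
    ∃ K : ℝ, ∀ u ∈ trigSol q T, ∀ ε : ℝ, 0 ≤ ε →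
      (∀ z, |(u T : Space d → ℝ) z| ≤ ε * weight κ z) → ∀ t ∈ Icc t₀ T', ∀ z,
        |(multiDerivOp β (u t) : Space d → ℝ) z| ≤ K * ε * weight (2 * κ) z := by
  obtain ⟨K, hK₀, hK⟩ := exists_multiDerivOp_sq_le hq hB (mul_nonneg zero_le_two hκ) ht₀ hC β
    (le_max_right T' 0) (max_lt hT' hT)
  refine ⟨K * (d + 1) + 1, fun u hu ε hε hterm t ht z => ?_⟩
  have hsq := hK u hu (ε ^ 2 * (d + 1)) (by positivity) (fun z => by
    calc (u T : Space d → ℝ) z ^ 2 ≤ (ε * weight κ z) ^ 2 := sq_le_sq' (neg_le_of_abs_le (hterm z))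
          (le_of_abs_le (hterm z))
      _ = ε ^ 2 * weight κ z ^ 2 := mul_pow _ _ _
      _ ≤ ε ^ 2 * ((d + 1) * weight (2 * κ) z) := by gcongr; exact weight_sq_le κ z
      _ = ε ^ 2 * (d + 1) * weight (2 * κ) z := (mul_assoc _ _ _).symm)
    t ⟨ht.1, ht.2.trans (le_max_left _ _)⟩ z
  have hw := one_le_weight (2 * κ) z
  have hL : 0 ≤ K * (d + 1) := by positivity
  refine abs_le_of_sq_le_sq ?_ (by positivity)
  calc (multiDerivOp β (u t) : Space d → ℝ) z ^ 2
      ≤ ε ^ 2 * (K * (d + 1) * weight (2 * κ) z) := hsq.trans_eq (by ring)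
    _ ≤ ε ^ 2 * ((K * (d + 1) + 1) ^ 2 * weight (2 * κ) z ^ 2) := by
      gcongr
      · nlinarith
      · exact le_self_pow₀ hw two_ne_zero
    _ = ((K * (d + 1) + 1) * ε * weight (2 * κ) z) ^ 2 := by ring

theorem hasExpGrowthOn_of_abs_sub_le_weight {s : Set ℝ} {w u : ℝ → Space d → ℝ} {c κ : ℝ}
    (hκ : 0 ≤ κ) (hu : HasExpGrowthOn s u)
    (hw : ∀ t ∈ s, ∀ z, |w t z - u t z| ≤ c * weight κ z) : HasExpGrowthOn s w := by
  have hdiff : HasExpGrowthOn s fun t z => w t z - u t z := by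
    refine ⟨|c| * (d + 1), κ, fun t ht z => (hw t ht z).trans ?_⟩
    rw [mul_assoc]
    exact mul_le_mul (le_abs_self c) (weight_le_exp_norm hκ z) (weight_pos _ _).le (abs_nonneg c)
  simpa using hdiff.add hu

/-- Paths `V(t,·)` of smooth functions, with velocity `V'(t,·)`, all of whose derivatives are
jointly continuous for `-1 < t < T`, of exponential growth, and differentiable in time. Starting
before `0` makes the time derivative at `0` two-sided. -/
structure IsRegularPath (T : ℝ) (V V' : ℝ → SmoothFn d) : Prop where
  continuousOn : ∀ β : MultiIndex d, ContinuousOn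
    (fun p : ℝ × Space d => (multiDerivOp β (V p.1) : Space d → ℝ) p.2) (Ioo (-1) T ×ˢ univ)
  growth : ∀ β : MultiIndex d, ∀ T' < T,
    HasExpGrowthOn (Icc 0 T') fun t => (multiDerivOp β (V t) : Space d → ℝ)
  hasDerivAt : ∀ β : MultiIndex d, ∀ t ∈ Ioo (-1) T, ∀ z,
    HasDerivAt (fun s => (multiDerivOp β (V s) : Space d → ℝ) z)
      ((multiDerivOp β (V' t) : Space d → ℝ) z) t

/-- Regular paths solving the homogeneous equation `(∂_t + genOp q t) V = 0`. -/
def IsRegularSol (q : FrozenCoeff d) (T : ℝ) (V : ℝ → SmoothFn d) : Prop :=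
  IsRegularPath T V fun t => -genOp q t (V t)

theorem exists_isRegularSol_of_cauchy {q : FrozenCoeff d} {T B κ : ℝ} (hT : 0 < T)
    (hq : q.BoundedOn B (Icc (-1) T)) (hB : 0 ≤ B) (hκ : 0 ≤ κ)
    (hC : ∀ t s : ℝ, 0 ≤ t → t < s → s ≤ T → (q.covInt t s).PosDef)
    {u : ℕ → ℝ → SmoothFn d} (hu : ∀ N, u N ∈ trigSol q T) {r : ℕ → ℝ} (hr₀ : ∀ N, 0 ≤ r N)
    (hr : Tendsto r atTop (𝓝 0)) (hcauchy : ∀ N M, N ≤ M → ∀ z,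
      |(u N T : Space d → ℝ) z - (u M T : Space d → ℝ) z| ≤ r N * weight κ z) :
    ∃ V : ℝ → SmoothFn d, IsRegularSol q T V ∧ ∀ t ∈ Ioo (-1) T, ∀ z,
      Tendsto (fun N => (u N t : Space d → ℝ) z) atTop (𝓝 ((V t : Space d → ℝ) z)) := by
  have hdiff : ∀ β : MultiIndex d, ∀ T' < T, ∃ K, ∀ N M, N ≤ M → ∀ t ∈ Icc (-1) T', ∀ z,
      |(multiDerivOp β (u N t) : Space d → ℝ) z - (multiDerivOp β (u M t) : Space d → ℝ) z| ≤
        K * r N * weight (2 * κ) z := by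
    intro β T' hT'
    obtain ⟨K, hK⟩ := exists_abs_multiDerivOp_le hT hq hB hκ (by norm_num) hC β hT'
    refine ⟨K, fun N M hNM t ht z => ?_⟩
    simpa [Pi.sub_apply, map_sub] using
      hK (u N - u M) (sub_mem (hu N) (hu M)) _ (hr₀ N) (hcauchy N M hNM) t ht z
  choose w hw using fun β => exists_limit_of_weighted_cauchy hr (hdiff β)
  have hu' := fun N β => multiDerivOp_mem_trigSol (hu N) β
  have hlim : DerivsTendsto (Ioo (-1) T) u w := fun β _ ht =>
    tendsto_prod_of_weighted_bound hr (fun N => continuous_of_mem_trigSol (hu' N β)) (hw β) ht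
  obtain ⟨V, hV⟩ := hlim.exists_smoothFn
  have hlim' : DerivsTendsto (Ioo (-1) T) u fun β t => multiDerivOp β (V t) :=
    fun β t ht z => by simpa only [hV β t ht] using hlim β t ht z
  refine ⟨V, ⟨fun β => ?_, fun β T' hT' => ?_, fun β t ht z => ?_⟩, fun t ht z => ?_⟩
  · exact DerivsTendsto.continuousOn isOpen_Ioo hlim' β
  · obtain ⟨K, hK⟩ := hw β T' hT'
    refine hasExpGrowthOn_of_abs_sub_le_weight (c := K * r 0) (κ := 2 * κ) (by positivity)
      (hasExpGrowthOn_of_mem_trigSol (hu' 0 β) isCompact_Icc) fun t ht z => ?_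
    rw [hV β t ⟨by linarith [ht.1], ht.2.trans_lt hT'⟩]
    exact hK 0 t ⟨by linarith [ht.1], ht.2⟩ z
  · rw [map_neg, multiDerivOp_genOp]
    refine hlim'.hasDerivAt isOpen_Ioo (fun N β t z => ?_) β ht z
    exact hasDerivAt_of_mem_trigSol (hu' N β) t z
  · simpa [ordPow_zero] using hlim'.tendsto_apply 0 ht z

theorem IsC12On.sub_of_solution {q : FrozenCoeff d} {t₀ t₁ : ℝ} {w u F : ℝ → Space d → ℝ}
    (hw : IsC12On t₀ t₁ w fun t => -(genFn q t (w t) + F t))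
    (hu : IsC12On t₀ t₁ u fun t => -(genFn q t (u t) + F t)) :
    IsC12On t₀ t₁ (fun t => w t - u t) fun t => -genFn q t (w t - u t) where
  continuousOn := (hw.sub hu).continuousOn
  contDiff := (hw.sub hu).contDiff
  hasDerivWithinAt t ht z := by
    refine ((hw.sub hu).hasDerivWithinAt t ht z).congr_deriv ?_
    have hgen := congrFun (genFn_sub_smul q t 1 (hw.contDiff t ht) (hu.contDiff t ht)) z
    simp only [one_smul, Pi.sub_apply, Pi.neg_apply, Pi.add_apply] at hgen ⊢
    rw [hgen]
    ring

theorem exists_seq_trigSol_near (q : FrozenCoeff d) (T : ℝ) {φ : Space d → ℝ} {K c κ : ℝ}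
    (hφ : Continuous φ) (hgrowth : ∀ z, |φ z| ≤ K * Real.exp (c * ‖z‖)) (hc : 0 ≤ c)
    (hκ : c < κ) :
    ∃ u : ℕ → ℝ → SmoothFn d, (∀ N, u N ∈ trigSol q T) ∧
      ∀ N : ℕ, ∀ z, |φ z - (u N T : Space d → ℝ) z| ≤ 1 / ((N : ℝ) + 1) * weight κ z := by
  have happrox : ∀ N : ℕ, ∃ u ∈ trigSol q T, ∀ z,
      |φ z - (u T : Space d → ℝ) z| ≤ 1 / ((N : ℝ) + 1) * weight κ z := by
    intro N
    obtain ⟨p, hp, hpz⟩ := exists_trigPoly_near hφ hgrowth hc hκ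
      (Nat.one_div_pos_of_nat (α := ℝ) (n := N))
    obtain ⟨u, hu, rfl⟩ := exists_mem_trigSol_eq q T hp
    exact ⟨u, hu, hpz⟩
  choose u hu hnear using happrox
  exact ⟨u, hu, hnear⟩

theorem exists_isRegularSol_eq {q : FrozenCoeff d} {T B : ℝ} (hT : 0 < T)
    (hq : q.BoundedOn B (Icc (-1) T))
    (hC : ∀ t s : ℝ, 0 ≤ t → t < s → s ≤ T → (q.covInt t s).PosDef)
    {v : ℝ → Space d → ℝ} (hv : IsC12On 0 T v fun t => -genFn q t (v t))
    (hgrowth : HasExpGrowthOn (Icc 0 T) v) :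
    ∃ V : ℝ → SmoothFn d, IsRegularSol q T V ∧ ∀ t ∈ Ico 0 T, (V t : Space d → ℝ) = v t := by
  have hB : 0 ≤ B := (abs_nonneg _).trans (hq.rate T ⟨by linarith, le_rfl⟩)
  have hTI : T ∈ Icc 0 T := ⟨hT.le, le_rfl⟩
  obtain ⟨K, c, -, hc, hKc⟩ := hgrowth.exists_nonneg
  set κ : ℝ := c + 1
  have hκ : 0 ≤ κ := by positivity
  have hφ : Continuous (v T) :=
    hv.continuousOn.comp_continuous (Continuous.prodMk_right T) fun z => ⟨hTI, mem_univ z⟩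
  obtain ⟨u, hu, hnear⟩ := exists_seq_trigSol_near q T hφ (hKc T hTI) hc (lt_add_one c)
  have hcauchy : ∀ N M, N ≤ M → ∀ z, |(u N T : Space d → ℝ) z - (u M T : Space d → ℝ) z| ≤
      2 * (1 / ((N : ℝ) + 1)) * weight κ z := by
    intro N M hNM z
    have hle : 1 / ((M : ℝ) + 1) * weight κ z ≤ 1 / ((N : ℝ) + 1) * weight κ z :=
      mul_le_mul_of_nonneg_right (Nat.one_div_le_one_div hNM) (weight_pos _ _).le
    have hN := hnear N z
    rw [abs_sub_comm] at hN
    linarith [abs_sub_le ((u N T : Space d → ℝ) z) (v T z) ((u M T : Space d → ℝ) z), hnear M z]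
  have hrate : Tendsto (fun N : ℕ => 1 / ((N : ℝ) + 1)) atTop (𝓝 0) :=
    tendsto_one_div_add_atTop_nhds_zero_nat
  obtain ⟨V, hV, hVlim⟩ := exists_isRegularSol_of_cauchy hT hq hB hκ hC hu
    (fun N => by positivity) (by simpa using hrate.const_mul 2) hcauchy
  refine ⟨V, hV, fun t ht => funext fun z => ?_⟩
  refine tendsto_nhds_unique (hVlim t ⟨by linarith [ht.1], ht.2⟩ z) ?_
  rw [tendsto_iff_dist_tendsto_zero]
  refine squeeze_zero (fun _ => dist_nonneg) (fun N => ?_)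
    (by simpa only [zero_mul] using hrate.mul_const (barrier B κ T t z))
  rw [dist_comm, Real.dist_eq]
  have hdiff := IsC12On.sub_of_solution (F := 0) (by simpa using hv)
    (by simpa using isC12On_of_mem_trigSol (hu N) 0 T)
  exact abs_le_barrier_of_solution (hq.mono (Icc_subset_Icc_left (by norm_num))) hκ
    (by positivity) hdiff (hgrowth.sub (hasExpGrowthOn_of_mem_trigSol (hu N) isCompact_Icc))
    (hnear N) t ⟨ht.1, ht.2.le⟩ z

/-! ### Operators preserving regular solutions -/

theorem multiDerivOp_mul_derivOp (β : MultiIndex d) (j : Fin (d + 1)) :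
    (multiDerivOp β * derivOp j : SmoothOp d) = multiDerivOp (β + Pi.single j 1) := by
  rw [multiDerivOp_add_single]
  induction β using MultiIndex.induction with
  | zero => simp [ordPow_zero]
  | add_single β i ih =>
    rw [multiDerivOp_add_single, mul_assoc, ih, ← mul_assoc, ← mul_assoc, (commute_derivOp i j).eq]

theorem multiDerivOp_mul_coordOp (β : MultiIndex d) (j : Fin (d + 1)) :
    (multiDerivOp β * coordOp j : SmoothOp d) =
      coordOp j * multiDerivOp β + (β j : ℝ) • (multiDerivOp (β - Pi.single j 1) : SmoothOp d) := by
  induction β using MultiIndex.induction with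
  | zero => simp [ordPow_zero]
  | add_single β i ih =>
    rw [multiDerivOp_add_single, mul_assoc, ih, mul_add, ← mul_assoc, derivOp_mul_coordOp, add_mul,
      mul_assoc, add_assoc, mul_smul_comm, ← multiDerivOp_add_single (β - Pi.single j 1)]
    congr 1
    rcases eq_or_ne i j with rfl | hij
    · rcases Nat.eq_zero_or_pos (β i) with h0 | hpos
      · simp [h0]
      · have hβ : β - Pi.single i 1 + Pi.single i 1 = β :=
          tsub_add_cancel_of_le (update_le_iff.2 ⟨hpos, fun _ _ => Nat.zero_le _⟩)
        simp [hβ, add_smul, add_comm]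
    · have hβ : β + Pi.single i 1 - Pi.single j 1 = β - Pi.single j 1 + Pi.single i 1 := by
        ext l
        rcases eq_or_ne l j with rfl | hl
        · simp [hij.symm]
        · simp [hl]
      simp [hij, hij.symm, hβ]

namespace IsRegularPath

variable {T : ℝ} {V V' W W' : ℝ → SmoothFn d}

theorem add (hV : IsRegularPath T V V') (hW : IsRegularPath T W W') :
    IsRegularPath T (fun t => V t + W t) fun t => V' t + W' t where
  continuousOn β := by
    simp only [map_add]
    exact (hV.continuousOn β).add (hW.continuousOn β)
  growth β T' hT' := by
    simp only [map_add]
    exact (hV.growth β T' hT').add (hW.growth β T' hT')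
  hasDerivAt β t ht z := by
    simp only [map_add]
    exact (hV.hasDerivAt β t ht z).add (hW.hasDerivAt β t ht z)

theorem smul {b b' : ℝ → ℝ} (hb : ∀ t, HasDerivAt b (b' t) t) (hV : IsRegularPath T V V') :
    IsRegularPath T (fun t => b t • V t) fun t => b' t • V t + b t • V' t := by
  have hcont : Continuous b := continuous_iff_continuousAt.2 fun t => (hb t).continuousAt
  refine ⟨fun β => ?_, fun β T' hT' => ?_, fun β t ht z => ?_⟩
  · simp only [map_smul]
    exact (hcont.comp continuous_fst).continuousOn.smul (hV.continuousOn β)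
  · simp only [map_smul]
    exact (HasExpGrowthOn.of_continuousOn isCompact_Icc hcont.continuousOn).mul
      (hV.growth β T' hT')
  · simp only [map_smul, map_add]
    exact (hb t).mul (hV.hasDerivAt β t ht z)

theorem const_smul (hV : IsRegularPath T V V') (c : ℝ) :
    IsRegularPath T (fun t => c • V t) fun t => c • V' t := by
  simpa using hV.smul fun t => hasDerivAt_const t c

theorem sum {ι : Type*} (J : Finset ι) {V V' : ι → ℝ → SmoothFn d}
    (hV : ∀ i, IsRegularPath T (V i) (V' i)) :
    IsRegularPath T (fun t => ∑ i ∈ J, V i t) fun t => ∑ i ∈ J, V' i t := by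
  classical
  induction J using Finset.induction_on with
  | empty =>
    simp only [Finset.sum_empty]
    exact ⟨fun β => by simpa using continuousOn_const, fun β T' _ => ⟨0, 0, by simp⟩,
      fun β t _ z => by simpa using hasDerivAt_const t (0 : ℝ)⟩
  | insert i J hi ih =>
    simp only [Finset.sum_insert hi]
    exact (hV i).add ih

theorem derivOp (hV : IsRegularPath T V V') (j : Fin (d + 1)) :
    IsRegularPath T (fun t => derivOp j (V t)) fun t => PolyExpansion.derivOp j (V' t) := by
  have hshift : ∀ (β : MultiIndex d) (f : SmoothFn d),
      multiDerivOp β (PolyExpansion.derivOp j f) = multiDerivOp (β + Pi.single j 1) f := fun β f =>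
    LinearMap.congr_fun (multiDerivOp_mul_derivOp β j) f
  refine ⟨fun β => ?_, fun β T' hT' => ?_, fun β t ht z => ?_⟩ <;> simp only [hshift]
  exacts [hV.continuousOn _, hV.growth _ T' hT', hV.hasDerivAt _ t ht z]

theorem coordOp (hV : IsRegularPath T V V') (j : Fin (d + 1)) :
    IsRegularPath T (fun t => coordOp j (V t)) fun t => PolyExpansion.coordOp j (V' t) := by
  have hleibniz : ∀ (β : MultiIndex d) (f : SmoothFn d) (z : Space d),
      (multiDerivOp β (PolyExpansion.coordOp j f) : Space d → ℝ) z =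
        z j * (multiDerivOp β f : Space d → ℝ) z +
          β j * (multiDerivOp (β - Pi.single j 1) f : Space d → ℝ) z := fun β f z =>
    congrFun (congrArg Subtype.val (LinearMap.congr_fun (multiDerivOp_mul_coordOp β j) f)) z
  have hcoord : Continuous fun p : ℝ × Space d => p.2 j := by fun_prop
  refine ⟨fun β => ?_, fun β T' hT' => ?_, fun β t ht z => ?_⟩
  · simp only [hleibniz]
    exact (hcoord.continuousOn.mul (hV.continuousOn β)).add ((hV.continuousOn _).const_mul _)
  · have hgrowth : HasExpGrowthOn (Icc 0 T') fun _ (z : Space d) => z j := by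
      refine ⟨1, 1, fun _ _ z => ?_⟩
      rw [one_mul, one_mul]
      exact (norm_le_pi_norm z j).trans (by linarith [Real.add_one_le_exp ‖z‖])
    change HasExpGrowthOn _ fun t z =>
      (multiDerivOp β (PolyExpansion.coordOp j (V t)) : Space d → ℝ) z
    simp only [hleibniz]
    exact (hgrowth.mul (hV.growth β T' hT')).add ((hV.growth _ T' hT').const_mul _)
  · simp only [hleibniz]
    exact ((hV.hasDerivAt β t ht z).const_mul _).add ((hV.hasDerivAt _ t ht z).const_mul _)

end IsRegularPath

/-- The operator `𝒵_j(t,s) = z_j + 𝐦_j(t,s) + ∑ₗ 𝐂_{jl}(t,s) ∂_l`. The conjugation by the flow of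
the homogeneous equation turns multiplication by `z_j` at time `s` into `𝒵_j(t,s)` at time `t`, so
that, for fixed `s`, it commutes with `∂_t + genOp q t`. -/
def flowCoordOp (q : FrozenCoeff d) (s : ℝ) (j : Fin (d + 1)) (t : ℝ) : SmoothOp d :=
  coordOp j + q.driftInt t s j • 1 + ∑ l, q.covInt t s j l • derivOp l

theorem derivOp_mul_derivOp_mul_coordOp (i l j : Fin (d + 1)) :
    (derivOp i * derivOp l * coordOp j : SmoothOp d) = coordOp j * (derivOp i * derivOp l) +
      ((if i = j then derivOp l else 0) + if l = j then derivOp i else 0) := by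
  rw [mul_assoc, derivOp_mul_coordOp, mul_add, ← mul_assoc, derivOp_mul_coordOp, add_mul, mul_assoc,
    add_assoc, ite_mul, one_mul, zero_mul, mul_ite, mul_one, mul_zero]

theorem genOp_mul_coordOp (q : FrozenCoeff d) (t : ℝ) (j : Fin (d + 1)) :
    genOp q t * coordOp j =
      coordOp j * genOp q t + q.drift t j • 1 + ∑ l, q.cov t j l • derivOp l := by
  have hfirst : ∑ i, ∑ l, q.cov t i l • (if i = j then (derivOp l : SmoothOp d) else 0) =
      ∑ l, q.cov t j l • derivOp l := by
    rw [Finset.sum_comm]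
    simp
  have hsecond : ∑ i, ∑ l, q.cov t i l • (if l = j then (derivOp i : SmoothOp d) else 0) =
      ∑ l, q.cov t j l • derivOp l := by
    simp [q.cov_symm t _ j]
  have hdrift : ∑ i, q.drift t i • (if i = j then (1 : SmoothOp d) else 0) = q.drift t j • 1 := by
    simp
  simp only [genOp, add_mul, mul_add, Finset.sum_mul, Finset.mul_sum, smul_mul_assoc,
    mul_smul_comm, one_mul, mul_one, derivOp_mul_coordOp, derivOp_mul_derivOp_mul_coordOp,
    smul_add, Finset.sum_add_distrib, hdrift, hfirst, hsecond]
  module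

theorem genOp_mul_flowCoordOp (q : FrozenCoeff d) (s t : ℝ) (j : Fin (d + 1)) :
    genOp q t * flowCoordOp q s j t = flowCoordOp q s j t * genOp q t +
      (q.drift t j • 1 + ∑ l, q.cov t j l • derivOp l) := by
  simp only [flowCoordOp, mul_add, add_mul, genOp_mul_coordOp, Finset.mul_sum, Finset.sum_mul,
    mul_smul_comm, smul_mul_assoc, (commute_genOp_derivOp q t _).eq, mul_one, one_mul]
  abel

section

variable {q : FrozenCoeff d} {T : ℝ} {V : ℝ → SmoothFn d}

theorem IsRegularSol.derivOp (hV : IsRegularSol q T V) (j : Fin (d + 1)) :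
    IsRegularSol q T fun t => derivOp j (V t) := by
  have hcomm : ∀ t, PolyExpansion.derivOp j (-genOp q t (V t)) =
      -genOp q t (PolyExpansion.derivOp j (V t)) := fun t => by
    rw [map_neg]
    exact congrArg Neg.neg (LinearMap.congr_fun (commute_genOp_derivOp q t j).eq (V t)).symm
  simpa only [IsRegularSol, hcomm] using IsRegularPath.derivOp hV j

theorem IsRegularSol.flowCoordOp (hV : IsRegularSol q T V) (s : ℝ) (j : Fin (d + 1)) :
    IsRegularSol q T fun t => flowCoordOp q s j t (V t) := by
  have hpath := ((IsRegularPath.coordOp hV j).add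
    (IsRegularPath.smul (fun t => q.hasDerivAt_driftInt s t j) hV)).add
    (IsRegularPath.sum Finset.univ fun l =>
      (IsRegularPath.derivOp hV l).smul fun t => q.hasDerivAt_covInt s t j l)
  have hcomm := fun t => LinearMap.congr_fun (genOp_mul_flowCoordOp q s t j) (V t)
  simp only [Module.End.mul_apply, LinearMap.add_apply, LinearMap.smul_apply,
    LinearMap.sum_apply, Module.End.one_apply] at hcomm
  unfold IsRegularSol
  simp only [hcomm]
  convert hpath using 2 with t t
  · simp [PolyExpansion.flowCoordOp]
  · simp only [PolyExpansion.flowCoordOp, LinearMap.add_apply, LinearMap.smul_apply,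
      LinearMap.sum_apply, Module.End.one_apply, map_neg, smul_neg, neg_smul,
      Finset.sum_add_distrib, Finset.sum_neg_distrib]
    abel

/-- Time-dependent operators generated by the partial derivatives and the coordinates transported
along the flow of the homogeneous equation. -/
def flowAlg (q : FrozenCoeff d) : Subalgebra ℝ (ℝ → SmoothOp d) :=
  Algebra.adjoin ℝ (range (flowCoordOp q 0) ∪ range fun j _ => derivOp j)

theorem flowCoordOp_mem_flowAlg (j : Fin (d + 1)) : flowCoordOp q 0 j ∈ flowAlg q :=
  Algebra.subset_adjoin (Or.inl ⟨j, rfl⟩)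

theorem derivOp_mem_flowAlg (j : Fin (d + 1)) : (fun _ => derivOp j) ∈ flowAlg q :=
  Algebra.subset_adjoin (Or.inr ⟨j, rfl⟩)

theorem IsRegularSol.flowAlg {Q : ℝ → SmoothOp d} (hQ : Q ∈ flowAlg q) (hV : IsRegularSol q T V) :
    IsRegularSol q T fun t => Q t (V t) := by
  induction hQ using Algebra.adjoin_induction generalizing V with
  | mem x hx =>
    rcases hx with ⟨j, rfl⟩ | ⟨j, rfl⟩
    · exact hV.flowCoordOp 0 j
    · exact hV.derivOp j
  | algebraMap r => simpa [IsRegularSol, Pi.algebraMap_apply] using IsRegularPath.const_smul hV r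
  | add x y _ _ hx hy => simpa [IsRegularSol, add_comm] using IsRegularPath.add (hx hV) (hy hV)
  | mul _ _ _ _ hx hy => exact hx (hy hV)

end

/-! ### Normal forms -/

/-- The operators of finite order with smooth coefficients, `∑_β c_β(z) ∂^β`. -/
def diffOps (d : ℕ) : Submodule ℝ (SmoothOp d) :=
  LinearMap.range (Finsupp.lsum ℝ fun β : MultiIndex d =>
    LinearMap.mulRight ℝ (multiDerivOp β : SmoothOp d) ∘ₗ LinearMap.mul ℝ (SmoothFn d))

theorem mem_diffOps {P : SmoothOp d} : P ∈ diffOps d ↔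
    ∃ c : MultiIndex d →₀ SmoothFn d, P = ∑ β ∈ c.support, mulOp (c β) * multiDerivOp β :=
  exists_congr fun _ => eq_comm

theorem mulOp_mul_multiDerivOp_mem_diffOps (p : SmoothFn d) (β : MultiIndex d) :
    mulOp p * multiDerivOp β ∈ diffOps d :=
  ⟨Finsupp.single β p, Finsupp.lsum_single _ _ _ _⟩

theorem mulOp_mul_mem_diffOps (p : SmoothFn d) {P : SmoothOp d} (hP : P ∈ diffOps d) :
    mulOp p * P ∈ diffOps d := by
  obtain ⟨c, rfl⟩ := mem_diffOps.1 hP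
  rw [Finset.mul_sum]
  refine sum_mem fun β _ => ?_
  rw [← mul_assoc, show mulOp p * mulOp (c β) = mulOp (p * c β) from
    (LinearMap.mulLeft_mul ℝ _ p (c β)).symm]
  exact mulOp_mul_multiDerivOp_mem_diffOps _ β

theorem derivOp_mul_mem_diffOps (j : Fin (d + 1)) {P : SmoothOp d} (hP : P ∈ diffOps d) :
    derivOp j * P ∈ diffOps d := by
  obtain ⟨c, rfl⟩ := mem_diffOps.1 hP
  rw [Finset.mul_sum]
  refine sum_mem fun β _ => ?_
  rw [← mul_assoc, derivOp_mul_mulOp, add_mul, mul_assoc, ← multiDerivOp_add_single]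
  exact add_mem (mulOp_mul_multiDerivOp_mem_diffOps _ _) (mulOp_mul_multiDerivOp_mem_diffOps _ _)

theorem flowCoordOp_mul_mem_diffOps (q : FrozenCoeff d) (s : ℝ) (j : Fin (d + 1)) (t : ℝ)
    {P : SmoothOp d} (hP : P ∈ diffOps d) : flowCoordOp q s j t * P ∈ diffOps d := by
  simp only [flowCoordOp, add_mul, smul_mul_assoc, one_mul, Finset.sum_mul]
  exact add_mem (add_mem (mulOp_mul_mem_diffOps _ hP) (Submodule.smul_mem _ _ hP))
    (sum_mem fun l _ => Submodule.smul_mem _ _ (derivOp_mul_mem_diffOps l hP))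

theorem mul_mem_diffOps_of_mem_flowAlg {q : FrozenCoeff d} {Q : ℝ → SmoothOp d}
    (hQ : Q ∈ flowAlg q) (t : ℝ) {P : SmoothOp d} (hP : P ∈ diffOps d) : Q t * P ∈ diffOps d := by
  induction hQ using Algebra.adjoin_induction generalizing P with
  | mem x hx =>
    rcases hx with ⟨j, rfl⟩ | ⟨j, rfl⟩
    · exact flowCoordOp_mul_mem_diffOps q 0 j t hP
    · exact derivOp_mul_mem_diffOps j hP
  | algebraMap r => simpa [Algebra.algebraMap_eq_smul_one] using Submodule.smul_mem _ r hP
  | add x y _ _ hx hy => simpa [add_mul] using add_mem (hx hP) (hy hP)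
  | mul x y _ _ hx hy => simpa [mul_assoc] using hx (hy hP)

theorem mem_diffOps_of_mem_flowAlg {q : FrozenCoeff d} {Q : ℝ → SmoothOp d} (hQ : Q ∈ flowAlg q)
    (t : ℝ) : Q t ∈ diffOps d := by
  have hone : (1 : SmoothOp d) ∈ diffOps d := by
    have hnormal : (1 : SmoothOp d) = mulOp 1 * multiDerivOp 0 := by
      ext1 f
      simp [ordPow_zero, mulOp]
    exact hnormal ▸ mulOp_mul_multiDerivOp_mem_diffOps 1 0
  simpa using mul_mem_diffOps_of_mem_flowAlg hQ t hone

theorem isLinearDiffOp_of_mem_diffOps {L : Op d} {P : SmoothOp d} (hP : P ∈ diffOps d)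
    (hL : ∀ f : SmoothFn d, L f = (P f : Space d → ℝ)) : IsLinearDiffOp L := by
  obtain ⟨c, rfl⟩ := mem_diffOps.1 hP
  refine ⟨c.support, fun β => c β, fun β _ => (c β).contDiff, fun f hf z => ?_⟩
  lift f to SmoothFn d using hf
  simp only [hL, multiDeriv_eq_coe, LinearMap.sum_apply, SmoothFn.coe_sum]
  rfl

/-! ### Iterated integrals -/

theorem continuous_iteratedIntegral {X : Type*} [TopologicalSpace X] (T : ℝ) (k : ℕ)
    {F : X → (Fin k → ℝ) → ℝ} (hF : Continuous fun p : X × (Fin k → ℝ) => F p.1 p.2) :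
    Continuous fun p : X × ℝ => iteratedIntegral T k p.2 (F p.1) := by
  induction k generalizing X with
  | zero => exact hF.comp (continuous_fst.prodMk continuous_const)
  | succ k ih =>
    have hinner : Continuous fun p : (X × ℝ) × ℝ =>
        iteratedIntegral T k p.2 fun τ => F p.1.1 (Fin.cons p.1.2 τ) :=
      ih (F := fun (y : X × ℝ) τ => F y.1 (Fin.cons y.2 τ)) <|
        hF.comp (continuous_fst.fst.prodMk (continuous_fst.snd.finCons continuous_snd))
    have hintegrand : Continuous fun p : (X × ℝ) × ℝ =>
        iteratedIntegral T k p.2 fun τ => F p.1.1 (Fin.cons p.2 τ) :=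
      hinner.comp ((continuous_fst.fst.prodMk continuous_snd).prodMk continuous_snd)
    refine (intervalIntegral.continuous_parametric_intervalIntegral_of_continuous
      (μ := MeasureTheory.volume) (a₀ := T)
      (f := fun (p : X × ℝ) s => iteratedIntegral T k s fun τ => F p.1 (Fin.cons s τ))
      hintegrand continuous_snd).neg.congr fun p => ?_
    exact (intervalIntegral.integral_symm _ _).symm

theorem continuous_iteratedIntegral_cons (T : ℝ) (k : ℕ) {c : (Fin (k + 1) → ℝ) → ℝ}
    (hc : Continuous c) :
    Continuous fun s => iteratedIntegral T k s fun τ => c (Fin.cons s τ) :=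
  (continuous_iteratedIntegral T k (F := fun (s : ℝ) τ => c (Fin.cons s τ))
    (hc.comp (Continuous.finCons (A := fun _ => ℝ) continuous_fst continuous_snd))).comp
    (continuous_id.prodMk continuous_id)

theorem hasDerivAt_iteratedIntegral_succ (T : ℝ) (k : ℕ) {c : (Fin (k + 1) → ℝ) → ℝ}
    (hc : Continuous c) (t : ℝ) :
    HasDerivAt (fun t => iteratedIntegral T (k + 1) t c)
      (-iteratedIntegral T k t fun τ => c (Fin.cons t τ)) t :=
  hasDerivAt_integral_left (continuous_iteratedIntegral_cons T k hc) T t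

theorem iteratedIntegral_succ_self (T : ℝ) (k : ℕ) (c : (Fin (k + 1) → ℝ) → ℝ) :
    iteratedIntegral T (k + 1) T c = 0 :=
  intervalIntegral.integral_same

theorem iteratedIntegral_sum_mul {ι : Type*} [Fintype ι] (T : ℝ) (k : ℕ) (t : ℝ)
    {c : ι → (Fin k → ℝ) → ℝ} (hc : ∀ i, Continuous (c i)) (x : ι → ℝ) :
    iteratedIntegral T k t (fun τ => ∑ i, c i τ * x i) =
      ∑ i, iteratedIntegral T k t (c i) * x i := by
  induction k generalizing t with
  | zero => rfl
  | succ k ih =>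
    have hinner : ∀ s, iteratedIntegral T k s (fun τ => ∑ i, c i (Fin.cons s τ) * x i) =
        ∑ i, iteratedIntegral T k s (fun τ => c i (Fin.cons s τ)) * x i := fun s =>
      ih s fun i => (hc i).comp (continuous_const.finCons continuous_id)
    have hcont : ∀ i, Continuous fun s =>
        iteratedIntegral T k s (fun τ => c i (Fin.cons s τ)) * x i := fun i =>
      (continuous_iteratedIntegral_cons T k (hc i)).mul continuous_const
    simp only [iteratedIntegral, hinner]
    rw [intervalIntegral.integral_finsetSum fun i _ => (hcont i).intervalIntegrable _ _]
    simp only [intervalIntegral.integral_mul_const]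

theorem iteratedIntegral_congr {T : ℝ} {k : ℕ} {t : ℝ} (ht : t ≤ T) {F G : (Fin k → ℝ) → ℝ}
    (h : ∀ τ : Fin k → ℝ, (∀ j, τ j ∈ Icc t T) → F τ = G τ) :
    iteratedIntegral T k t F = iteratedIntegral T k t G := by
  induction k generalizing t with
  | zero => exact h _ fun j => j.elim0
  | succ k ih =>
    refine intervalIntegral.integral_congr fun s hs => ?_
    rw [uIcc_of_le ht] at hs
    refine ih hs.2 fun τ hτ => h _ fun j => ?_
    cases j using Fin.cases with
    | zero => exact hs
    | succ j => exact Icc_subset_Icc_left hs.1 (hτ j)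

/-! ### Operator-valued iterated integrals -/

/-- Families of operators with separated variables, that is, finite sums of products `c(x) Q(t)`
with `c` continuous and `Q ∈ flowAlg q`. -/
def separableAlg (q : FrozenCoeff d) (X : Type*) [TopologicalSpace X] :
    Subalgebra ℝ (X → ℝ → SmoothOp d) :=
  Algebra.adjoin ℝ {F | ∃ c : X → ℝ, Continuous c ∧ ∃ Q ∈ flowAlg q, F = fun x => c x • Q}

section

variable {q : FrozenCoeff d} {X : Type*} [TopologicalSpace X]

theorem smul_mem_separableAlg {c : X → ℝ} (hc : Continuous c) {Q : ℝ → SmoothOp d}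
    (hQ : Q ∈ flowAlg q) : (fun x => c x • Q) ∈ separableAlg q X :=
  Algebra.subset_adjoin ⟨c, hc, Q, hQ, rfl⟩

theorem const_mem_separableAlg {Q : ℝ → SmoothOp d} (hQ : Q ∈ flowAlg q) :
    (fun _ => Q) ∈ separableAlg q X := by
  simpa using smul_mem_separableAlg (X := X) (continuous_const (y := (1 : ℝ))) hQ

theorem comp_mem_separableAlg {Y : Type*} [TopologicalSpace Y] {F : Y → ℝ → SmoothOp d}
    (hF : F ∈ separableAlg q Y) {g : X → Y} (hg : Continuous g) :
    (fun x => F (g x)) ∈ separableAlg q X := by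
  induction hF using Algebra.adjoin_induction with
  | mem F hF =>
    obtain ⟨c, hc, Q, hQ, rfl⟩ := hF
    exact smul_mem_separableAlg (hc.comp hg) hQ
  | algebraMap r => exact Subalgebra.algebraMap_mem _ r
  | add F G _ _ hF hG => exact add_mem hF hG
  | mul F G _ _ hF hG => exact mul_mem hF hG

theorem ordPow_mem_separableAlg {b : Fin (d + 1) → X → ℝ → SmoothOp d}
    (hb : ∀ j, b j ∈ separableAlg q X) (η : MultiIndex d) :
    (fun x t => ordPow (fun j => b j x t) η) ∈ separableAlg q X := by
  convert ordPow_mem hb η using 1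
  ext x t : 2
  simp [ordPow, Pi.list_prod_apply, Function.comp_def]

theorem exists_eq_sum_of_mem_separableAlg {F : X → ℝ → SmoothOp d} (hF : F ∈ separableAlg q X) :
    ∃ (n : ℕ) (c : Fin n → X → ℝ) (Q : Fin n → ℝ → SmoothOp d),
      (∀ i, Continuous (c i)) ∧ (∀ i, Q i ∈ flowAlg q) ∧ ∀ x t, F x t = ∑ i, c i x • Q i t := by
  rw [separableAlg, ← Subalgebra.mem_toSubmodule, Algebra.adjoin_eq_span,
    Submodule.mem_span_set'] at hF
  obtain ⟨n, r, g, rfl⟩ := hF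
  have hproduct : ∀ G ∈ Submonoid.closure {F : X → ℝ → SmoothOp d |
      ∃ c : X → ℝ, Continuous c ∧ ∃ Q ∈ flowAlg q, F = fun x => c x • Q},
      ∃ c : X → ℝ, Continuous c ∧ ∃ Q ∈ flowAlg q, G = fun x => c x • Q := fun _ hG => by
    induction hG using Submonoid.closure_induction with
    | mem _ hG => exact hG
    | one => exact ⟨1, continuous_one, 1, one_mem _, by simp [Pi.one_def]⟩
    | mul G H _ _ hG hH =>
      obtain ⟨c, hc, Q, hQ, rfl⟩ := hG
      obtain ⟨c', hc', Q', hQ', rfl⟩ := hH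
      exact ⟨c * c', hc.mul hc', Q * Q', mul_mem hQ hQ', funext fun x =>
        smul_mul_smul_comm (c x) Q (c' x) Q'⟩
  choose c hc Q hQ hg using fun i => hproduct (g i) (g i).2
  refine ⟨n, fun i x => r i * c i x, Q, fun i => continuous_const.mul (hc i), hQ, fun x t => ?_⟩
  simp [hg, mul_smul]

variable {k : ℕ}

/-- The iterated integral from `r` of a separable family. -/
def operatorIntegral (T : ℝ) {F : (Fin k → ℝ) → ℝ → SmoothOp d}
    (hF : F ∈ separableAlg q (Fin k → ℝ)) (r : ℝ) : ℝ → SmoothOp d :=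
  let hsum := (exists_eq_sum_of_mem_separableAlg hF).choose_spec
  ∑ i, iteratedIntegral T k r (hsum.choose i) • hsum.choose_spec.choose i

theorem exists_operatorIntegral_eq_sum (T : ℝ) {F : (Fin k → ℝ) → ℝ → SmoothOp d}
    (hF : F ∈ separableAlg q (Fin k → ℝ)) :
    ∃ (n : ℕ) (c : Fin n → (Fin k → ℝ) → ℝ) (Q : Fin n → ℝ → SmoothOp d),
      (∀ i, Continuous (c i)) ∧ (∀ i, Q i ∈ flowAlg q) ∧ (∀ τ t, F τ t = ∑ i, c i τ • Q i t) ∧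
        ∀ r t, operatorIntegral T hF r t = ∑ i, iteratedIntegral T k r (c i) • Q i t := by
  obtain ⟨hc, hQ, hF'⟩ := (exists_eq_sum_of_mem_separableAlg hF).choose_spec.choose_spec.choose_spec
  exact ⟨_, _, _, hc, hQ, hF', fun r t => by simp [operatorIntegral]⟩

theorem operatorIntegral_mem (T : ℝ) {F : (Fin k → ℝ) → ℝ → SmoothOp d}
    (hF : F ∈ separableAlg q (Fin k → ℝ)) (r : ℝ) : operatorIntegral T hF r ∈ flowAlg q := by
  obtain ⟨n, c, Q, -, hQ, -, hI⟩ := exists_operatorIntegral_eq_sum T hF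
  have hr : operatorIntegral T hF r = ∑ i, iteratedIntegral T k r (c i) • Q i := by
    ext1 t
    simp [hI]
  exact hr ▸ sum_mem fun i _ => Subalgebra.smul_mem _ (hQ i) _

theorem iteratedIntegral_apply_separable {F : (Fin k → ℝ) → ℝ → SmoothOp d}
    (hF : F ∈ separableAlg q (Fin k → ℝ)) (P : SmoothOp d) (T r t : ℝ) (f : SmoothFn d)
    (z : Space d) :
    iteratedIntegral T k r (fun τ => (P (F τ t f) : Space d → ℝ) z) =
      (P (operatorIntegral T hF r t f) : Space d → ℝ) z := by
  obtain ⟨n, c, Q, hc, -, hF', hI⟩ := exists_operatorIntegral_eq_sum T hF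
  simpa [hF', hI] using iteratedIntegral_sum_mul T k r hc fun i => (P (Q i t f) : Space d → ℝ) z

theorem operatorIntegral_apply (T : ℝ) {F : (Fin k → ℝ) → ℝ → SmoothOp d}
    (hF : F ∈ separableAlg q (Fin k → ℝ)) (r t : ℝ) (f : SmoothFn d) (z : Space d) :
    (operatorIntegral T hF r t f : Space d → ℝ) z =
      iteratedIntegral T k r fun τ => (F τ t f : Space d → ℝ) z :=
  (iteratedIntegral_apply_separable hF 1 T r t f z).symm

theorem tendsto_operatorIntegral (T : ℝ) {F : (Fin (k + 1) → ℝ) → ℝ → SmoothOp d}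
    (hF : F ∈ separableAlg q (Fin (k + 1) → ℝ)) (t : ℝ) (f : SmoothFn d) (z : Space d) :
    Tendsto (fun r => (operatorIntegral T hF r t f : Space d → ℝ) z) (𝓝 T) (𝓝 0) := by
  obtain ⟨n, c, Q, hc, -, -, hI⟩ := exists_operatorIntegral_eq_sum T hF
  have hcont := tendsto_finsetSum Finset.univ fun i _ =>
    (hasDerivAt_iteratedIntegral_succ T k (hc i) T).continuousAt.tendsto.mul_const
      ((Q i t f : Space d → ℝ) z)
  simpa [hI, iteratedIntegral_succ_self] using hcont

theorem isRegularPath_operatorIntegral {T : ℝ} {F : (Fin (k + 1) → ℝ) → ℝ → SmoothOp d}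
    (hF : F ∈ separableAlg q (Fin (k + 1) → ℝ)) {G : ℝ → ℝ → SmoothOp d}
    {H : (Fin k → ℝ) → ℝ → SmoothOp d} (hH : H ∈ separableAlg q (Fin k → ℝ))
    (hcons : ∀ s τ t, F (Fin.cons s τ) t = G s t * H τ t) {V : ℝ → SmoothFn d}
    (hV : IsRegularSol q T V) :
    IsRegularPath T (fun t => operatorIntegral T hF t t (V t)) fun t =>
      -(genOp q t (operatorIntegral T hF t t (V t)) +
        G t t (operatorIntegral T hH t t (V t))) := by
  obtain ⟨n, c, Q, hc, hQ, hF', hI⟩ := exists_operatorIntegral_eq_sum T hF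
  have hboundary : ∀ t, G t t (operatorIntegral T hH t t (V t)) =
      ∑ i, (iteratedIntegral T k t fun τ => c i (Fin.cons t τ)) • Q i t (V t) := fun t => by
    ext z
    rw [← iteratedIntegral_apply_separable hH]
    simp only [← Module.End.mul_apply, ← hcons, hF', LinearMap.sum_apply, LinearMap.smul_apply,
      SmoothFn.coe_sum, Subalgebra.coe_smul, Pi.smul_apply, smul_eq_mul]
    exact iteratedIntegral_sum_mul T k t
      (fun i => (hc i).comp (continuous_const.finCons continuous_id)) _
  convert IsRegularPath.sum Finset.univ fun i => (hV.flowAlg (hQ i)).smul fun t =>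
    hasDerivAt_iteratedIntegral_succ T k (hc i) t using 2 with t t
  · simp [hI]
  · simp only [hI, hboundary, LinearMap.sum_apply, LinearMap.smul_apply, map_sum, map_smul,
      smul_neg, neg_smul, Finset.sum_add_distrib, Finset.sum_neg_distrib]
    abel

end

/-! ### The expansion operators -/

/-- Continuous extensions to all times of the data entering the operators `𝒢_n`: `coeff α η`
stands for `∂_z^η a_α` along the curve `z̄`, and `center` for the curve itself. -/
structure TaylorData (d : ℕ) where
  coeff : MultiIndex d → MultiIndex d → ℝ → ℝ
  center : ℝ → Space d
  continuous_coeff : ∀ α ∈ indicesLeTwo d, ∀ η, Continuous (coeff α η)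
  continuous_center : ∀ j, Continuous fun t => center t j

section

variable (q : FrozenCoeff d) (b : TaylorData d)

/-- The components of `𝒵(t,s) - z̄(s)`, on smooth functions. -/
def smoothCenteredZ (s t : ℝ) (j : Fin (d + 1)) : SmoothOp d :=
  flowCoordOp q s j t - b.center s j • 1

/-- The operator `𝒢_n(t,s)` on smooth functions. -/
def smoothGOp (n : ℕ) (s t : ℝ) : SmoothOp d :=
  ∑ α ∈ indicesLeTwo d, ∑ η ∈ indicesOfOrder d n,
    ((1 / (multiFactorial η : ℝ)) * b.coeff α η s) •
      (ordPow (smoothCenteredZ q b s t) η * multiDerivOp α)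

/-- The product `𝒢_{i₁}(t,t₁) ⋯ 𝒢_{i_k}(t,t_k)` on smooth functions. -/
def smoothGProd {k : ℕ} (i : Fin k → ℕ) (τ : Fin k → ℝ) (t : ℝ) : SmoothOp d :=
  ((List.finRange k).map fun j => smoothGOp q b (i j) (τ j) t).prod

theorem flowCoordOp_eq_add (s t : ℝ) (j : Fin (d + 1)) :
    flowCoordOp q s j t = flowCoordOp q 0 j t + q.driftInt 0 s j • 1 +
      ∑ l, q.covInt 0 s j l • derivOp l := by
  simp only [flowCoordOp, q.driftInt_add t 0 s, q.covInt_add t 0 s, Pi.add_apply,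
    Matrix.add_apply, add_smul, Finset.sum_add_distrib]
  abel

theorem smoothCenteredZ_mem_separableAlg (j : Fin (d + 1)) :
    (fun s t => smoothCenteredZ q b s t j) ∈ separableAlg q ℝ := by
  have hexpand : (fun s t => smoothCenteredZ q b s t j) =
      (fun _ => flowCoordOp q 0 j) + (fun s => (q.driftInt 0 s j - b.center s j) • 1) +
        ∑ l, fun s => q.covInt 0 s j l • fun _ => derivOp l := by
    ext s t : 2
    simp only [smoothCenteredZ, flowCoordOp_eq_add q s t j, Pi.add_apply, Finset.sum_apply,
      Pi.smul_apply, Pi.one_apply]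
    module
  rw [hexpand]
  exact add_mem (add_mem (const_mem_separableAlg (flowCoordOp_mem_flowAlg j))
    (smul_mem_separableAlg ((q.continuous_driftInt_right 0 j).sub (b.continuous_center j))
      (one_mem _)))
    (sum_mem fun l _ =>
      smul_mem_separableAlg (q.continuous_covInt_right 0 j l) (derivOp_mem_flowAlg l))

theorem smoothGOp_mem_separableAlg (n : ℕ) : smoothGOp q b n ∈ separableAlg q ℝ := by
  have hexpand : smoothGOp q b n = ∑ α ∈ indicesLeTwo d, ∑ η ∈ indicesOfOrder d n,
      (fun s => ((1 / (multiFactorial η : ℝ)) * b.coeff α η s) • (1 : ℝ → SmoothOp d)) *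
        ((fun s t => ordPow (smoothCenteredZ q b s t) η) * fun _ _ => multiDerivOp α) := by
    ext s t : 2
    simp only [smoothGOp, Finset.sum_apply, Pi.mul_apply, Pi.smul_apply,
      smul_mul_assoc, one_mul]
  rw [hexpand]
  exact sum_mem fun α hα => sum_mem fun η _ => mul_mem
    (smul_mem_separableAlg (continuous_const.mul (b.continuous_coeff α hα η)) (one_mem _))
    (mul_mem (ordPow_mem_separableAlg (smoothCenteredZ_mem_separableAlg q b) η)
      (ordPow_mem_separableAlg (fun j => const_mem_separableAlg (derivOp_mem_flowAlg j)) α))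

theorem smoothGProd_mem_separableAlg {k : ℕ} (i : Fin k → ℕ) :
    smoothGProd q b i ∈ separableAlg q (Fin k → ℝ) := by
  have hexpand : smoothGProd q b i =
      ((List.finRange k).map fun j (τ : Fin k → ℝ) => smoothGOp q b (i j) (τ j)).prod := by
    ext τ t : 2
    simp [smoothGProd, Pi.list_prod_apply, Function.comp_def]
  rw [hexpand]
  refine list_prod_mem fun F hF => ?_
  obtain ⟨j, -, rfl⟩ := List.mem_map.1 hF
  exact comp_mem_separableAlg (smoothGOp_mem_separableAlg q b (i j)) (continuous_apply j)

theorem smoothGProd_cons {k : ℕ} (m : ℕ) (i : Fin k → ℕ) (s : ℝ) (τ : Fin k → ℝ) (t : ℝ) :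
    smoothGProd q b (Fin.cons m i : Fin (k + 1) → ℕ) (Fin.cons s τ) t =
      smoothGOp q b m s t * smoothGProd q b i τ t := by
  simp [smoothGProd, List.finRange_succ, Function.comp_def]

/-- The operator `𝓛_n` on smooth functions, with the iterated integrals starting at `r`
rather than at the time `t` of the operators `𝒢_i(t,·)`. It is the identity for `n = 0`. -/
def smoothLOp (T : ℝ) (n : ℕ) (r t : ℝ) : SmoothOp d :=
  ∑ k ∈ Finset.range (n + 1), ∑ i ∈ compositions n k,
    operatorIntegral T (smoothGProd_mem_separableAlg q b i) r t

theorem smoothLOp_mem_flowAlg (T : ℝ) (n : ℕ) (r : ℝ) : smoothLOp q b T n r ∈ flowAlg q := by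
  have hexpand : smoothLOp q b T n r = ∑ k ∈ Finset.range (n + 1), ∑ i ∈ compositions n k,
      operatorIntegral T (smoothGProd_mem_separableAlg q b i) r := by
    ext1 t
    simp only [smoothLOp, Finset.sum_apply]
  rw [hexpand]
  exact sum_mem fun k _ => sum_mem fun i _ => operatorIntegral_mem T _ r

theorem smoothLOp_apply (T : ℝ) (n : ℕ) (r t : ℝ) (f : SmoothFn d) (z : Space d) :
    (smoothLOp q b T n r t f : Space d → ℝ) z =
      ∑ k ∈ Finset.range (n + 1), ∑ i ∈ compositions n k,
        iteratedIntegral T k r fun τ => (smoothGProd q b i τ t f : Space d → ℝ) z := by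
  simp only [smoothLOp, LinearMap.sum_apply, SmoothFn.coe_sum, operatorIntegral_apply]

end

theorem mem_compositions {n k : ℕ} {i : Fin k → ℕ} :
    i ∈ compositions n k ↔ ∑ j, i j = n ∧ ∀ j, 1 ≤ i j := by
  simp [compositions]

theorem compositions_eq_empty {n k : ℕ} (h : n < k) : compositions n k = ∅ := by
  refine Finset.eq_empty_of_forall_notMem fun i hi => h.not_ge ?_
  obtain ⟨rfl, hpos⟩ := mem_compositions.1 hi
  simpa using Finset.sum_le_sum fun j (_ : j ∈ Finset.univ) => hpos j

theorem compositions_zero_zero : compositions 0 0 = {Fin.elim0} := by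
  ext i
  simp [mem_compositions, eq_iff_true_of_subsingleton]

theorem compositions_zero_right {n : ℕ} (hn : 1 ≤ n) : compositions n 0 = ∅ := by
  refine Finset.eq_empty_of_forall_notMem fun i hi => ?_
  obtain ⟨rfl, -⟩ := mem_compositions.1 hi
  simp at hn

theorem sum_compositions_succ {M : Type*} [AddCommMonoid M] (n k : ℕ)
    (f : (Fin (k + 1) → ℕ) → M) :
    ∑ i ∈ compositions n (k + 1), f i =
      ∑ m ∈ Finset.Icc 1 n, ∑ i ∈ compositions (n - m) k, f (Fin.cons m i) := by
  rw [Finset.sum_sigma']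
  refine Finset.sum_bij' (fun i _ => ⟨i 0, Fin.tail i⟩)
    (fun p _ => (Fin.cons p.1 p.2 : Fin (k + 1) → ℕ)) (fun i hi => ?_) (fun p hp => ?_)
    (fun i _ => Fin.cons_self_tail i) (fun _ _ => rfl)
    fun i _ => congrArg f (Fin.cons_self_tail i).symm
  · obtain ⟨hsum, hpos⟩ := mem_compositions.1 hi
    rw [Fin.sum_univ_succ] at hsum
    simp only [Finset.mem_sigma, Finset.mem_Icc, mem_compositions, Fin.tail]
    exact ⟨⟨hpos 0, by omega⟩, by omega, fun j => hpos _⟩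
  · simp only [Finset.mem_sigma, Finset.mem_Icc, mem_compositions] at hp ⊢
    obtain ⟨⟨hm_pos, hm_le⟩, hsum, hpos⟩ := hp
    simp only [Fin.sum_univ_succ, Fin.forall_fin_succ, Fin.cons_zero, Fin.cons_succ, hsum]
    exact ⟨by omega, hm_pos, hpos⟩

section

variable {q : FrozenCoeff d} {b : TaylorData d}

theorem smoothLOp_zero (T r t : ℝ) : smoothLOp q b T 0 r t = 1 := by
  ext f z
  simp [smoothLOp_apply, compositions_zero_zero, iteratedIntegral, smoothGProd]

theorem smoothLOp_eq_sum_range (T : ℝ) {n N : ℕ} (hN : n < N) (r t : ℝ) :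
    smoothLOp q b T n r t = ∑ k ∈ Finset.range N, ∑ i ∈ compositions n k,
      operatorIntegral T (smoothGProd_mem_separableAlg q b i) r t := by
  refine Finset.sum_subset (Finset.range_subset_range.2 hN) fun k _ hk => ?_
  rw [Finset.mem_range, not_lt] at hk
  rw [compositions_eq_empty hk, Finset.sum_empty]

theorem smoothLOp_eq_sum_succ (T : ℝ) {n : ℕ} (hn : 1 ≤ n) (r t : ℝ) :
    smoothLOp q b T n r t = ∑ k ∈ Finset.range n, ∑ i ∈ compositions n (k + 1),
      operatorIntegral T (smoothGProd_mem_separableAlg q b i) r t := by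
  rw [smoothLOp, Finset.sum_range_succ', compositions_zero_right hn, Finset.sum_empty, add_zero]

theorem smoothLOp_eq_sum_cons (T : ℝ) {n : ℕ} (hn : 1 ≤ n) (r t : ℝ) :
    smoothLOp q b T n r t = ∑ m ∈ Finset.Icc 1 n, ∑ k ∈ Finset.range n,
      ∑ i ∈ compositions (n - m) k, operatorIntegral T
        (smoothGProd_mem_separableAlg q b (Fin.cons m i : Fin (k + 1) → ℕ)) r t := by
  rw [Finset.sum_comm, smoothLOp_eq_sum_succ T hn]
  exact Finset.sum_congr rfl fun k _ => sum_compositions_succ n k _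

/-- Differentiation in the starting time of the integrals strips off the outermost operator
`𝒢_m(t,t)`, since all the other factors commute with `∂_t + genOp q t`. -/
theorem isRegularPath_smoothLOp {T : ℝ} {V : ℝ → SmoothFn d} (hV : IsRegularSol q T V) {n : ℕ}
    (hn : 1 ≤ n) :
    IsRegularPath T (fun t => smoothLOp q b T n t t (V t)) fun t =>
      -(genOp q t (smoothLOp q b T n t t (V t)) +
        ∑ m ∈ Finset.Icc 1 n, smoothGOp q b m t t (smoothLOp q b T (n - m) t t (V t))) := by
  have hsource : ∀ t, ∀ m ∈ Finset.Icc 1 n,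
      smoothGOp q b m t t (smoothLOp q b T (n - m) t t (V t)) =
      ∑ k ∈ Finset.range n, ∑ i ∈ compositions (n - m) k, smoothGOp q b m t t
        (operatorIntegral T (smoothGProd_mem_separableAlg q b i) t t (V t)) := fun t m hm => by
    rw [Finset.mem_Icc] at hm
    simp only [smoothLOp_eq_sum_range T (show n - m < n by omega), LinearMap.sum_apply, map_sum]
  convert IsRegularPath.sum (Finset.Icc 1 n) fun m => IsRegularPath.sum (Finset.range n) fun k =>
    IsRegularPath.sum (compositions (n - m) k) fun i =>
      isRegularPath_operatorIntegral (T := T)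
        (smoothGProd_mem_separableAlg q b (Fin.cons m i : Fin (k + 1) → ℕ))
        (smoothGProd_mem_separableAlg q b i) (smoothGProd_cons q b m i) hV using 2 with t t
  · simp only [smoothLOp_eq_sum_cons T hn, LinearMap.sum_apply]
  · rw [Finset.sum_congr rfl (hsource t)]
    simp only [smoothLOp_eq_sum_cons T hn, LinearMap.sum_apply, map_sum, Finset.sum_neg_distrib,
      Finset.sum_add_distrib]

theorem tendsto_smoothLOp {n : ℕ} (hn : 1 ≤ n) (T t : ℝ) (f : SmoothFn d) (z : Space d) :
    Tendsto (fun r => (smoothLOp q b T n r t f : Space d → ℝ) z) (𝓝 T) (𝓝 0) := by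
  simp only [smoothLOp_eq_sum_succ T hn, LinearMap.sum_apply, SmoothFn.coe_sum]
  simpa using tendsto_finsetSum (Finset.range n) fun k _ =>
    tendsto_finsetSum (compositions n (k + 1)) fun i _ =>
      tendsto_operatorIntegral T (smoothGProd_mem_separableAlg q b i) t f z

end

/-! ### Multi-indices of order at most two -/

section

variable {ι X : Type*} (B : ι → X → X) (x : X)

theorem foldr_iterate_zero (l : List ι) :
    l.foldr (fun i y => (B i)^[(0 : ι → ℕ) i] y) x = x := by
  induction l with
  | nil => rfl
  | cons _ _ ih => exact ih

variable [LinearOrder ι]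

theorem foldr_iterate_single (j : ι) {l : List ι} (hl : l.Nodup) :
    l.foldr (fun i y => (B i)^[(Pi.single j 1 : ι → ℕ) i] y) x = if j ∈ l then B j x else x := by
  induction l with
  | nil => rfl
  | cons i l ih =>
    obtain ⟨hil, hl'⟩ := List.nodup_cons.1 hl
    rw [List.foldr_cons, ih hl']
    rcases eq_or_ne j i with rfl | hij
    · simp [hil]
    · simp [hij, hij.symm]

theorem foldr_iterate_single_add_single {j k : ι} (hjk : j ≤ k) {l : List ι}
    (hl : l.Pairwise (· < ·)) (hj : j ∈ l) (hk : k ∈ l) :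
    l.foldr (fun i y => (B i)^[(Pi.single j 1 + Pi.single k 1 : ι → ℕ) i] y) x =
      B j (B k x) := by
  induction l with
  | nil => simp at hj
  | cons i l ih =>
    obtain ⟨hi, hl'⟩ := List.pairwise_cons.1 hl
    rw [List.foldr_cons]
    rcases eq_or_ne j i with rfl | hji
    · have htail : l.foldr (fun i y => (B i)^[(Pi.single j 1 + Pi.single k 1 : ι → ℕ) i] y) x =
          l.foldr (fun i y => (B i)^[(Pi.single k 1 : ι → ℕ) i] y) x :=
        List.foldr_ext _ _ x fun i hil y => by simp [(hi i hil).ne']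
      rw [htail, foldr_iterate_single B x k (hl'.imp ne_of_lt)]
      rcases hjk.eq_or_lt with rfl | hlt
      · simp [show j ∉ l from fun hjl => (hi j hjl).false]
      · simp [hlt.ne, (List.mem_cons.1 hk).resolve_left hlt.ne']
    · have hjl := (List.mem_cons.1 hj).resolve_left hji
      have hik : i < k := (hi j hjl).trans_le hjk
      rw [ih hl' hjl ((List.mem_cons.1 hk).resolve_left hik.ne')]
      simp [hji.symm, hik.ne]

end

theorem multiDeriv_zero (f : Space d → ℝ) : multiDeriv 0 f = f :=
  foldr_iterate_zero _ f _

theorem multiDeriv_single (j : Fin (d + 1)) (f : Space d → ℝ) :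
    multiDeriv (Pi.single j 1) f = partialDeriv j f :=
  (foldr_iterate_single _ f j (List.nodup_finRange _)).trans (if_pos (List.mem_finRange j))

theorem multiDeriv_single_add_single_of_le {j l : Fin (d + 1)} (hjl : j ≤ l) (f : Space d → ℝ) :
    multiDeriv (Pi.single j 1 + Pi.single l 1) f = partialDeriv j (partialDeriv l f) :=
  foldr_iterate_single_add_single _ f hjl (List.pairwise_lt_finRange _) (List.mem_finRange j)
    (List.mem_finRange l)

theorem multiDeriv_single_add_single {f : Space d → ℝ} (hf : ContDiff ℝ 2 f)
    (j l : Fin (d + 1)) :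
    multiDeriv (Pi.single j 1 + Pi.single l 1) f = partialDeriv j (partialDeriv l f) := by
  rcases le_total j l with hjl | hlj
  · exact multiDeriv_single_add_single_of_le hjl f
  · rw [add_comm, multiDeriv_single_add_single_of_le hlj, partialDeriv_comm hf]

theorem mem_indicesOfOrder {n : ℕ} {α : MultiIndex d} :
    α ∈ indicesOfOrder d n ↔ ∑ j, α j = n := by
  simp [indicesOfOrder]

theorem mem_indicesLeTwo {α : MultiIndex d} : α ∈ indicesLeTwo d ↔ ∑ j, α j ≤ 2 := by
  simp [indicesLeTwo, mem_indicesOfOrder, Nat.lt_succ_iff]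

theorem single_add_single_mem_indicesOfOrder (j l : Fin (d + 1)) :
    Pi.single j 1 + Pi.single l 1 ∈ indicesOfOrder d 2 := by
  simp [mem_indicesOfOrder, Finset.sum_add_distrib]

theorem indicesOfOrder_zero : indicesOfOrder d 0 = {0} := by
  ext α
  simp [mem_indicesOfOrder, funext_iff]

theorem exists_eq_add_single_of_mem_indicesOfOrder {n : ℕ} {α : MultiIndex d}
    (hα : α ∈ indicesOfOrder d (n + 1)) :
    ∃ β ∈ indicesOfOrder d n, ∃ j, α = β + Pi.single j 1 := by
  rw [mem_indicesOfOrder] at hα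
  obtain ⟨β, j, rfl⟩ := MultiIndex.exists_eq_add_single (β := α) (by rintro rfl; simp at hα)
  exact ⟨β, mem_indicesOfOrder.2 (by simpa [Finset.sum_add_distrib] using hα), j, rfl⟩

theorem indicesOfOrder_one :
    indicesOfOrder d 1 = Finset.univ.image fun j => Pi.single j 1 := by
  ext α
  simp only [Finset.mem_image, Finset.mem_univ, true_and]
  refine ⟨fun hα => ?_, ?_⟩
  · obtain ⟨β, hβ, j, rfl⟩ := exists_eq_add_single_of_mem_indicesOfOrder hα
    rw [indicesOfOrder_zero, Finset.mem_singleton] at hβ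
    exact ⟨j, by rw [hβ, zero_add]⟩
  · rintro ⟨j, rfl⟩
    simp [mem_indicesOfOrder]

theorem sum_indicesOfOrder_one (g : MultiIndex d → ℝ) :
    ∑ α ∈ indicesOfOrder d 1, g α = ∑ j, g (Pi.single j 1) := by
  rw [indicesOfOrder_one, Finset.sum_image fun i _ j _ h => ?_]
  by_contra hij
  simpa [hij] using congrFun h i

theorem single_add_single_eq_iff {i j k l : Fin (d + 1)} :
    (Pi.single j 1 + Pi.single l 1 : MultiIndex d) = Pi.single i 1 + Pi.single k 1 ↔
      (j = i ∧ l = k) ∨ (j = k ∧ l = i) := by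
  refine ⟨fun h => ?_, ?_⟩
  · have hj := congrFun h j
    have hl := congrFun h l
    have hi := congrFun h i
    simp only [Pi.add_apply, Pi.single_apply] at hj hl hi
    grind
  · rintro (⟨rfl, rfl⟩ | ⟨rfl, rfl⟩)
    · rfl
    · exact add_comm _ _

/-- Each `α` of order two comes from two ordered pairs `(j, l)` when it is not a square and from
one when it is, which the factor `2` on the diagonal compensates. -/
theorem sum_indicesOfOrder_two (g : MultiIndex d → ℝ) :
    ∑ α ∈ indicesOfOrder d 2, g α =
      (1 / 2) * ∑ j, ∑ l, (if j = l then 2 else 1) * g (Pi.single j 1 + Pi.single l 1) := by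
  have hpairs : ∑ j, ∑ l, (if j = l then 2 else 1) * g (Pi.single j 1 + Pi.single l 1) =
      ∑ p : Fin (d + 1) × Fin (d + 1),
        (if p.1 = p.2 then 2 else 1) * g (Pi.single p.1 1 + Pi.single p.2 1) := by
    rw [Fintype.sum_prod_type]
  rw [hpairs, ← Finset.sum_fiberwise_of_maps_to (t := indicesOfOrder d 2)
    (g := fun p : Fin (d + 1) × Fin (d + 1) => Pi.single p.1 1 + Pi.single p.2 1)
    fun p _ => single_add_single_mem_indicesOfOrder _ _, Finset.mul_sum]
  refine Finset.sum_congr rfl fun α hα => ?_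
  obtain ⟨β, hβ, k, rfl⟩ := exists_eq_add_single_of_mem_indicesOfOrder hα
  obtain ⟨γ, hγ, i, rfl⟩ := exists_eq_add_single_of_mem_indicesOfOrder hβ
  rw [indicesOfOrder_zero, Finset.mem_singleton] at hγ
  have hfiber : Finset.univ.filter (fun p : Fin (d + 1) × Fin (d + 1) =>
      (Pi.single p.1 1 + Pi.single p.2 1 : MultiIndex d) = Pi.single i 1 + Pi.single k 1) =
      {(i, k), (k, i)} := by
    ext ⟨j, l⟩
    simp [single_add_single_eq_iff]
  rw [hγ, zero_add, hfiber]
  rcases eq_or_ne i k with rfl | hik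
  · simp
  · rw [Finset.sum_pair fun h => hik (Prod.ext_iff.1 h).1, if_neg hik, if_neg hik.symm,
      add_comm (Pi.single k 1 : MultiIndex d)]
    ring

theorem sum_indicesLeTwo (g : MultiIndex d → ℝ) :
    ∑ α ∈ indicesLeTwo d, g α = g 0 + ∑ j, g (Pi.single j 1) +
      (1 / 2) * ∑ j, ∑ l, (if j = l then 2 else 1) * g (Pi.single j 1 + Pi.single l 1) := by
  rw [indicesLeTwo, Finset.sum_biUnion fun m _ n _ hmn => ?_, Finset.sum_range_succ,
    Finset.sum_range_succ, Finset.sum_range_one, indicesOfOrder_zero, Finset.sum_singleton,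
    sum_indicesOfOrder_one, sum_indicesOfOrder_two]
  exact Finset.disjoint_left.2 fun α hm hn =>
    hmn ((mem_indicesOfOrder.1 hm).symm.trans (mem_indicesOfOrder.1 hn))

/-! ### Freezing the coefficients along the curve -/

theorem nonneg_of_integral_nonneg {g : ℝ → ℝ} {t₀ t₁ : ℝ} (hg : ContinuousOn g (Icc t₀ t₁))
    (h₀₁ : t₀ < t₁) (h : ∀ t s : ℝ, t₀ ≤ t → t < s → s ≤ t₁ → 0 ≤ ∫ r in t..s, g r) {t : ℝ}
    (ht : t ∈ Icc t₀ t₁) : 0 ≤ g t := by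
  have hint : ∀ {r s}, r ∈ Icc t₀ t₁ → s ∈ Icc t₀ t₁ →
      IntervalIntegrable g MeasureTheory.volume r s :=
    fun hr hs => (hg.mono (uIcc_subset_Icc hr hs)).intervalIntegrable
  have h₀ : t₀ ∈ Icc t₀ t₁ := left_mem_Icc.2 h₀₁.le
  have hmono : MonotoneOn (fun s => ∫ r in t₀..s, g r) (Icc t₀ t₁) := fun r hr s hs hrs => by
    rcases hrs.eq_or_lt with rfl | hrs
    · exact le_rfl
    have hadd := intervalIntegral.integral_add_adjacent_intervals (hint h₀ hr) (hint hr hs)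
    linarith [h r s hr.1 hrs hs.2]
  have : Fact (t ∈ Icc t₀ t₁) := ⟨ht⟩
  have hderiv : HasDerivWithinAt (fun s => ∫ r in t₀..s, g r) (g t) (Icc t₀ t₁) t :=
    intervalIntegral.integral_hasDerivWithinAt_right (hint h₀ ht)
      (hg.stronglyMeasurableAtFilter_nhdsWithin measurableSet_Icc t) (hg t ht)
  rw [← hderiv.derivWithin (uniqueDiffOn_Icc h₀₁ t ht)]
  exact hmono.derivWithin_nonneg

theorem posSemidef_of_posSemidef_integral {n : Type*} [Finite n] {t₀ t₁ : ℝ} (h₀₁ : t₀ < t₁)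
    {c : ℝ → Matrix n n ℝ} (hc : ∀ j l, ContinuousOn (fun t => c t j l) (Icc t₀ t₁))
    (hC : ∀ t s : ℝ, t₀ ≤ t → t < s → s ≤ t₁ →
      (Matrix.of fun j l => ∫ r in t..s, c r j l).PosSemidef)
    {t : ℝ} (ht : t ∈ Icc t₀ t₁) (hsymm : ∀ j l, c t j l = c t l j) : (c t).PosSemidef := by
  have := Fintype.ofFinite n
  refine posSemidef_iff_sum.2 ⟨hsymm, fun x => ?_⟩
  have hcont : ContinuousOn (fun t => ∑ j, ∑ l, c t j l * (x j * x l)) (Icc t₀ t₁) :=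
    continuousOn_finsetSum _ fun j _ => continuousOn_finsetSum _ fun l _ =>
      (hc j l).mul continuousOn_const
  refine nonneg_of_integral_nonneg hcont h₀₁ (fun r s hr hrs hs => ?_) ht
  rw [← sum_integral_mul fun j l => (hc j l).mono <|
    uIcc_subset_Icc ⟨hr, hrs.le.trans hs⟩ ⟨hr.trans hrs.le, hs⟩]
  exact (posSemidef_iff_sum.1 (hC r s hr hrs hs)).2 x

theorem covMatrix_symm (a : MultiIndex d → ℝ → Space d → ℝ) (zbar : ℝ → Space d) (t : ℝ)
    (j l : Fin (d + 1)) : covMatrix a zbar t j l = covMatrix a zbar t l j := by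
  simp only [covMatrix, Matrix.of_apply, add_comm (Pi.single j 1 : MultiIndex d), eq_comm]

/-- The spatially frozen coefficients `q` and the Taylor data `b` are those of the operator with
coefficients `a`, expanded about the curve `zbar`, on the time interval `[0,T]`. -/
structure IsFreezing (T : ℝ) (a : MultiIndex d → ℝ → Space d → ℝ) (zbar : ℝ → Space d)
    (q : FrozenCoeff d) (b : TaylorData d) : Prop where
  rate : ∀ t ∈ Icc 0 T, q.rate t = a 0 t (zbar t)
  drift : ∀ t ∈ Icc 0 T, q.drift t = driftVec a zbar t
  cov : ∀ t ∈ Icc 0 T, q.cov t = covMatrix a zbar t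
  center : ∀ t ∈ Icc 0 T, b.center t = zbar t
  coeff : ∀ t ∈ Icc 0 T, ∀ α η, b.coeff α η t = multiDeriv η (a α t) (zbar t)

theorem FrozenCoeff.exists_boundedOn (q : FrozenCoeff d) {s : Set ℝ} (hs : IsCompact s) :
    ∃ B, q.BoundedOn B s := by
  have hcont : Continuous fun t => (q.rate t, q.drift t, fun j => q.cov t j j) :=
    q.continuous_rate.prodMk ((continuous_pi q.continuous_drift).prodMk
      (continuous_pi fun j => q.continuous_cov j j))
  obtain ⟨B, hB⟩ := hs.exists_bound_of_continuousOn hcont.continuousOn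
  have hB' : ∀ t ∈ s, |q.rate t| ≤ B ∧ ‖q.drift t‖ ≤ B ∧ ‖fun j => q.cov t j j‖ ≤ B :=
    fun t ht => by simpa [Prod.norm_def] using hB t ht
  exact ⟨B, fun t ht => (hB' t ht).1, fun t ht j => (norm_le_pi_norm _ j).trans (hB' t ht).2.1,
    fun t ht j => (norm_le_pi_norm _ j).trans (hB' t ht).2.2⟩

theorem exists_isFreezing {T : ℝ} (hT : 0 < T) {a : MultiIndex d → ℝ → Space d → ℝ}
    {zbar : ℝ → Space d}
    (ha_cont : ∀ α ∈ indicesLeTwo d, ∀ η : MultiIndex d,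
      ContinuousOn (fun t => multiDeriv η (a α t) (zbar t)) (Icc 0 T))
    (hzbar : ContinuousOn zbar (Icc 0 T))
    (hC : ∀ t s : ℝ, 0 ≤ t → t < s → s ≤ T → (covInt a zbar t s).PosDef) :
    ∃ q b, IsFreezing T a zbar q b := by
  have ha : ∀ α ∈ indicesLeTwo d, ContinuousOn (fun t => a α t (zbar t)) (Icc 0 T) :=
    fun α hα => by simpa only [multiDeriv_zero] using ha_cont α hα 0
  have hcov : ∀ j l, ContinuousOn (fun t => covMatrix a zbar t j l) (Icc 0 T) := fun j l =>
    continuousOn_const.mul <| ha _ <| mem_indicesLeTwo.2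
      (mem_indicesOfOrder.1 (single_add_single_mem_indicesOfOrder j l)).le
  let proj : ℝ → ℝ := fun t => projIcc 0 T hT.le t
  have hproj_mem : ∀ t, proj t ∈ Icc 0 T := fun t => (projIcc 0 T hT.le t).2
  have hproj : ∀ t ∈ Icc 0 T, proj t = t := fun t ht => by simp [proj, projIcc_of_mem hT.le ht]
  have hext : ∀ {E : Type} [TopologicalSpace E] {f : ℝ → E}, ContinuousOn f (Icc 0 T) →
      Continuous fun t => f (proj t) := fun hf =>
    hf.comp_continuous (continuous_subtype_val.comp continuous_projIcc) hproj_mem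
  let q : FrozenCoeff d :=
    { rate := fun t => a 0 (proj t) (zbar (proj t))
      drift := fun t => driftVec a zbar (proj t)
      cov := fun t => covMatrix a zbar (proj t)
      continuous_rate := hext (ha 0 (by simp [mem_indicesLeTwo]))
      continuous_drift := fun j => hext (ha _ (by simp [mem_indicesLeTwo]))
      continuous_cov := fun j l => hext (hcov j l)
      posSemidef_cov := fun t => posSemidef_of_posSemidef_integral hT hcov
        (fun t s ht hts hs => (hC t s ht hts hs).posSemidef) (hproj_mem t)
        (covMatrix_symm a zbar _) }
  let b : TaylorData d :=
    { coeff := fun α η t => multiDeriv η (a α (proj t)) (zbar (proj t))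
      center := fun t => zbar (proj t)
      continuous_coeff := fun α hα η => hext (ha_cont α hα η)
      continuous_center := fun j => (continuous_apply j).comp (hext hzbar) }
  refine ⟨q, b, ?_, ?_, ?_, ?_, ?_⟩ <;> intro t ht <;> simp only [q, b, hproj t ht, implies_true]

theorem taylorCoeff_zero (a : MultiIndex d → ℝ → Space d → ℝ) (zbar : ℝ → Space d)
    (α : MultiIndex d) (t : ℝ) (z : Space d) : taylorCoeff a zbar α 0 t z = a α t (zbar t) := by
  simp [taylorCoeff, indicesOfOrder_zero, multiDeriv_zero, multiFactorial]

theorem ordPow_mulOp (g : Fin (d + 1) → SmoothFn d) (η : MultiIndex d) :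
    ordPow (fun j => mulOp (g j)) η = mulOp (∏ j, g j ^ η j) := by
  have hmap := map_list_prod (Algebra.lmul ℝ (SmoothFn d)) (List.ofFn fun j => g j ^ η j)
  rw [List.prod_ofFn, List.map_ofFn] at hmap
  rw [ordPow, ← List.ofFn_eq_map]
  refine Eq.trans ?_ hmap.symm
  congr 2
  ext1 j
  exact (map_pow (Algebra.lmul ℝ (SmoothFn d)) (g j) (η j)).symm

theorem smoothCenteredZ_self (q : FrozenCoeff d) (b : TaylorData d) (t : ℝ) (j : Fin (d + 1)) :
    smoothCenteredZ q b t t j = mulOp (coordFn j - b.center t j • 1) := by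
  ext f z
  simp [smoothCenteredZ, flowCoordOp, q.driftInt_self, q.covInt_self, sub_mul]

namespace IsFreezing

variable {T : ℝ} {a : MultiIndex d → ℝ → Space d → ℝ} {zbar : ℝ → Space d}
  {q : FrozenCoeff d} {b : TaylorData d}

theorem generatorTerm_zero (h : IsFreezing T a zbar q b) {t : ℝ} (ht : t ∈ Icc 0 T)
    {f : Space d → ℝ} (hf : ContDiff ℝ 2 f) :
    generatorTerm a zbar 0 t f = genFn q t f := by
  ext z
  simp only [generatorTerm, taylorCoeff_zero, sum_indicesLeTwo, multiDeriv_zero,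
    multiDeriv_single, multiDeriv_single_add_single hf, genFn, h.rate t ht, h.drift t ht,
    h.cov t ht, driftVec, covMatrix, Matrix.of_apply, mul_assoc]

theorem meanInt_eq (h : IsFreezing T a zbar q b) {t s : ℝ} (ht : t ∈ Icc 0 T)
    (hs : s ∈ Icc 0 T) : meanInt a zbar t s = q.driftInt t s := by
  ext j
  exact intervalIntegral.integral_congr fun r hr => by
    simp only [h.drift r (uIcc_subset_Icc ht hs hr)]

theorem covInt_eq (h : IsFreezing T a zbar q b) {t s : ℝ} (ht : t ∈ Icc 0 T)
    (hs : s ∈ Icc 0 T) : covInt a zbar t s = q.covInt t s := by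
  ext j l
  exact intervalIntegral.integral_congr fun r hr => by
    simp only [h.cov r (uIcc_subset_Icc ht hs hr)]

theorem covInt_posDef (h : IsFreezing T a zbar q b)
    (hC : ∀ t s : ℝ, 0 ≤ t → t < s → s ≤ T → (PolyExpansion.covInt a zbar t s).PosDef) (t s : ℝ)
    (ht : 0 ≤ t) (hts : t < s) (hs : s ≤ T) : (q.covInt t s).PosDef := by
  rw [← h.covInt_eq ⟨ht, hts.le.trans hs⟩ ⟨ht.trans hts.le, hs⟩]
  exact hC t s ht hts hs

theorem centeredZ_eq_coe (h : IsFreezing T a zbar q b) {t s : ℝ} (ht : t ∈ Icc 0 T)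
    (hs : s ∈ Icc 0 T) (j : Fin (d + 1)) (f : SmoothFn d) :
    centeredZ a zbar t s j f = (smoothCenteredZ q b s t j f : Space d → ℝ) := by
  ext z
  simp [centeredZ, smoothCenteredZ, flowCoordOp, h.meanInt_eq ht hs, h.covInt_eq ht hs,
    h.center s hs, LinearMap.sum_apply, coe_derivOp, add_mul]

theorem gOp_eq_coe (h : IsFreezing T a zbar q b) {t s : ℝ} (ht : t ∈ Icc 0 T)
    (hs : s ∈ Icc 0 T) (n : ℕ) (f : SmoothFn d) :
    gOp a zbar n t s f = (smoothGOp q b n s t f : Space d → ℝ) := by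
  ext z
  simp only [gOp, taylorOp, smoothGOp, multiDeriv_eq_coe _ f, h.coeff s hs,
    opMonomial_eq_coe_ordPow (h.centeredZ_eq_coe ht hs), LinearMap.sum_apply,
    LinearMap.smul_apply, Module.End.mul_apply, SmoothFn.coe_sum, Subalgebra.coe_smul,
    Pi.smul_apply, smul_eq_mul]

theorem gProd_eq_coe (h : IsFreezing T a zbar q b) {t : ℝ} (ht : t ∈ Icc 0 T) {k : ℕ}
    {τ : Fin k → ℝ} (hτ : ∀ j, τ j ∈ Icc 0 T) (i : Fin k → ℕ) (f : SmoothFn d) :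
    gProd a zbar i t τ f = (smoothGProd q b i τ t f : Space d → ℝ) := by
  unfold gProd smoothGProd
  induction List.finRange k with
  | nil => rfl
  | cons j l ih =>
    rw [List.foldr_cons, ih, h.gOp_eq_coe ht (hτ j), List.map_cons, List.prod_cons]
    rfl

theorem lOp_eq_coe (h : IsFreezing T a zbar q b) {t : ℝ} (ht : t ∈ Icc 0 T) {n : ℕ}
    (hn : 1 ≤ n) (f : SmoothFn d) :
    lOp a zbar n t T f = (smoothLOp q b T n t t f : Space d → ℝ) := by
  ext z
  rw [smoothLOp_apply, Finset.range_eq_Ico, Finset.sum_eq_sum_Ico_succ_bot n.succ_pos,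
    compositions_zero_right hn, Finset.sum_empty, zero_add]
  refine Finset.sum_congr rfl fun k _ => Finset.sum_congr rfl fun i _ =>
    iteratedIntegral_congr ht.2 fun τ hτ => ?_
  rw [h.gProd_eq_coe ht fun j => ⟨ht.1.trans (hτ j).1, (hτ j).2⟩]

theorem generatorTerm_eq_coe (h : IsFreezing T a zbar q b) {t : ℝ} (ht : t ∈ Icc 0 T) (n : ℕ)
    (f : SmoothFn d) :
    generatorTerm a zbar n t f = (smoothGOp q b n t t f : Space d → ℝ) := by
  have hmonomial : ∀ (η : MultiIndex d) (g : SmoothFn d) z,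
      (ordPow (smoothCenteredZ q b t t) η g : Space d → ℝ) z =
        (∏ j, (z j - zbar t j) ^ η j) * (g : Space d → ℝ) z := fun η g z => by
    rw [funext (smoothCenteredZ_self q b t), ordPow_mulOp]
    simp [h.center t ht]
  ext z
  simp only [generatorTerm, taylorCoeff, smoothGOp, multiDeriv_eq_coe _ f, hmonomial,
    h.coeff t ht, LinearMap.sum_apply, LinearMap.smul_apply, Module.End.mul_apply,
    SmoothFn.coe_sum, Subalgebra.coe_smul, Pi.smul_apply, smul_eq_mul, Finset.sum_mul]
  exact Finset.sum_congr rfl fun α _ => Finset.sum_congr rfl fun η _ => by ring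

end IsFreezing

/-! ### Uniqueness -/

namespace IsRegularPath

variable {T t₁ : ℝ} {V V' : ℝ → SmoothFn d}

theorem isC12On (hV : IsRegularPath T V V') (ht₁ : t₁ < T) :
    IsC12On 0 t₁ (fun t => (V t : Space d → ℝ)) fun t => (V' t : Space d → ℝ) where
  continuousOn := by
    have hsub : Icc 0 t₁ ⊆ Ioo (-1) T := Icc_subset_Ioo (by norm_num) ht₁
    simpa [ordPow_zero] using (hV.continuousOn 0).mono (prod_mono_left hsub)
  contDiff t _ := (V t).contDiff_two
  hasDerivWithinAt t ht z := by
    have hder := hV.hasDerivAt 0 t ⟨by linarith [ht.1], ht.2.trans ht₁⟩ z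
    simpa [ordPow_zero] using hder.hasDerivWithinAt

theorem hasExpGrowthOn (hV : IsRegularPath T V V') (ht₁ : t₁ < T) :
    HasExpGrowthOn (Icc 0 t₁) fun t => (V t : Space d → ℝ) := by
  simpa [ordPow_zero] using hV.growth 0 t₁ ht₁

end IsRegularPath

theorem eventually_abs_le_weight {T : ℝ} (hT : 0 < T) {v : ℝ → Space d → ℝ}
    (hcont : ContinuousOn (fun p : ℝ × Space d => v p.1 p.2) (Icc 0 T ×ˢ univ)) {K c κ : ℝ}
    (hgrowth : ∀ t ∈ Icc 0 T, ∀ z, |v t z| ≤ K * Real.exp (c * ‖z‖)) (hκ : 0 ≤ κ) (hc : c < κ)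
    (hterm : v T = 0) {ε : ℝ} (hε : 0 < ε) :
    ∀ᶠ s in 𝓝[<] T, ∀ z, |v s z| ≤ ε * weight κ z := by
  obtain ⟨R, hR⟩ := exists_radius_exp_le_weight (d := d) hκ hc K hε
  have huc := (isCompact_Icc.prod (isCompact_closedBall 0 R)).uniformContinuousOn_of_continuous
    (hcont.mono (prod_mono_right (subset_univ _)))
  obtain ⟨δ, hδ, hnear⟩ := Metric.uniformContinuousOn_iff.1 huc ε hε
  filter_upwards [Ioo_mem_nhdsLT (max_lt hT (sub_lt_self T hδ))] with s hs z
  rw [mem_Ioo, max_lt_iff] at hs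
  have hsI : s ∈ Icc 0 T := ⟨hs.1.1.le, hs.2.le⟩
  rcases le_total R ‖z‖ with hz | hz
  · exact (hgrowth s hsI z).trans (hR z hz)
  · have hzR : z ∈ Metric.closedBall 0 R := mem_closedBall_zero_iff.2 hz
    have hdist : dist (s, z) (T, z) < δ := by
      rw [Prod.dist_eq, dist_self, max_eq_left dist_nonneg, Real.dist_eq, abs_lt]
      constructor <;> linarith [hs.1.2, hs.2]
    have hsmall := hnear (s, z) ⟨hsI, hzR⟩ (T, z) ⟨⟨hT.le, le_rfl⟩, hzR⟩ hdist
    simp only [hterm, Pi.zero_apply, dist_zero_right, Real.norm_eq_abs] at hsmall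
    exact hsmall.le.trans (le_mul_of_one_le_right hε.le (one_le_weight κ z))

section

variable {q : FrozenCoeff d} {T B : ℝ} {v : ℝ → Space d → ℝ} {P F : ℝ → SmoothFn d}

theorem abs_sub_add_le_barrier {κ ε r : ℝ} (hq : q.BoundedOn B (Icc 0 r)) (hr : r < T)
    (hκ : 0 ≤ κ) (hε : 0 ≤ ε)
    (hv : IsC12On 0 r v fun t => -(genFn q t (v t) + (F t : Space d → ℝ)))
    (hgrowth : HasExpGrowthOn (Icc 0 r) v)
    (hsmall : ∀ z, |v r z| ≤ ε * weight κ z)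
    (hP : IsRegularPath T P fun t => -(genOp q t (P t) + F t))
    {Q : ℝ → SmoothFn d} (hQ : IsRegularSol q T Q) (hQP : Q r = P r) {t : ℝ} (ht : t ∈ Icc 0 r)
    (z : Space d) :
    |v t z - (P t : Space d → ℝ) z + (Q t : Space d → ℝ) z| ≤ ε * barrier B κ r t z := by
  have hU : IsRegularPath T (fun t => P t - Q t) fun t => -(genOp q t (P t - Q t) + F t) := by
    convert hP.add (hQ.const_smul (-1)) using 2 with t t
    · module
    · rw [map_sub]
      module
  have hU' : IsC12On 0 r (fun t => ((P t - Q t : SmoothFn d) : Space d → ℝ))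
      fun t => -(genFn q t (P t - Q t : SmoothFn d) + (F t : Space d → ℝ)) := by
    simp only [← coe_genOp]
    exact hU.isC12On hr
  have hbound := abs_le_barrier_of_solution hq hκ hε (hv.sub_of_solution hU')
    (hgrowth.sub (hU.hasExpGrowthOn hr)) (fun z => by simpa [hQP] using hsmall z) t ht z
  simpa [sub_sub_eq_add_sub, add_sub_right_comm] using hbound

/-- A Duhamel principle: the solution `v` with zero terminal values is `P`, provided that the
solutions `Q r` of the homogeneous equation which agree with `P` at time `r` vanish as `r → T`. -/
theorem eq_of_tendsto_homogeneous (hT : 0 < T) (hq : q.BoundedOn B (Icc 0 T))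
    (hv : IsC12On 0 T v fun t => -(genFn q t (v t) + (F t : Space d → ℝ)))
    (hgrowth : HasExpGrowthOn (Icc 0 T) v) (hterm : v T = 0)
    (hP : IsRegularPath T P fun t => -(genOp q t (P t) + F t))
    {Q : ℝ → ℝ → SmoothFn d} (hQ : ∀ r, IsRegularSol q T (Q r)) (hQP : ∀ r, Q r r = P r)
    {t : ℝ} (ht : t ∈ Ico 0 T) {z : Space d}
    (hlim : Tendsto (fun r => (Q r t : Space d → ℝ) z) (𝓝[<] T) (𝓝 0)) :
    v t z = (P t : Space d → ℝ) z := by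
  have hB : 0 ≤ B := (abs_nonneg _).trans (hq.rate T ⟨hT.le, le_rfl⟩)
  obtain ⟨K, c, -, hc, hKc⟩ := hgrowth.exists_nonneg
  have hκ : 0 ≤ c + 1 := by positivity
  have hlim' : Tendsto (fun r => |v t z - (P t : Space d → ℝ) z + (Q r t : Space d → ℝ) z|)
      (𝓝[<] T) (𝓝 |v t z - (P t : Space d → ℝ) z|) := by
    simpa using (hlim.const_add (v t z - (P t : Space d → ℝ) z)).abs
  have hbound : ∀ ε > 0, |v t z - (P t : Space d → ℝ) z| ≤ ε * barrier B (c + 1) T t z := by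
    intro ε hε
    refine le_of_tendsto hlim' ?_
    filter_upwards [eventually_abs_le_weight hT hv.continuousOn hKc hκ (lt_add_one c) hterm hε,
      Ioo_mem_nhdsLT ht.2] with r hsmall hr
    have hrT : Icc 0 r ⊆ Icc 0 T := Icc_subset_Icc_right hr.2.le
    refine (abs_sub_add_le_barrier (hq.mono hrT) hr.2 hκ hε.le (hv.mono_right hr.2.le)
      (hgrowth.mono hrT) hsmall hP (hQ r) (hQP r) ⟨ht.1, hr.1.le⟩ z).trans ?_
    exact mul_le_mul_of_nonneg_left (barrier_mono_right hB hκ hr.2.le z) hε.le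
  have hβ := barrier_pos B (c + 1) T t z
  refine sub_eq_zero.1 (abs_nonpos_iff.1 (le_of_forall_pos_le_add fun ε hε => ?_))
  simpa [div_mul_cancel₀ _ hβ.ne'] using hbound _ (div_pos hε hβ)

theorem eq_smoothLOp_of_solution {b : TaylorData d} {V : ℝ → SmoothFn d} (hT : 0 < T)
    (hq : q.BoundedOn B (Icc 0 T)) (hV : IsRegularSol q T V) {n : ℕ} (hn : 1 ≤ n)
    (hv : IsC12On 0 T v fun t => -(genFn q t (v t) +
      (∑ m ∈ Finset.Icc 1 n,
        smoothGOp q b m t t (smoothLOp q b T (n - m) t t (V t)) : SmoothFn d)))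
    (hgrowth : HasExpGrowthOn (Icc 0 T) v) (hterm : v T = 0) {t : ℝ} (ht : t ∈ Ico 0 T) :
    v t = smoothLOp q b T n t t (V t) :=
  funext fun z => eq_of_tendsto_homogeneous hT hq hv hgrowth hterm
    (isRegularPath_smoothLOp hV hn) (fun r => hV.flowAlg (smoothLOp_mem_flowAlg q b T n r))
    (fun _ => rfl) ht ((tendsto_smoothLOp hn T t (V t) z).mono_left nhdsWithin_le_nhds)

end

/-! ### Classical solutions -/

namespace IsFreezing

variable {T : ℝ} {a : MultiIndex d → ℝ → Space d → ℝ} {zbar : ℝ → Space d}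
  {q : FrozenCoeff d} {b : TaylorData d} {V : ℝ → SmoothFn d} {v : ℕ → ℝ → Space d → ℝ}

theorem isC12On (h : IsFreezing T a zbar q b) {f w : ℝ → Space d → ℝ} {φ : Space d → ℝ}
    (hw : IsClassicalSolution T (generatorTerm a zbar 0) f φ w) :
    IsC12On 0 T w fun t => -(genFn q t (w t) + f t) where
  continuousOn := hw.continuousOn
  contDiff := hw.contDiff
  hasDerivWithinAt t ht z := by
    rw [← h.generatorTerm_zero (Ico_subset_Icc_self ht) (hw.contDiff t ht)]
    exact hw.pde t ht z

theorem sourceTerm_eq_coe (h : IsFreezing T a zbar q b) {n : ℕ} {t : ℝ} (ht : t ∈ Icc 0 T)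
    (hv : ∀ k < n, v k t = smoothLOp q b T k t t (V t)) :
    sourceTerm a zbar v n t = (∑ m ∈ Finset.Icc 1 n,
      smoothGOp q b m t t (smoothLOp q b T (n - m) t t (V t)) : SmoothFn d) := by
  ext z
  rw [sourceTerm, SmoothFn.coe_sum]
  refine Finset.sum_congr rfl fun m hm => ?_
  rw [Finset.mem_Icc] at hm
  rw [hv (n - m) (by omega), h.generatorTerm_eq_coe ht]

theorem expansionTerm_eq_coe (h : IsFreezing T a zbar q b) {v₀ : ℝ → Space d → ℝ} {t : ℝ}
    (ht : t ∈ Icc 0 T) (hV : (V t : Space d → ℝ) = v₀ t) (n : ℕ) :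
    expansionTerm a zbar T v₀ n t = smoothLOp q b T n t t (V t) := by
  rcases Nat.eq_zero_or_pos n with rfl | hn
  · simp [expansionTerm, smoothLOp_zero, hV]
  · rw [expansionTerm, if_neg hn.ne', ← hV, h.lOp_eq_coe ht hn]

theorem isLinearDiffOp_lOp (h : IsFreezing T a zbar q b) {n : ℕ} (hn : 1 ≤ n) {t : ℝ}
    (ht : t ∈ Icc 0 T) : IsLinearDiffOp (lOp a zbar n t T) :=
  isLinearDiffOp_of_mem_diffOps (mem_diffOps_of_mem_flowAlg (smoothLOp_mem_flowAlg q b T n t) t)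
    (h.lOp_eq_coe ht hn)

theorem solvesPDE_of_eq_smoothLOp (h : IsFreezing T a zbar q b) (hV : IsRegularSol q T V)
    (hv : ∀ k, ∀ t ∈ Ico 0 T, v k t = smoothLOp q b T k t t (V t)) {n : ℕ} (hn : 1 ≤ n) :
    SolvesPDE T (generatorTerm a zbar 0) (sourceTerm a zbar v n) (v n) := by
  intro t ht z
  have ht' : t ∈ Icc 0 T := Ico_subset_Icc_self ht
  rw [hv n t ht, h.generatorTerm_zero ht' (SmoothFn.contDiff_two _), ← coe_genOp,
    h.sourceTerm_eq_coe ht' fun k _ => hv k t ht]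
  have hder := (isRegularPath_smoothLOp (b := b) hV hn).hasDerivAt 0 t ⟨by linarith [ht.1], ht.2⟩ z
  simp only [ordPow_zero, Module.End.one_apply] at hder
  refine hder.hasDerivWithinAt.congr_of_eventuallyEq ?_ (congrFun (hv n t ht) z)
  filter_upwards [inter_mem_nhdsWithin (Icc 0 T) (Iio_mem_nhds ht.2)] with s hs
  exact congrFun (hv n s ⟨hs.1.1, hs.2⟩) z

theorem eq_smoothLOp_of_isClassicalSolution (h : IsFreezing T a zbar q b) {B : ℝ} (hT : 0 < T)
    (hq : q.BoundedOn B (Icc 0 T)) (hV : IsRegularSol q T V)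
    (hv₀ : ∀ t ∈ Ico 0 T, (V t : Space d → ℝ) = v 0 t) {n : ℕ}
    (hv : ∀ m : ℕ, 1 ≤ m → m ≤ n → IsClassicalSolution T (generatorTerm a zbar 0)
      (sourceTerm a zbar v m) (fun _ => 0) (v m)) :
    ∀ t ∈ Ico 0 T, v n t = smoothLOp q b T n t t (V t) := by
  induction n using Nat.strong_induction_on with
  | _ n ih =>
    rcases Nat.eq_zero_or_pos n with rfl | hn
    · simpa [smoothLOp_zero] using fun t ht => (hv₀ t ht).symm
    · have hsol := hv n hn le_rfl
      have hC12 := h.isC12On hsol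
      have hsource : ∀ t ∈ Ico 0 T, sourceTerm a zbar v n t = _ := fun t ht =>
        h.sourceTerm_eq_coe (Ico_subset_Icc_self ht) fun k hk =>
          ih k hk (fun m hm hmk => hv m hm (hmk.trans hk.le)) t ht
      exact fun t => eq_smoothLOp_of_solution hT hq hV hn ⟨hC12.continuousOn, hC12.contDiff,
        fun t ht z => hsource t ht ▸ hC12.hasDerivWithinAt t ht z⟩ hsol.growth hsol.terminal

end IsFreezing

end PolyExpansion

end

open PolyExpansion in
theorem proposition5p1 (d : ℕ) (T : ℝ) (hT : 0 < T)
    (a : MultiIndex d → ℝ → Space d → ℝ) (zbar : ℝ → Space d)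
    (ha_smooth : ∀ α ∈ indicesLeTwo d, ∀ t ∈ Icc 0 T, ContDiff ℝ ∞ (a α t))
    (ha_cont : ∀ α ∈ indicesLeTwo d, ∀ η : MultiIndex d,
      ContinuousOn (fun t => multiDeriv η (a α t) (zbar t)) (Icc 0 T))
    (hzbar : ContinuousOn zbar (Icc 0 T))
    (hC : ∀ t s : ℝ, 0 ≤ t → t < s → s ≤ T → (covInt a zbar t s).PosDef)
    (φ : Space d → ℝ) (v : ℕ → ℝ → Space d → ℝ)
    (hv₀ : IsClassicalSolution T (generatorTerm a zbar 0) (fun _ _ => 0) φ (v 0)) :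
    -- `v₀(t,·)` is smooth, so that differential operators of any order can be applied to it
    (∀ t ∈ Ico 0 T, ContDiff ℝ ∞ (v 0 t)) ∧
    -- `𝓛_n(t,T)` is a linear differential operator
    (∀ n : ℕ, 1 ≤ n → ∀ t ∈ Ico 0 T, IsLinearDiffOp (lOp a zbar n t T)) ∧
    -- the functions `𝓛_n(t,T) v₀(t,·)` satisfy the equations of the hierarchy before time `T`
    (∀ n : ℕ, 1 ≤ n →
      SolvesPDE T (generatorTerm a zbar 0) (sourceTerm a zbar (expansionTerm a zbar T (v 0)) n)
        (expansionTerm a zbar T (v 0) n)) ∧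
    -- the solution `v_n` of the hierarchy is `𝓛_n(t,T) v₀`
    (∀ n : ℕ, 1 ≤ n →
      (∀ m : ℕ, 1 ≤ m → m ≤ n →
        IsClassicalSolution T (generatorTerm a zbar 0) (sourceTerm a zbar v m) (fun _ => 0)
          (v m)) →
      ∀ t ∈ Ico 0 T, ∀ z : Space d, v n t z = lOp a zbar n t T (v 0 t) z) := by
  obtain ⟨q, b, h⟩ := exists_isFreezing hT ha_cont hzbar hC
  obtain ⟨B, hq⟩ := q.exists_boundedOn (isCompact_Icc (a := (-1 : ℝ)) (b := T))
  have hv₀C12 : IsC12On 0 T (v 0) fun t => -genFn q t (v 0 t) := by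
    simpa [← Pi.zero_def] using h.isC12On hv₀
  obtain ⟨V, hV, hVv⟩ := exists_isRegularSol_eq hT hq (h.covInt_posDef hC) hv₀C12 hv₀.growth
  have hIco : ∀ t ∈ Ico 0 T, t ∈ Icc 0 T := fun t ht => Ico_subset_Icc_self ht
  refine ⟨fun t ht => ?_, fun n hn t ht => h.isLinearDiffOp_lOp hn (hIco t ht), fun n hn => ?_,
    fun n hn hv t ht z => ?_⟩
  · rw [← hVv t ht]
    exact (V t).contDiff
  · exact h.solvesPDE_of_eq_smoothLOp hV
      (fun k t ht => h.expansionTerm_eq_coe (hIco t ht) (hVv t ht) k) hn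
  · have hq₀ : q.BoundedOn B (Icc 0 T) := hq.mono (Icc_subset_Icc_left (by norm_num))
    rw [h.eq_smoothLOp_of_isClassicalSolution hT hq₀ hV hVv hv t ht, ← hVv t ht,
      h.lOp_eq_coe (hIco t ht) hn]
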